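/- **Setting.** Let $-\infty\le \ell_-<0<\ell_+\le\infty$, $\Omega_0=(\ell_-,\ell_+)$, $\alpha>0$, $0<\beta<\tfrac12$, $\gamma>0$, and let $V_0\in L^\infty(\Omega_0)$ be real-valued with $V_0\ge 0$ a.e. Let $\varepsilon_0$ satisfy $$\varepsilon_0<\min\{(2\gamma)^{-1/\alpha},|\ell_-|,\ell_+\},\qquad \varepsilon_0<\gamma^{-1/(\alpha+1-\beta)},\qquad \varepsilon_0<\min\{\gamma,\gamma^{-1}\}.$$ For $0<\varepsilon\le\varepsilon_0$ put $d_\varepsilon=\gamma\varepsilon^{\alpha+1}$, $h_\varepsilon=\varepsilon^\alpha$, $b_\varepsilon=\varepsilon^\beta$ and $$S_\varepsilon=\Omega_0\times(-\varepsilon,0),\quad P_\varepsilon=\{|x_1|<\tfrac{d_\varepsilon}2,\ 0<x_2<h_\varepsilon\},\quad R_\varepsilon=\{|x_1|<\tfrac{b_\varepsilon}2,\ h_\varepsilon<x_2<h_\varepsilon+b_\varepsilon\},$$ $\Omega_\varepsilon=\operatorname{int}\overline{S_\varepsilon\cup P_\varepsilon\cup R_\varepsilon}\subset\mathbb R^2$.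 Let $V_\varepsilon(x)=V_0(x_1)$ on $S_\varepsilon$ and $V_\varepsilon=0$ on $P_\varepsilon\cup R_\varepsilon$. Let $\mathcal A_\varepsilon$ be the operator in $\mathcal H_\varepsilon=L^2(\Omega_\varepsilon)$ associated with the form $$\mathfrak a_\varepsilon[u,v]=\int_{\Omega_\varepsilon}\bigl(\nabla u\cdot\overline{\nabla v}+V_\varepsilon u\overline v\bigr)\,dx,\qquad \operatorname{dom}\mathfrak a_\varepsilon=H^1(\Omega_\varepsilon),$$ (that is, $-\Delta+V_\varepsilon$ with Neumann boundary conditions), and let $\mathcal A_0$ be the operator in $\mathcal H_0=L^2(\Omega_0)\oplus\mathbb C$ associated with the form $$\mathfrak a_0[f,g]=\int_{\Omega_0}\bigl(f_1'\overline{g_1'}+V_0f_1\overline{g_1}\bigr)\,dx+\gamma f_1(0)\overline{g_1(0)},\qquad \operatorname{dom}\mathfrak a_0=H^1(\Omega_0)\times\mathbb C,$$ (that is, the direct sum of the one-dimensional Schrödinger operator with a $\delta$-interaction of strength $\gamma$ at $0$ and Neumann conditions at finite end points, and of the zero operator on $\mathbb C$). Put $\mathcal R_\varepsilon=(\mathcal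 A_\varepsilon+I)^{-1}$ and $\mathcal R_0=(\mathcal A_0+I)^{-1}$. Define $J_\varepsilon:\mathcal H_0\to\mathcal H_\varepsilon$ and $\widetilde J_\varepsilon:\mathcal H_\varepsilon\to\mathcal H_0$ by $$J_\varepsilon f=\begin{cases}\varepsilon^{-1/2}f_1(x_1)&\text{on }S_\varepsilon,\\ 0&\text{on }P_\varepsilon,\\ b_\varepsilon^{-1}f_2&\text{on }R_\varepsilon,\end{cases}\qquad \widetilde J_\varepsilon u=\Bigl(x_1\mapsto\varepsilon^{-1/2}\int_{-\varepsilon}^0u(x_1,x_2)\,dx_2,\ \ b_\varepsilon^{-1}\int_{R_\varepsilon}u\,dx\Bigr).$$ **Theorem 2.1.** The resolvents $\mathcal R_\varepsilon$ and $\mathcal R_0$ exist as bounded everywhere defined operators, and $$\|\mathcal R_\varepsilon J_\varepsilon-J_\varepsilon\mathcal R_0\|_{\mathcal H_0\to\mathcal H_\varepsilon}=\|\widetilde J_\varepsilon\mathcal R_\varepsilon-\mathcal R_0\widetilde J_\varepsilon\|_{\mathcal H_\varepsilon\to\mathcal H_0}\le C_1\,\varepsilon^{\min\{\alpha,\,1/2-\beta\}}$$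 for all $\varepsilon\in(0,\varepsilon_0]$, where the constant $C_1>0$ is independent of $\varepsilon$. More precisely, $C_1$ depends only on an upper bound for $\alpha$, $\beta^{-1}$, $\gamma$, $\|V_0\|_{L^\infty(\Omega_0)}$ and $\ell^{-1}$, where $\ell=\min\{|\ell_-|,\ell_+\}$: for every real $K$ there is $C_1=C_1(K)>0$ that works for all data for which these five quantities are at most $K$. -/

import Mathlib

open MeasureTheory Set
open scoped ContDiff ENNReal ComplexConjugate

noncomputable section

namespace RoomPassage

/-! ### Lebesgue and Sobolev spaces on open sets -/

section Sobolev

variable {E : Type*} [NormedAddCommGroup E] [NormedSpace ℝ E] [MeasureSpace E]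

/-- The complex Hilbert space `L²(Ω)` with respect to Lebesgue measure. -/
abbrev L2 (Ω : Set E) : Type _ := Lp ℂ 2 (volume.restrict Ω)

/-- `g` is the weak (distributional) derivative of `u` on the open set `Ω` in the direction `v`. -/
def HasWeakDeriv (Ω : Set E) (v : E) (u g : L2 Ω) : Prop :=
  ∀ φ : E → ℝ, ContDiff ℝ ∞ φ → HasCompactSupport φ → tsupport φ ⊆ Ω →
    ∫ x in Ω, (fderiv ℝ φ x v) • u x = - ∫ x in Ω, φ x • g x

/-- The Sobolev space `H¹(Ω)`: all weak directional derivatives exist and belong to `L²(Ω)`. -/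
def H1 (Ω : Set E) : Set (L2 Ω) :=
  {u | ∀ v : E, ∃ g : L2 Ω, HasWeakDeriv Ω v u g}

open scoped Classical in
/-- The weak derivative of `u` in the direction `v` as an element of `L²(Ω)` (unique when it
exists, for open `Ω`; it is only used for `u ∈ H¹(Ω)`). -/
def weakDeriv (Ω : Set E) (v : E) (u : L2 Ω) : L2 Ω :=
  if h : ∃ g : L2 Ω, HasWeakDeriv Ω v u g then h.choose else 0

end Sobolev

open scoped Classical in
/-- The value at `x ∈ Ω` of the continuous representative of (the class of) `f`; for open `Ω ⊆ ℝ`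
this representative is unique on `Ω`, and it exists for `f ∈ H¹(Ω)`. -/
def pointValue (Ω : Set ℝ) (f : L2 Ω) (x : ℝ) : ℂ :=
  if h : ∃ g : ℝ → ℂ, ContinuousOn g Ω ∧ f =ᵐ[volume.restrict Ω] g then h.choose x else 0

/-! ### Operators associated with sesquilinear forms, and resolvents -/

section Forms

variable {H : Type*} [NormedAddCommGroup H] [InnerProductSpace ℂ H]

/-- The graph of the operator `A` associated with the sesquilinear form `a` (linear in the first
argument) with form domain `D`: `u ∈ dom A` and `A u = w` iff `u ∈ D` and `(w, v) = a[u, v]` for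
all `v ∈ D`. Mathlib's inner product is linear in its second argument. -/
def operatorGraph (D : Set H) (a : H → H → ℂ) : Set (H × H) :=
  {p | p.1 ∈ D ∧ ∀ v ∈ D, inner ℂ v p.2 = a p.1 v}

/-- The bounded operator `R` is `(A + I)⁻¹` for the operator `A` with graph `G`:
`R f = u` iff `u ∈ dom A` and `A u + u = f`. -/
def IsResolvent (G : Set (H × H)) (R : H →L[ℂ] H) : Prop :=
  ∀ f u : H, R f = u ↔ (u, f - u) ∈ G

theorem IsResolvent.unique {G : Set (H × H)} {R R' : H →L[ℂ] H}
    (h : IsResolvent G R) (h' : IsResolvent G R') : R = R' := by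
  ext f
  exact ((h' f (R f)).2 ((h f (R f)).1 rfl)).symm

open scoped Classical in
/-- The resolvent `(A + I)⁻¹` of the operator with graph `G`, when it exists as a bounded
everywhere defined operator. -/
def formResolvent (G : Set (H × H)) : H →L[ℂ] H :=
  if h : ∃ R : H →L[ℂ] H, IsResolvent G R then h.choose else 0

end Forms

/-! ### The geometry -/

/-- The interval `Ω₀ = (ℓ₋, ℓ₊)`, bounded or not. -/
def interval (lm lp : EReal) : Set ℝ := {x | lm < (x : EReal) ∧ (x : EReal) < lp}

/-- The straight strip `Ω₀ × (-ε, 0)`. -/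
def strip (lm lp : EReal) (ε : ℝ) : Set (ℝ × ℝ) := interval lm lp ×ˢ Ioo (-ε) 0

/-- The passage of width `d` and height `h`. -/
def passage (d h : ℝ) : Set (ℝ × ℝ) := {x | |x.1| < d / 2 ∧ 0 < x.2 ∧ x.2 < h}

/-- The room, a square of side length `b` on top of the passage of height `h`. -/
def room (h b : ℝ) : Set (ℝ × ℝ) := {x | |x.1| < b / 2 ∧ h < x.2 ∧ x.2 < h + b}

/-- The waveguide: strip, passage and room glued together. -/
def waveguide (lm lp : EReal) (ε d h b : ℝ) : Set (ℝ × ℝ) :=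
  interior (closure (strip lm lp ε ∪ passage d h ∪ room h b))

theorem isOpen_interval (lm lp : EReal) : IsOpen (interval lm lp) :=
  (isOpen_lt continuous_const continuous_coe_real_ereal).inter
    (isOpen_lt continuous_coe_real_ereal continuous_const)

theorem isOpen_strip (lm lp : EReal) (ε : ℝ) : IsOpen (strip lm lp ε) :=
  (isOpen_interval lm lp).prod isOpen_Ioo

theorem isOpen_passage (d h : ℝ) : IsOpen (passage d h) :=
  (isOpen_lt (continuous_abs.comp continuous_fst) continuous_const).inter
    ((isOpen_lt continuous_const continuous_snd).inter (isOpen_lt continuous_snd continuous_const))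

theorem isOpen_room (h b : ℝ) : IsOpen (room h b) :=
  (isOpen_lt (continuous_abs.comp continuous_fst) continuous_const).inter
    ((isOpen_lt continuous_const continuous_snd).inter (isOpen_lt continuous_snd continuous_const))

theorem union_subset_waveguide (lm lp : EReal) (ε d h b : ℝ) :
    strip lm lp ε ∪ passage d h ∪ room h b ⊆ waveguide lm lp ε d h b :=
  interior_maximal subset_closure
    (((isOpen_strip lm lp ε).union (isOpen_passage d h)).union (isOpen_room h b))

theorem strip_subset (lm lp : EReal) (ε d h b : ℝ) :
    strip lm lp ε ⊆ waveguide lm lp ε d h b := fun _ hx =>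
  union_subset_waveguide lm lp ε d h b (Or.inl (Or.inl hx))

theorem room_subset (lm lp : EReal) (ε d h b : ℝ) :
    room h b ⊆ waveguide lm lp ε d h b := fun _ hx =>
  union_subset_waveguide lm lp ε d h b (Or.inr hx)

theorem volume_room_lt_top (h b : ℝ) : volume (room h b) < ⊤ := by
  have hsub : room h b ⊆ Icc (-(b / 2)) (b / 2) ×ˢ Icc h (h + b) := by
    rintro x ⟨h1, h2, h3⟩
    have := abs_lt.1 h1
    exact ⟨⟨this.1.le, this.2.le⟩, ⟨h2.le, h3.le⟩⟩
  exact (measure_mono hsub).trans_lt (isCompact_Icc.prod isCompact_Icc).measure_lt_top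

/-! ### The forms and the operators -/

open scoped Classical in
/-- The potential on the waveguide: `V₀(x₁)` on the strip, zero on passage and room. -/
def potential (lm lp : EReal) (ε : ℝ) (V₀ : ℝ → ℝ) (x : ℝ × ℝ) : ℝ :=
  if x ∈ strip lm lp ε then V₀ x.1 else 0

/-- The form `∫_Ω (∇u · conj ∇v + V u conj v)` on a planar domain; its domain is `H¹(Ω)`. -/
def planarForm (Ω : Set (ℝ × ℝ)) (V : ℝ × ℝ → ℝ) (u v : L2 Ω) : ℂ :=
  ∫ x in Ω, (weakDeriv Ω (1, 0) u x * conj (weakDeriv Ω (1, 0) v x)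
    + weakDeriv Ω (0, 1) u x * conj (weakDeriv Ω (0, 1) v x)
    + (V x : ℂ) * u x * conj (v x))

/-- The graph of `-Δ_Neumann + V` on a planar domain. -/
def neumannGraph (Ω : Set (ℝ × ℝ)) (V : ℝ × ℝ → ℝ) : Set (L2 Ω × L2 Ω) :=
  operatorGraph (H1 Ω) (planarForm Ω V)

/-- The limit Hilbert space `L²(Ω₀) ⊕ ℂ` with its Hilbert sum inner product. -/
abbrev LimitSpace (Ω₀ : Set ℝ) : Type := WithLp 2 (L2 Ω₀ × ℂ)

/-- The form domain `H¹(Ω₀) × ℂ`. -/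
def limitDomain (Ω₀ : Set ℝ) : Set (LimitSpace Ω₀) := {f | f.fst ∈ H1 Ω₀}

/-- The form `∫ (f₁' conj g₁' + V₀ f₁ conj g₁) + γ f₁(0) conj g₁(0)` on `H¹(Ω₀) × ℂ`. -/
def limitForm (Ω₀ : Set ℝ) (V₀ : ℝ → ℝ) (γ : ℝ) (f g : LimitSpace Ω₀) : ℂ :=
  (∫ x in Ω₀, (weakDeriv Ω₀ 1 f.fst x * conj (weakDeriv Ω₀ 1 g.fst x)
    + (V₀ x : ℂ) * f.fst x * conj (g.fst x)))
    + (γ : ℂ) * pointValue Ω₀ f.fst 0 * conj (pointValue Ω₀ g.fst 0)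

/-- The graph of the limit operator: the Schrödinger operator with a `δ`-interaction of strength
`γ` at `0`, plus the zero operator on `ℂ`. -/
def limitGraph (Ω₀ : Set ℝ) (V₀ : ℝ → ℝ) (γ : ℝ) : Set (LimitSpace Ω₀ × LimitSpace Ω₀) :=
  operatorGraph (limitDomain Ω₀) (limitForm Ω₀ V₀ γ)

/-! ### The identification operators -/

section Identification

theorem restrict_strip (lm lp : EReal) (ε : ℝ) :
    (volume : Measure (ℝ × ℝ)).restrict (strip lm lp ε) =
      ((volume : Measure ℝ).restrict (interval lm lp)).prod (volume.restrict (Ioo (-ε) 0)) := by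
  rw [strip, Measure.volume_eq_prod, Measure.prod_restrict]

theorem restrict_strip_le (lm lp : EReal) (ε d h b : ℝ) :
    (volume : Measure (ℝ × ℝ)).restrict (strip lm lp ε) ≤
      volume.restrict (waveguide lm lp ε d h b) :=
  Measure.restrict_mono (strip_subset lm lp ε d h b) le_rfl

theorem restrict_room_le (lm lp : EReal) (ε d h b : ℝ) :
    (volume : Measure (ℝ × ℝ)).restrict (room h b) ≤
      volume.restrict (waveguide lm lp ε d h b) :=
  Measure.restrict_mono (room_subset lm lp ε d h b) le_rfl

theorem eLpNorm_comp_fst {μ ν : Measure ℝ} [SFinite μ] [IsFiniteMeasure ν] {f : ℝ → ℂ}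
    (hf : AEStronglyMeasurable f μ) :
    eLpNorm (fun x : ℝ × ℝ => f x.1) 2 (μ.prod ν) = (ν univ) ^ (1 / 2 : ℝ) * eLpNorm f 2 μ := by
  have h1 : eLpNorm (f ∘ Prod.fst) 2 (μ.prod ν) =
      eLpNorm f 2 (Measure.map Prod.fst (μ.prod ν)) := by
    refine (eLpNorm_map_measure ?_ measurable_fst.aemeasurable).symm
    rw [Measure.map_fst_prod]
    exact hf.smul_measure _
  change eLpNorm (f ∘ Prod.fst) 2 (μ.prod ν) = _
  rw [h1, Measure.map_fst_prod, eLpNorm_smul_measure_of_ne_top (by simp)]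
  simp

theorem eLpNorm_section_integral_le {μ ν : Measure ℝ} [SFinite μ] [IsFiniteMeasure ν]
    {u : ℝ × ℝ → ℂ} (hu : AEStronglyMeasurable u (μ.prod ν)) :
    eLpNorm (fun x => ∫ y, u (x, y) ∂ν) 2 μ ≤
      (ν univ) ^ (1 / 2 : ℝ) * eLpNorm u 2 (μ.prod ν) := by
  have hsq : ∀ᵐ x ∂μ, ‖∫ y, u (x, y) ∂ν‖ₑ ^ (2 : ℝ) ≤ ν univ * ∫⁻ y, ‖u (x, y)‖ₑ ^ (2 : ℝ) ∂ν := by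
    filter_upwards [hu.prodMk_left] with x hx
    have h1 : ‖∫ y, u (x, y) ∂ν‖ₑ ≤ eLpNorm (fun y => u (x, y)) 1 ν := by
      rw [eLpNorm_one_eq_lintegral_enorm]
      exact enorm_integral_le_lintegral_enorm _
    have h2 := eLpNorm_le_eLpNorm_mul_rpow_measure_univ (p := 1) (q := 2) (by norm_num) hx
    have h3 := ENNReal.rpow_le_rpow (h1.trans h2) (z := 2) (by norm_num)
    refine h3.trans (le_of_eq ?_)
    rw [ENNReal.mul_rpow_of_nonneg _ _ (by norm_num), ← ENNReal.rpow_mul,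
      eLpNorm_eq_lintegral_rpow_enorm_toReal (by norm_num) (by norm_num), ← ENNReal.rpow_mul]
    norm_num
    rw [mul_comm]
  rw [eLpNorm_eq_lintegral_rpow_enorm_toReal (by norm_num) (by norm_num),
    eLpNorm_eq_lintegral_rpow_enorm_toReal (by norm_num) (by norm_num),
    ENNReal.toReal_ofNat, ← ENNReal.mul_rpow_of_nonneg _ _ (by norm_num)]
  refine ENNReal.rpow_le_rpow ?_ (by norm_num)
  rw [lintegral_prod _ (hu.enorm.pow_const _),
    ← lintegral_const_mul' _ _ (measure_ne_top _ _)]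
  exact lintegral_mono_ae hsq

variable (lm lp : EReal) (ε d h b : ℝ)

/-- The function `(x₁, x₂) ↦ ε^{-1/2} f(x₁)` on the strip, extended by zero. -/
def liftFun (f : ℝ → ℂ) : ℝ × ℝ → ℂ :=
  (strip lm lp ε).indicator fun x => ((ε ^ (-(1 / 2) : ℝ) : ℝ) : ℂ) * f x.1

theorem eLpNorm_liftFun {f : ℝ → ℂ} (hf : MemLp f 2 (volume.restrict (interval lm lp))) :
    eLpNorm (liftFun lm lp ε f) 2 (volume.restrict (waveguide lm lp ε d h b)) =
      ‖((ε ^ (-(1 / 2) : ℝ) : ℝ) : ℂ)‖ₑ * ((volume (Ioo (-ε) 0)) ^ (1 / 2 : ℝ) *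
        eLpNorm f 2 (volume.restrict (interval lm lp))) := by
  rw [liftFun, eLpNorm_indicator_eq_eLpNorm_restrict (isOpen_strip lm lp ε).measurableSet,
    Measure.restrict_restrict_of_subset (strip_subset lm lp ε d h b), restrict_strip]
  change eLpNorm (((ε ^ (-(1 / 2) : ℝ) : ℝ) : ℂ) • fun x : ℝ × ℝ => f x.1) 2 _ = _
  rw [eLpNorm_const_smul, eLpNorm_comp_fst hf.1, Measure.restrict_apply_univ]

theorem memLp_liftFun {f : ℝ → ℂ} (hf : MemLp f 2 (volume.restrict (interval lm lp))) :
    MemLp (liftFun lm lp ε f) 2 (volume.restrict (waveguide lm lp ε d h b)) := by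
  rw [liftFun, memLp_indicator_iff_restrict (isOpen_strip lm lp ε).measurableSet,
    Measure.restrict_restrict_of_subset (strip_subset lm lp ε d h b), restrict_strip]
  exact (hf.comp_fst _).const_mul _

theorem liftFun_congr {f g : ℝ → ℂ} (hfg : f =ᵐ[volume.restrict (interval lm lp)] g) :
    liftFun lm lp ε f =ᵐ[volume.restrict (waveguide lm lp ε d h b)] liftFun lm lp ε g := by
  have h1 : ∀ᵐ x ∂((volume : Measure (ℝ × ℝ)).restrict (strip lm lp ε)), f x.1 = g x.1 := by
    rw [restrict_strip]
    exact Measure.quasiMeasurePreserving_fst.ae hfg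
  rw [ae_restrict_iff' (isOpen_strip lm lp ε).measurableSet] at h1
  filter_upwards [ae_restrict_of_ae h1] with x hx
  by_cases hxs : x ∈ strip lm lp ε
  · simp [liftFun, hxs, hx hxs]
  · simp [liftFun, hxs]

/-- The strip component of the identification operator, `L²(Ω₀) → L²(Ω_ε)`. -/
def liftStrip : L2 (interval lm lp) →L[ℂ] L2 (waveguide lm lp ε d h b) :=
  LinearMap.mkContinuous
    { toFun := fun f => (memLp_liftFun lm lp ε d h b (Lp.memLp f)).toLp _
      map_add' := fun f g => by
        rw [← MemLp.toLp_add, MemLp.toLp_eq_toLp_iff]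
        refine (liftFun_congr lm lp ε d h b (Lp.coeFn_add f g)).trans (ae_of_all _ fun x => ?_)
        by_cases hxs : x ∈ strip lm lp ε <;> simp [liftFun, hxs, mul_add]
      map_smul' := fun c f => by
        rw [RingHom.id_apply, ← MemLp.toLp_const_smul, MemLp.toLp_eq_toLp_iff]
        refine (liftFun_congr lm lp ε d h b (Lp.coeFn_smul c f)).trans (ae_of_all _ fun x => ?_)
        by_cases hxs : x ∈ strip lm lp ε <;> simp [liftFun, hxs, mul_left_comm] }
    ((‖((ε ^ (-(1 / 2) : ℝ) : ℝ) : ℂ)‖ₑ * (volume (Ioo (-ε) 0)) ^ (1 / 2 : ℝ)).toReal)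
    fun f => by
      rw [LinearMap.coe_mk, AddHom.coe_mk, Lp.norm_toLp, eLpNorm_liftFun _ _ _ _ _ _ (Lp.memLp f),
        ← mul_assoc, ENNReal.toReal_mul, Lp.norm_def]

/-- The room component of the identification operator: `c ↦ b⁻¹ c` on the room, zero elsewhere. -/
def liftRoom : ℂ →L[ℂ] L2 (waveguide lm lp ε d h b) :=
  ContinuousLinearMap.toSpanSingleton ℂ
    (indicatorConstLp 2 (isOpen_room h b).measurableSet
      (((Measure.restrict_apply_le _ _).trans_lt (volume_room_lt_top h b)).ne) ((b⁻¹ : ℝ) : ℂ))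

/-- The identification operator `J : L²(Ω₀) ⊕ ℂ → L²(Ω_ε)`: it maps `(f₁, f₂)` to
`ε^{-1/2} f₁(x₁)` on the strip, `0` on the passage and `b⁻¹ f₂` on the room. -/
def J : LimitSpace (interval lm lp) →L[ℂ] L2 (waveguide lm lp ε d h b) :=
  liftStrip lm lp ε d h b ∘L WithLp.fstL 2 ℂ (L2 (interval lm lp)) ℂ +
    liftRoom lm lp ε d h b ∘L WithLp.sndL 2 ℂ (L2 (interval lm lp)) ℂ

theorem J_apply_ae (f : LimitSpace (interval lm lp)) :
    J lm lp ε d h b f =ᵐ[volume.restrict (waveguide lm lp ε d h b)] fun x =>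
      (strip lm lp ε).indicator (fun x => ((ε ^ (-(1 / 2) : ℝ) : ℝ) : ℂ) * f.fst x.1) x +
        (room h b).indicator (fun _ => ((b⁻¹ : ℝ) : ℂ) * f.snd) x := by
  have h1 : liftStrip lm lp ε d h b f.fst =ᵐ[volume.restrict (waveguide lm lp ε d h b)]
      liftFun lm lp ε f.fst :=
    MemLp.coeFn_toLp (memLp_liftFun lm lp ε d h b (Lp.memLp f.fst))
  have hm : MeasurableSet (room h b) := (isOpen_room h b).measurableSet
  have hf : (volume.restrict (waveguide lm lp ε d h b)) (room h b) ≠ ⊤ :=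
    ((Measure.restrict_apply_le _ _).trans_lt (volume_room_lt_top h b)).ne
  have h2 : liftRoom lm lp ε d h b f.snd =ᵐ[volume.restrict (waveguide lm lp ε d h b)]
      (room h b).indicator fun _ => ((b⁻¹ : ℝ) : ℂ) * f.snd := by
    refine (Lp.coeFn_smul f.snd (indicatorConstLp 2 hm hf ((b⁻¹ : ℝ) : ℂ))).trans ?_
    filter_upwards [indicatorConstLp_coeFn (p := 2) (hs := hm) (hμs := hf)
      (c := ((b⁻¹ : ℝ) : ℂ))] with x hx
    rw [Pi.smul_apply, hx]
    by_cases hxr : x ∈ room h b <;> simp [hxr, mul_comm]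
  have h3 := Lp.coeFn_add (liftStrip lm lp ε d h b f.fst) (liftRoom lm lp ε d h b f.snd)
  filter_upwards [h1, h2, h3] with x hx1 hx2 hx3
  change (liftStrip lm lp ε d h b f.fst + liftRoom lm lp ε d h b f.snd :
    L2 (waveguide lm lp ε d h b)) x = _
  rw [hx3, Pi.add_apply, hx1, hx2, liftFun]

/-- The function `x₁ ↦ ε^{-1/2} ∫_{-ε}^0 u(x₁, x₂) dx₂`. -/
def sectionFun (u : ℝ × ℝ → ℂ) (x : ℝ) : ℂ :=
  ((ε ^ (-(1 / 2) : ℝ) : ℝ) : ℂ) * ∫ y in Ioo (-ε) 0, u (x, y)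

theorem memLp_strip (u : L2 (waveguide lm lp ε d h b)) :
    MemLp u 2 (((volume : Measure ℝ).restrict (interval lm lp)).prod
      (volume.restrict (Ioo (-ε) 0))) := by
  rw [← restrict_strip]
  exact (Lp.memLp u).mono_measure (restrict_strip_le lm lp ε d h b)

theorem eLpNorm_sectionFun_le (u : L2 (waveguide lm lp ε d h b)) :
    eLpNorm (sectionFun ε u) 2 (volume.restrict (interval lm lp)) ≤
      ‖((ε ^ (-(1 / 2) : ℝ) : ℝ) : ℂ)‖ₑ * (volume (Ioo (-ε) 0)) ^ (1 / 2 : ℝ) *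
        eLpNorm u 2 (volume.restrict (waveguide lm lp ε d h b)) := by
  change eLpNorm (((ε ^ (-(1 / 2) : ℝ) : ℝ) : ℂ) • fun x => ∫ y in Ioo (-ε) 0, u (x, y)) 2 _ ≤ _
  rw [eLpNorm_const_smul, mul_assoc]
  gcongr
  refine (eLpNorm_section_integral_le (memLp_strip lm lp ε d h b u).1).trans ?_
  rw [Measure.restrict_apply_univ, ← restrict_strip]
  gcongr
  exact strip_subset lm lp ε d h b

theorem memLp_sectionFun (u : L2 (waveguide lm lp ε d h b)) :
    MemLp (sectionFun ε u) 2 (volume.restrict (interval lm lp)) := by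
  refine ⟨(memLp_strip lm lp ε d h b u).1.integral_prod_right'.const_mul _, ?_⟩
  refine (eLpNorm_sectionFun_le lm lp ε d h b u).trans_lt ?_
  refine ENNReal.mul_lt_top (ENNReal.mul_lt_top enorm_lt_top ?_) (Lp.eLpNorm_lt_top u)
  exact ENNReal.rpow_lt_top_of_nonneg (by norm_num) (by simp)

theorem sectionFun_congr {u v : ℝ × ℝ → ℂ}
    (huv : u =ᵐ[volume.restrict (waveguide lm lp ε d h b)] v) :
    sectionFun ε u =ᵐ[volume.restrict (interval lm lp)] sectionFun ε v := by
  have h1 : u =ᵐ[volume.restrict (strip lm lp ε)] v :=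
    ae_mono (restrict_strip_le lm lp ε d h b) huv
  rw [restrict_strip] at h1
  filter_upwards [Measure.ae_ae_of_ae_prod h1] with x hx
  rw [sectionFun, sectionFun, integral_congr_ae hx]

theorem ae_integrable_section (u : L2 (waveguide lm lp ε d h b)) :
    ∀ᵐ x ∂(volume.restrict (interval lm lp)),
      Integrable (fun y => u (x, y)) (volume.restrict (Ioo (-ε) 0)) := by
  have hu := memLp_strip lm lp ε d h b u
  filter_upwards [hu.1.prodMk_left, ((memLp_two_iff_integrable_sq_norm hu.1).1 hu).prod_right_ae]
    with x hx1 hx2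
  exact ((memLp_two_iff_integrable_sq_norm hx1).2 hx2).integrable (by norm_num)

/-- The `L²(Ω₀)`-component of the operator `J̃`. -/
def averageStrip : L2 (waveguide lm lp ε d h b) →L[ℂ] L2 (interval lm lp) :=
  LinearMap.mkContinuous
    { toFun := fun u => (memLp_sectionFun lm lp ε d h b u).toLp _
      map_add' := fun u v => by
        rw [← MemLp.toLp_add, MemLp.toLp_eq_toLp_iff]
        refine (sectionFun_congr lm lp ε d h b (Lp.coeFn_add u v)).trans ?_
        filter_upwards [ae_integrable_section lm lp ε d h b u,
          ae_integrable_section lm lp ε d h b v] with x hx1 hx2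
        simp only [sectionFun, Pi.add_apply]
        rw [integral_add hx1 hx2, mul_add]
      map_smul' := fun c u => by
        rw [RingHom.id_apply, ← MemLp.toLp_const_smul, MemLp.toLp_eq_toLp_iff]
        refine (sectionFun_congr lm lp ε d h b (Lp.coeFn_smul c u)).trans (ae_of_all _ fun x => ?_)
        simp only [sectionFun, Pi.smul_apply, smul_eq_mul]
        rw [integral_const_mul, mul_left_comm] }
    ((‖((ε ^ (-(1 / 2) : ℝ) : ℝ) : ℂ)‖ₑ * (volume (Ioo (-ε) 0)) ^ (1 / 2 : ℝ)).toReal)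
    fun u => by
      rw [LinearMap.coe_mk, AddHom.coe_mk, Lp.norm_toLp, Lp.norm_def, ← ENNReal.toReal_mul]
      refine ENNReal.toReal_mono ?_ (eLpNorm_sectionFun_le lm lp ε d h b u)
      refine (ENNReal.mul_lt_top (ENNReal.mul_lt_top enorm_lt_top ?_) (Lp.eLpNorm_lt_top u)).ne
      exact ENNReal.rpow_lt_top_of_nonneg (by norm_num) (by simp)

instance isFiniteMeasure_room : IsFiniteMeasure ((volume : Measure (ℝ × ℝ)).restrict (room h b)) :=
  ⟨by rw [Measure.restrict_apply_univ]; exact volume_room_lt_top h b⟩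

theorem memLp_room (u : L2 (waveguide lm lp ε d h b)) :
    MemLp u 2 ((volume : Measure (ℝ × ℝ)).restrict (room h b)) :=
  (Lp.memLp u).mono_measure (restrict_room_le lm lp ε d h b)

/-- The `ℂ`-component of the operator `J̃`: `u ↦ b⁻¹ ∫_room u`. -/
def averageRoom : L2 (waveguide lm lp ε d h b) →L[ℂ] ℂ :=
  LinearMap.mkContinuous
    { toFun := fun u => ((b⁻¹ : ℝ) : ℂ) * ∫ x in room h b, u x
      map_add' := fun u v => by
        rw [integral_congr_ae (ae_mono (restrict_room_le lm lp ε d h b) (Lp.coeFn_add u v)),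
          ← mul_add]
        congr 1
        exact integral_add ((memLp_room lm lp ε d h b u).integrable (by norm_num))
          ((memLp_room lm lp ε d h b v).integrable (by norm_num))
      map_smul' := fun c u => by
        rw [integral_congr_ae (ae_mono (restrict_room_le lm lp ε d h b) (Lp.coeFn_smul c u))]
        simp only [Pi.smul_apply, smul_eq_mul, RingHom.id_apply]
        rw [integral_const_mul, mul_left_comm] }
    (‖((b⁻¹ : ℝ) : ℂ)‖ * ((volume (room h b)) ^ (1 / 2 : ℝ)).toReal)
    fun u => by
      rw [LinearMap.coe_mk, AddHom.coe_mk, norm_mul, mul_assoc]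
      gcongr
      rw [Lp.norm_def, ← ENNReal.toReal_mul, ← toReal_enorm]
      have hfin : (volume (room h b)) ^ (1 / 2 : ℝ) < ⊤ :=
        ENNReal.rpow_lt_top_of_nonneg (by norm_num) (volume_room_lt_top h b).ne
      refine ENNReal.toReal_mono (ENNReal.mul_lt_top hfin (Lp.eLpNorm_lt_top u)).ne ?_
      have h1 : ‖∫ x in room h b, u x‖ₑ ≤ eLpNorm u 1 (volume.restrict (room h b)) := by
        rw [eLpNorm_one_eq_lintegral_enorm]
        exact enorm_integral_le_lintegral_enorm _
      have h2 := eLpNorm_le_eLpNorm_mul_rpow_measure_univ (p := 1) (q := 2) (by norm_num)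
        (memLp_room lm lp ε d h b u).1
      refine (h1.trans h2).trans ?_
      rw [Measure.restrict_apply_univ, mul_comm]
      norm_num
      gcongr
      exact room_subset lm lp ε d h b

/-- The operator `J̃ : L²(Ω_ε) → L²(Ω₀) ⊕ ℂ`: it maps `u` to the pair of
`x₁ ↦ ε^{-1/2} ∫_{-ε}^0 u(x₁, x₂) dx₂` and `b⁻¹ ∫_room u`. -/
def JTilde : L2 (waveguide lm lp ε d h b) →L[ℂ] LimitSpace (interval lm lp) :=
  (WithLp.prodContinuousLinearEquiv 2 ℂ (L2 (interval lm lp)) ℂ).symm.toContinuousLinearMap ∘L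
    ((averageStrip lm lp ε d h b).prod (averageRoom lm lp ε d h b))

theorem JTilde_fst_ae (u : L2 (waveguide lm lp ε d h b)) :
    (JTilde lm lp ε d h b u).fst =ᵐ[volume.restrict (interval lm lp)] fun x =>
      ((ε ^ (-(1 / 2) : ℝ) : ℝ) : ℂ) * ∫ y in Ioo (-ε) 0, u (x, y) :=
  MemLp.coeFn_toLp (memLp_sectionFun lm lp ε d h b u)

theorem JTilde_snd (u : L2 (waveguide lm lp ε d h b)) :
    (JTilde lm lp ε d h b u).snd = ((b⁻¹ : ℝ) : ℂ) * ∫ x in room h b, u x := rfl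

end Identification

end RoomPassage

end

open RoomPassage

/-! The two norms agree because `JTilde` is the adjoint of `J` and both resolvents are self-adjoint;
only the first is estimated, by duality. Given `f` and `w`, let g be the limit resolvent applied to
`f` and u the waveguide resolvent applied to `w`. The weak equation for g is tested with J̃u. The
one for u is tested with the function j that equals Jg on strip and room and interpolates linearly
in x₂ across the passage P. On the strip the gradient and potential terms cancel exactly, since J
and J̃ are adjoint and commute with ∂₁ and with multiplication by V₀. What survives are integrals
over P, whose area is dh, and one main term

g₁(0) · conj(γ m + h⁻¹ ε^(-1/2) ∫_P ∂₂u), m = (J̃u)₁(0).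

This term explains the δ-interaction. Since h⁻¹ = γ ε / d, the bracket is γ ε^(1/2) times the sum of
d⁻¹ ∫_P ∂₂u and the mean of u over the cross-section of the strip at 0. Now d⁻¹ ∫_P ∂₂u is, up to
O(‖∇u‖), the difference of the means of u over squares of side d at the two ends of P. The Dirichlet
integral in the plane is scale invariant, so doubling the side of a square changes the mean by at
most a constant times ‖∇u‖. About log(1/d) doublings lead to the whole room, where the mean is at
most b⁻¹‖u‖, and to a square as high as the strip, where it is close to the mean over the
cross-section. The two strip means cancel and the main term is of order ε^(1/2) (log(1/ε) + ε^(-β)),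
hence of order ε^(1/2-β). The integrals over P are handled by Cauchy–Schwarz and by sup bounds for
g₁ and g₁' near 0, which follow from g₁'' = g₁ + V₀ g₁ - f₁ on either side of 0; they contribute the
orders ε^α and ε^(1/2-β).

The weight is carried by `norm_rectMean_dyadic_sub_le` and `norm_flux_add_le` (flux),
`hasWeakDeriv_glued_fst` and `hasWeakDeriv_glued_snd` (admissibility of j), `limit_solution_bounds`
(sup bounds) and `formResolvent_spec` (resolvents of closed forms). They meet in
`norm_resolvent_difference_le`. -/

/-! ### Weak derivatives on the line -/

/-- `G` is the weak derivative of `F` on the open set `I ⊆ ℝ`. -/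
def IsWeakDeriv (I : Set ℝ) (F G : ℝ → ℂ) : Prop :=
  ∀ φ : ℝ → ℝ, ContDiff ℝ ∞ φ → HasCompactSupport φ → tsupport φ ⊆ I →
    ∫ x in I, deriv φ x • F x = - ∫ x in I, φ x • G x

theorem setIntegral_smul_of_tsupport_subset {X : Type*} [MeasureSpace X] [TopologicalSpace X]
    {I : Set X} {φ : X → ℝ} (hφ : tsupport φ ⊆ I) (F : X → ℂ) :
    ∫ x in I, φ x • F x = ∫ x, φ x • F x := by
  refine setIntegral_eq_integral_of_forall_compl_eq_zero fun x hx => ?_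
  rw [image_eq_zero_of_notMem_tsupport fun h => hx (hφ h), zero_smul]

theorem exists_Ioo_of_isCompact_subset {I K : Set ℝ} (hI : IsOpen I) (hne : I.Nonempty)
    (hK : IsCompact K) (hKI : K ⊆ I) : ∃ a ∈ I, ∃ b ∈ I, a < b ∧ K ⊆ Ioo a b := by
  obtain ⟨x₀, hx₀⟩ := hne
  have hK' : IsCompact (insert x₀ K) := hK.insert x₀
  have hne' : (insert x₀ K).Nonempty := ⟨x₀, mem_insert _ _⟩
  have hsub : insert x₀ K ⊆ I := insert_subset hx₀ hKI
  obtain ⟨m, hm⟩ := hK'.exists_isLeast hne'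
  obtain ⟨M, hM⟩ := hK'.exists_isGreatest hne'
  obtain ⟨a, ham, haI⟩ : ∃ a < m, a ∈ I := by
    have h : ∀ᶠ a in nhdsWithin m (Iio m), a ∈ I :=
      mem_nhdsWithin_of_mem_nhds (hI.mem_nhds (hsub hm.1))
    obtain ⟨a, h1, h2⟩ := (h.and self_mem_nhdsWithin).exists
    exact ⟨a, h2, h1⟩
  obtain ⟨b, hbM, hbI⟩ : ∃ b > M, b ∈ I := by
    have h : ∀ᶠ b in nhdsWithin M (Ioi M), b ∈ I :=
      mem_nhdsWithin_of_mem_nhds (hI.mem_nhds (hsub hM.1))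
    obtain ⟨a, h1, h2⟩ := (h.and self_mem_nhdsWithin).exists
    exact ⟨a, h2, h1⟩
  refine ⟨a, haI, b, hbI, ?_, fun x hx => ⟨?_, ?_⟩⟩
  · exact ham.trans_le ((hm.2 hM.1).trans hbM.le)
  · exact ham.trans_le (hm.2 (mem_insert_of_mem _ hx))
  · exact (hM.2 (mem_insert_of_mem _ hx)).trans_lt hbM

/-- A smooth function with zero mean, compactly supported in an interval, is the derivative of a
smooth function compactly supported in this interval. -/
theorem exists_deriv_eq_of_integral_eq_zero {I : Set ℝ} (hI : IsOpen I) (hord : I.OrdConnected)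
    (hne : I.Nonempty) {χ : ℝ → ℝ} (hχ : ContDiff ℝ ∞ χ) (hc : HasCompactSupport χ)
    (hs : tsupport χ ⊆ I) (h0 : ∫ x, χ x = 0) :
    ∃ ξ : ℝ → ℝ, ContDiff ℝ ∞ ξ ∧ HasCompactSupport ξ ∧ tsupport ξ ⊆ I ∧ deriv ξ = χ := by
  obtain ⟨a, ha, b, hb, hab, hsub⟩ := exists_Ioo_of_isCompact_subset hI hne hc hs
  have hz : ∀ x, x ∉ Ioo a b → χ x = 0 := fun x hx =>
    image_eq_zero_of_notMem_tsupport fun h => hx (hsub h)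
  have hd : ∀ x, HasDerivAt (fun x => ∫ t in a..x, χ t) (χ x) x := fun x =>
    intervalIntegral.integral_hasDerivAt_right (hχ.continuous.intervalIntegrable _ _)
      (hχ.continuous.stronglyMeasurableAtFilter _ _) hχ.continuous.continuousAt
  have hderiv : deriv (fun x => ∫ t in a..x, χ t) = χ := funext fun x => (hd x).deriv
  have hab0 : ∫ t in a..b, χ t = 0 := by
    rw [intervalIntegral.integral_of_le hab.le, ← h0]
    refine setIntegral_eq_integral_of_forall_compl_eq_zero fun x hx => hz x fun h => hx ?_
    exact ⟨h.1, h.2.le⟩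
  have hout : ∀ x, x ∉ Icc a b → ∫ t in a..x, χ t = 0 := by
    intro x hx
    by_cases hxa : x < a
    · refine (intervalIntegral.integral_congr (g := fun _ => (0 : ℝ)) fun t ht => ?_).trans (by simp)
      rw [uIcc_of_ge hxa.le] at ht
      exact hz t fun h => (ht.2.trans_lt h.1).false
    · have hbx : b < x := by
        by_contra h
        exact hx ⟨not_lt.1 hxa, not_lt.1 h⟩
      rw [← intervalIntegral.integral_add_adjacent_intervals
        (hχ.continuous.intervalIntegrable a b) (hχ.continuous.intervalIntegrable b x), hab0, zero_add]
      refine (intervalIntegral.integral_congr (g := fun _ => (0 : ℝ)) fun t ht => ?_).trans (by simp)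
      rw [uIcc_of_le hbx.le] at ht
      exact hz t fun h => (ht.1.trans_lt h.2).false
  have hsupp : tsupport (fun x => ∫ t in a..x, χ t) ⊆ Icc a b :=
    closure_minimal (fun x hx => by_contra fun h => hx (hout x h)) isClosed_Icc
  refine ⟨_, contDiff_infty_iff_deriv.2 ⟨fun x => (hd x).differentiableAt, ?_⟩,
    isCompact_Icc.of_isClosed_subset (isClosed_tsupport _) hsupp,
    hsupp.trans (hord.out ha hb), hderiv⟩
  rw [hderiv]
  exact hχ

theorem exists_test_integral_eq_one {I : Set ℝ} (hI : IsOpen I) (hne : I.Nonempty) :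
    ∃ ψ : ℝ → ℝ, ContDiff ℝ ∞ ψ ∧ HasCompactSupport ψ ∧ tsupport ψ ⊆ I ∧ ∫ x, ψ x = 1 := by
  obtain ⟨x₀, hx₀⟩ := hne
  obtain ⟨f, hf1, hf2, hf3, hf4, hf5⟩ := exists_contDiff_tsupport_subset (n := ⊤) (hI.mem_nhds hx₀)
  have hpos : 0 < ∫ x, f x := by
    refine (hf3.continuous.integral_pos_of_hasCompactSupport_nonneg_nonzero hf2
      (fun x => (hf4 ⟨x, rfl⟩).1) (x := x₀) ?_)
    rw [hf5]
    exact one_ne_zero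
  refine ⟨fun x => (∫ x, f x)⁻¹ * f x, contDiff_const.mul hf3, hf2.mul_left,
    (closure_mono (Function.support_const_smul_subset (∫ x, f x)⁻¹ f)).trans hf1, ?_⟩
  rw [integral_const_mul, inv_mul_cancel₀ hpos.ne']

theorem integrable_test_smul {X : Type*} [TopologicalSpace X] [T2Space X]
    [MeasurableSpace X] [BorelSpace X] [SecondCountableTopology X]
    {μ : Measure X} {I : Set X} {F : X → ℂ} (hF : LocallyIntegrableOn F I μ)
    {φ : X → ℝ} (hφ : Continuous φ) (hc : HasCompactSupport φ) (hs : tsupport φ ⊆ I) :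
    Integrable (fun x => φ x • F x) μ := by
  have h1 : IntegrableOn F (tsupport φ) μ := hF.integrableOn_compact_subset hs hc
  have h2 : IntegrableOn (fun x => φ x • F x) (tsupport φ) μ :=
    h1.continuousOn_smul hφ.continuousOn hc
  refine (integrableOn_iff_integrable_of_support_subset fun x hx => ?_).1 h2
  by_contra h
  exact hx (by simp [image_eq_zero_of_notMem_tsupport h])

theorem tsupport_deriv_subset' (φ : ℝ → ℝ) : tsupport (deriv φ) ⊆ tsupport φ :=
  closure_minimal (support_deriv_subset) (isClosed_tsupport _)

/-- The du Bois-Reymond argument: subtracting from a test function `χ` the multiple `(∫ χ) ψ` of a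
fixed one of unit mass leaves a function of mean zero, hence the derivative of a test function,
which `F` annihilates. So `F - ∫ ψ F` annihilates every test function. -/
theorem IsWeakDeriv.ae_const {I : Set ℝ} (hI : IsOpen I) (hord : I.OrdConnected) {F : ℝ → ℂ}
    (hF : LocallyIntegrableOn F I) (h : IsWeakDeriv I F 0) :
    ∃ c : ℂ, ∀ᵐ x ∂(volume.restrict I), F x = c := by
  rcases I.eq_empty_or_nonempty with rfl | hne
  · exact ⟨0, by simp⟩
  obtain ⟨ψ, hψ, hψc, hψs, hψ1⟩ := exists_test_integral_eq_one hI hne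
  refine ⟨∫ x, ψ x • F x, ?_⟩
  rw [ae_restrict_iff' hI.measurableSet]
  have hFc : LocallyIntegrableOn (fun x => F x - ∫ x, ψ x • F x) I :=
    hF.sub ((locallyIntegrable_const _).locallyIntegrableOn _)
  suffices hz : ∀ χ : ℝ → ℝ, ContDiff ℝ ∞ χ → HasCompactSupport χ → tsupport χ ⊆ I →
      ∫ x, χ x • (F x - ∫ x, ψ x • F x) = 0 by
    filter_upwards [hI.ae_eq_zero_of_integral_contDiff_smul_eq_zero hFc hz] with x hx hxI
    exact sub_eq_zero.1 (hx hxI)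
  intro χ hχ hχc hχs
  have hint : Integrable χ := hχ.continuous.integrable_of_hasCompactSupport hχc
  have hintψ : Integrable ψ := hψ.continuous.integrable_of_hasCompactSupport hψc
  have hχF := integrable_test_smul hF hχ.continuous hχc hχs
  have hψF := integrable_test_smul hF hψ.continuous hψc hψs
  have hsupp : tsupport (fun x => χ x - (∫ t, χ t) * ψ x) ⊆ tsupport χ ∪ tsupport ψ := by
    refine closure_minimal (fun x hx => ?_) ((isClosed_tsupport _).union (isClosed_tsupport _))
    by_contra hn
    rw [mem_union, not_or] at hn
    exact hx (by simp [image_eq_zero_of_notMem_tsupport hn.1,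
      image_eq_zero_of_notMem_tsupport hn.2])
  obtain ⟨ξ, hξ, hξc, hξs, hξd⟩ := exists_deriv_eq_of_integral_eq_zero hI hord hne
    (χ := fun x => χ x - (∫ t, χ t) * ψ x) (hχ.sub (contDiff_const.mul hψ))
    ((hχc.isCompact.union hψc.isCompact).of_isClosed_subset (isClosed_tsupport _) hsupp)
    (hsupp.trans (union_subset hχs hψs))
    (by rw [integral_sub hint (hintψ.const_mul _), integral_const_mul, hψ1, mul_one, sub_self])
  have h1 := h ξ hξ hξc hξs
  rw [setIntegral_smul_of_tsupport_subset ((tsupport_deriv_subset' ξ).trans hξs), hξd] at h1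
  simp only [Pi.zero_apply, smul_zero, integral_zero, neg_zero] at h1
  have h2 : ∀ x, (χ x - (∫ t, χ t) * ψ x) • F x = χ x • F x - (∫ t, χ t) • ψ x • F x := by
    intro x
    rw [sub_smul, mul_smul]
  simp only [h2] at h1
  have i2 : Integrable (fun x => (∫ t, χ t) • ψ x • F x) :=
    hψF.fun_smul _
  rw [integral_sub hχF i2, integral_smul] at h1
  simp only [smul_sub]
  rw [integral_sub hχF (hint.smul_const _), integral_smul_const]
  exact h1

theorem MeasureTheory.LocallyIntegrableOn.intervalIntegrable_of_ordConnected {I : Set ℝ}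
    (hord : I.OrdConnected) {G : ℝ → ℂ} (hG : LocallyIntegrableOn G I) {x y : ℝ} (hx : x ∈ I)
    (hy : y ∈ I) : IntervalIntegrable G volume x y :=
  (hG.integrableOn_compact_subset (hord.uIcc_subset hx hy) isCompact_uIcc).intervalIntegrable

/-- Integration by parts for a primitive of a merely locally integrable function: Fubini over a
triangle takes the place of pointwise differentiation. -/
theorem isWeakDeriv_integral {I : Set ℝ} (hI : IsOpen I) (hord : I.OrdConnected) {G : ℝ → ℂ}
    (hG : LocallyIntegrableOn G I) {x₀ : ℝ} (hx₀ : x₀ ∈ I) :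
    IsWeakDeriv I (fun x => ∫ t in x₀..x, G t) G := by
  intro φ hφ hφc hφs
  obtain ⟨a, ha, b, hb, hab, hsub⟩ := exists_Ioo_of_isCompact_subset hI ⟨x₀, hx₀⟩ hφc hφs
  have hii : ∀ x ∈ I, ∀ y ∈ I, IntervalIntegrable G volume x y := fun x hx y hy =>
    hG.intervalIntegrable_of_ordConnected hord hx hy
  have hz : ∀ x, x ∉ Ioo a b → φ x = 0 := fun x hx =>
    image_eq_zero_of_notMem_tsupport fun h => hx (hsub h)
  have hφd : Continuous (deriv φ) := hφ.continuous_deriv (by simp)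
  have hds : tsupport (deriv φ) ⊆ Ioc a b :=
    (tsupport_deriv_subset' φ).trans (hsub.trans Ioo_subset_Ioc_self)
  rw [setIntegral_smul_of_tsupport_subset hφs,
    setIntegral_smul_of_tsupport_subset ((tsupport_deriv_subset' φ).trans hφs),
    ← setIntegral_smul_of_tsupport_subset hds,
    ← setIntegral_smul_of_tsupport_subset (hsub.trans Ioo_subset_Ioc_self)]
  have hft : ∀ t ∈ Icc a b, ∫ x in t..b, deriv φ x = - φ t := by
    intro t ht
    rw [intervalIntegral.integral_deriv_eq_sub (fun x _ => hφ.differentiable (by simp) x)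
      (hφd.intervalIntegrable _ _), hz b (by simp), zero_sub]
  have hGab : IntegrableOn G (Ioc a b) := (hii a ha b hb).1
  have hdab : IntegrableOn (deriv φ) (Ioc a b) := (hφd.intervalIntegrable a b).1
  -- The kernel lives on the triangle `t < x`. Integrated in `t` it yields the primitive starting at
  -- `a`; integrated in `x` it yields `∫_t^b φ' = -φ t`.
  let k : ℝ × ℝ → ℂ := {p : ℝ × ℝ | p.2 < p.1}.indicator fun p => deriv φ p.1 • G p.2
  have hk : Integrable k ((volume.restrict (Ioc a b)).prod (volume.restrict (Ioc a b))) :=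
    (hdab.smul_prod hGab).indicator (measurableSet_lt measurable_snd measurable_fst)
  have e1 : ∫ x in Ioc a b, deriv φ x • ∫ t in x₀..x, G t =
      ∫ x in Ioc a b, ((deriv φ x • ∫ t in x₀..a, G t) + ∫ t in Ioc a b, k (x, t)) := by
    refine setIntegral_congr_fun measurableSet_Ioc fun x hx => ?_
    have hxI : x ∈ I := hord.out ha hb ⟨hx.1.le, hx.2⟩
    rw [← intervalIntegral.integral_add_adjacent_intervals (hii x₀ hx₀ a ha) (hii a ha x hxI),
      smul_add, intervalIntegral.integral_of_le hx.1.le]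
    congr 1
    have : ∀ t, k (x, t) = (Iio x).indicator (fun t => deriv φ x • G t) t := fun t => rfl
    simp only [this]
    rw [setIntegral_indicator measurableSet_Iio, ← integral_smul, ← Measure.restrict_congr_set
      (Ioo_ae_eq_Ioc (a := a) (b := x))]
    congr 2
    ext t
    simp only [mem_Ioo, mem_inter_iff, mem_Ioc, mem_Iio]
    exact ⟨fun h => ⟨⟨h.1, h.2.le.trans hx.2⟩, h.2⟩, fun h => ⟨h.1.1, h.2⟩⟩
  rw [e1, integral_add (hdab.smul_const _) hk.integral_prod_left, integral_smul_const,
    ← intervalIntegral.integral_of_le hab.le, hft a ⟨le_rfl, hab.le⟩, hz a (by simp), neg_zero,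
    zero_smul, zero_add, integral_integral_swap (f := fun x t => k (x, t)) hk, ← integral_neg]
  refine setIntegral_congr_fun measurableSet_Ioc fun t ht => ?_
  have : ∀ x, k (x, t) = (Ioi t).indicator (fun x => deriv φ x • G t) x := fun x => rfl
  simp only [this]
  rw [setIntegral_indicator measurableSet_Ioi, Ioc_inter_Ioi, max_eq_right ht.1.le,
    integral_smul_const, ← intervalIntegral.integral_of_le ht.2, hft t ⟨ht.1.le, ht.2⟩, neg_smul]

/-- A function with a weak derivative on an interval has a continuous representative, which is an
antiderivative of the weak derivative. -/
theorem IsWeakDeriv.exists_continuousOn {I : Set ℝ} (hI : IsOpen I) (hord : I.OrdConnected)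
    {F G : ℝ → ℂ} (hF : LocallyIntegrableOn F I) (hG : LocallyIntegrableOn G I)
    (h : IsWeakDeriv I F G) :
    ∃ Fc : ℝ → ℂ, ContinuousOn Fc I ∧ F =ᵐ[volume.restrict I] Fc ∧
      ∀ x ∈ I, ∀ y ∈ I, Fc y - Fc x = ∫ t in x..y, G t := by
  rcases I.eq_empty_or_nonempty with rfl | ⟨x₀, hx₀⟩
  · exact ⟨F, by simp, by simp, by simp⟩
  have hii : ∀ x ∈ I, ∀ y ∈ I, IntervalIntegrable G volume x y := fun x hx y hy =>
    hG.intervalIntegrable_of_ordConnected hord hx hy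
  have hcont : ContinuousOn (fun x => ∫ t in x₀..x, G t) I := by
    intro x hx
    obtain ⟨a, ha, b, hb, hab, hsub⟩ := exists_Ioo_of_isCompact_subset hI ⟨x₀, hx₀⟩
      (isCompact_singleton.insert x₀ : IsCompact {x₀, x})
      (insert_subset hx₀ (singleton_subset_iff.2 hx))
    have h1 : ContinuousOn (fun x => ∫ t in x₀..x, G t) (uIcc a b) :=
      intervalIntegral.continuousOn_primitive_interval' (hii a ha b hb)
        (by rw [uIcc_of_le hab.le]; exact Ioo_subset_Icc_self (hsub (by simp)))
    refine (h1.continuousAt ?_).continuousWithinAt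
    rw [uIcc_of_le hab.le]
    exact Icc_mem_nhds (hsub (by simp)).1 (hsub (by simp)).2
  have hP : LocallyIntegrableOn (fun x => ∫ t in x₀..x, G t) I :=
    hcont.locallyIntegrableOn hI.measurableSet
  have hW := isWeakDeriv_integral hI hord hG hx₀
  -- `F` and the primitive of `G` have the same weak derivative, so they differ by a constant; the
  -- primitive plus this constant is the representative sought.
  have h0 : IsWeakDeriv I (fun x => F x - ∫ t in x₀..x, G t) 0 := by
    intro φ hφ hφc hφs
    have hφd : Continuous (deriv φ) := hφ.continuous_deriv (by simp)
    have hds := (tsupport_deriv_subset' φ).trans hφs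
    have i1 := integrable_test_smul hF hφd hφc.deriv hds
    have i2 := integrable_test_smul hP hφd hφc.deriv hds
    simp only [smul_sub, Pi.zero_apply, smul_zero, integral_zero, neg_zero]
    rw [integral_sub i1.integrableOn i2.integrableOn, h φ hφ hφc hφs, hW φ hφ hφc hφs, sub_self]
  obtain ⟨c, hc⟩ := h0.ae_const hI hord (hF.sub hP)
  refine ⟨fun x => c + ∫ t in x₀..x, G t, continuousOn_const.add hcont, ?_, fun x hx y hy => ?_⟩
  · filter_upwards [hc] with x hx
    rw [← hx, Pi.sub_apply, sub_add_cancel]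
  · rw [add_sub_add_left_eq_sub, intervalIntegral.integral_interval_sub_left (hii _ hx₀ _ hy)
      (hii _ hx₀ _ hx)]

/-! ### Quantitative estimates on the line -/

theorem integral_norm_le_sqrt_mul {X : Type*} [MeasurableSpace X] {μ : Measure X}
    [IsFiniteMeasure μ] {F : X → ℂ} (hF : MemLp F 2 μ) :
    ∫ x, ‖F x‖ ∂μ ≤ √(μ.real univ) * (eLpNorm F 2 μ).toReal := by
  have h := eLpNorm_le_eLpNorm_mul_rpow_measure_univ (p := 1) (q := 2) (by norm_num) hF.1
  have h1 : eLpNorm F 1 μ = ENNReal.ofReal (∫ x, ‖F x‖ ∂μ) := by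
    rw [eLpNorm_one_eq_lintegral_enorm,
      ofReal_integral_norm_eq_lintegral_enorm (hF.integrable (by norm_num))]
  have h2 := ENNReal.toReal_mono (ENNReal.mul_ne_top hF.2.ne
    (ENNReal.rpow_ne_top_of_nonneg (by norm_num) (measure_ne_top μ univ))) h
  rw [h1, ENNReal.toReal_ofReal (integral_nonneg fun _ => norm_nonneg _), ENNReal.toReal_mul,
    ← ENNReal.toReal_rpow] at h2
  refine h2.trans (le_of_eq ?_)
  rw [mul_comm, Real.sqrt_eq_rpow, Measure.real]
  norm_num

theorem MeasureTheory.MemLp.locallyIntegrableOn_restrict {X : Type*} [TopologicalSpace X]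
    [MeasurableSpace X] {μ : Measure X} [IsLocallyFiniteMeasure μ] {I : Set X} {F : X → ℂ}
    (hF : MemLp F 2 (μ.restrict I)) : LocallyIntegrableOn F I μ := by
  intro x _
  obtain ⟨U, hU, hUf⟩ := μ.finiteAt_nhds x
  refine ⟨I ∩ U, inter_mem_nhdsWithin I hU, ?_⟩
  have : IsFiniteMeasure (μ.restrict (I ∩ U)) :=
    ⟨by rw [Measure.restrict_apply_univ]; exact (measure_mono inter_subset_right).trans_lt hUf⟩
  exact (hF.mono_measure (Measure.restrict_mono inter_subset_left le_rfl)).integrable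
    (by norm_num)

/-- Oscillation of an antiderivative of a square integrable function on a bounded interval. -/
theorem norm_sub_le_of_primitive {a b : ℝ} (hab : a ≤ b) {Fc G : ℝ → ℂ}
    (hG : MemLp G 2 (volume.restrict (Ioo a b)))
    (hFc : ∀ x ∈ Ioo a b, ∀ y ∈ Ioo a b, Fc y - Fc x = ∫ t in x..y, G t) {x y : ℝ}
    (hx : x ∈ Ioo a b) (hy : y ∈ Ioo a b) :
    ‖Fc y - Fc x‖ ≤ √(b - a) * (eLpNorm G 2 (volume.restrict (Ioo a b))).toReal := by
  rw [hFc x hx y hy]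
  refine (intervalIntegral.norm_integral_le_integral_norm_uIoc).trans ?_
  have hi : IntegrableOn G (Ioo a b) := hG.integrable (by norm_num)
  refine (setIntegral_mono_set hi.norm (ae_of_all _ fun _ => norm_nonneg _)
    (LE.le.eventuallyLE ?_)).trans ?_
  · exact uIoc_subset_uIcc.trans (ordConnected_Ioo.uIcc_subset hx hy)
  · refine (integral_norm_le_sqrt_mul hG).trans (le_of_eq ?_)
    simp [hab]

/-- The mean deviates from a value by at most the oscillation over the larger interval. The point
`y` need not lie in the subinterval, so means over different subintervals can be compared through
one common value. -/
theorem norm_mean_sub_le_of_primitive {a b : ℝ} {F Fc G : ℝ → ℂ}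
    (hF : MemLp F 2 (volume.restrict (Ioo a b))) (hG : MemLp G 2 (volume.restrict (Ioo a b)))
    (hae : F =ᵐ[volume.restrict (Ioo a b)] Fc)
    (hFc : ∀ x ∈ Ioo a b, ∀ y ∈ Ioo a b, Fc y - Fc x = ∫ t in x..y, G t) {y a₁ b₁ : ℝ}
    (hy : y ∈ Ioo a b) (ha₁ : a ≤ a₁) (hab₁ : a₁ < b₁) (hb₁ : b₁ ≤ b) :
    ‖(b₁ - a₁)⁻¹ • (∫ x in Ioo a₁ b₁, F x) - Fc y‖ ≤
      √(b - a) * (eLpNorm G 2 (volume.restrict (Ioo a b))).toReal := by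
  have hsub : Ioo a₁ b₁ ⊆ Ioo a b := Ioo_subset_Ioo ha₁ hb₁
  have hpos : 0 < b₁ - a₁ := sub_pos.2 hab₁
  have hFi : IntegrableOn F (Ioo a₁ b₁) :=
    IntegrableOn.mono_set (hF.integrable (by norm_num)) hsub
  have hvol : (volume.real (Ioo a₁ b₁)) = b₁ - a₁ := by simp [hab₁.le]
  have e : (b₁ - a₁)⁻¹ • (∫ x in Ioo a₁ b₁, F x) - Fc y =
      (b₁ - a₁)⁻¹ • ∫ x in Ioo a₁ b₁, (F x - Fc y) := by
    rw [integral_sub hFi (integrableOn_const (by simp)), setIntegral_const, hvol, smul_sub,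
      smul_smul, inv_mul_cancel₀ hpos.ne', one_smul]
  rw [e, norm_smul, norm_inv, Real.norm_of_nonneg hpos.le, inv_mul_le_iff₀ hpos, mul_comm, ← hvol]
  have hae' : F =ᵐ[volume.restrict (Ioo a₁ b₁)] Fc := ae_restrict_of_ae_restrict_of_subset hsub hae
  refine norm_setIntegral_le_of_norm_le_const_ae (by simp) ?_
  filter_upwards [hae', ae_restrict_mem measurableSet_Ioo] with x hx hxI
  rw [hx]
  exact norm_sub_le_of_primitive (ha₁.trans (hab₁.le.trans hb₁)) hG hFc hy (hsub hxI)

/-! ### Averages over sections -/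

theorem exists_cutoff_seq {c d : ℝ} (hcd : c < d) :
    ∃ ψ : ℕ → ℝ → ℝ, (∀ n, ContDiff ℝ ∞ (ψ n)) ∧ (∀ n, HasCompactSupport (ψ n)) ∧
      (∀ n, tsupport (ψ n) ⊆ Ioo c d) ∧ (∀ n x, ψ n x ∈ Icc (0 : ℝ) 1) ∧
      ∀ x ∈ Ioo c d, ∀ᶠ n in Filter.atTop, ψ n x = 1 := by
  have hr : 0 < (d - c) / 2 := by linarith
  let f : ∀ n : ℕ, ContDiffBump ((c + d) / 2 : ℝ) := fun n =>
    -- The shift by `3` keeps `2 / (n + 3)` below `1`, so the inner radius is positive already for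
    -- `n = 0`.
    { rIn := (d - c) / 2 * (1 - 2 / (n + 3))
      rOut := (d - c) / 2 * (1 - 1 / (n + 3))
      rIn_pos := by
        refine mul_pos hr (sub_pos.2 ((div_lt_one (by positivity)).2 ?_))
        linarith [(Nat.cast_nonneg n : (0 : ℝ) ≤ n)]
      rIn_lt_rOut := by
        refine mul_lt_mul_of_pos_left (sub_lt_sub_left ?_ _) hr
        exact div_lt_div_of_pos_right (by norm_num) (by positivity) }
  refine ⟨fun n => f n, fun n => (f n).contDiff, fun n => (f n).hasCompactSupport, fun n => ?_,
    fun n x => ⟨(f n).nonneg, (f n).le_one⟩, fun x hx => ?_⟩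
  · rw [(f n).tsupport_eq, Real.closedBall_eq_Icc]
    have h1 : (f n).rOut < (d - c) / 2 := by
      change (d - c) / 2 * (1 - 1 / (n + 3)) < _
      have : (0 : ℝ) < 1 / (n + 3) := by positivity
      nlinarith
    intro y hy
    constructor <;> linarith [hy.1, hy.2]
  · have hlim : Filter.Tendsto (fun n : ℕ => (d - c) / 2 * (1 - 2 / ((n : ℝ) + 3))) Filter.atTop
        (nhds ((d - c) / 2 * (1 - 0))) := by
      refine (tendsto_const_nhds.sub ?_).const_mul _
      exact tendsto_const_nhds.div_atTop
        (Filter.tendsto_atTop_add_const_right _ _ tendsto_natCast_atTop_atTop)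
    have hlt : |x - (c + d) / 2| < (d - c) / 2 * (1 - 0) := by
      rw [abs_lt]
      constructor <;> linarith [hx.1, hx.2]
    filter_upwards [hlim.eventually (lt_mem_nhds hlt)] with n hn
    refine (f n).one_of_mem_closedBall ?_
    rw [Metric.mem_closedBall, Real.dist_eq]
    exact hn.le

/-- The derivative in `x` never falls on the cutoff in `y`. Hence in `φ(x) ψₙ(y)` the cutoffs can
tend to `1` by dominated convergence, and no boundary condition at `c` and `d` is needed. -/
theorem isWeakDeriv_section {I : Set ℝ} {c d : ℝ} (hcd : c < d) {u g : ℝ × ℝ → ℂ}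
    (hu : MemLp u 2 ((volume.restrict I).prod (volume.restrict (Ioo c d))))
    (hg : MemLp g 2 ((volume.restrict I).prod (volume.restrict (Ioo c d))))
    (h : ∀ φ ψ : ℝ → ℝ, ContDiff ℝ ∞ φ → HasCompactSupport φ → tsupport φ ⊆ I →
      ContDiff ℝ ∞ ψ → HasCompactSupport ψ → tsupport ψ ⊆ Ioo c d →
      ∫ p, (deriv φ p.1 * ψ p.2) • u p ∂((volume.restrict I).prod (volume.restrict (Ioo c d))) =
        - ∫ p, (φ p.1 * ψ p.2) • g p ∂((volume.restrict I).prod (volume.restrict (Ioo c d)))) :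
    IsWeakDeriv I (fun x => ∫ y in Ioo c d, u (x, y)) (fun x => ∫ y in Ioo c d, g (x, y)) := by
  intro φ hφ hφc hφs
  obtain ⟨ψ, h1, h2, h3, h4, h5⟩ := exists_cutoff_seq hcd
  have hint : ∀ {χ : ℝ → ℝ} {w : ℝ × ℝ → ℂ}, Continuous χ → HasCompactSupport χ →
      MemLp w 2 ((volume.restrict I).prod (volume.restrict (Ioo c d))) →
      Integrable (fun p : ℝ × ℝ => χ p.1 • w p)
        ((volume.restrict I).prod (volume.restrict (Ioo c d))) := by
    intro χ w hχ hχc hw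
    have hm : MemLp χ 2 (volume.restrict I) :=
      (hχ.memLp_of_hasCompactSupport hχc).mono_measure Measure.restrict_le_self
    exact memLp_one_iff_integrable.1 (MemLp.smul hw (hm.comp_fst (volume.restrict (Ioo c d))))
  have hlim : ∀ {χ : ℝ → ℝ} {w : ℝ × ℝ → ℂ}, Continuous χ → HasCompactSupport χ →
      MemLp w 2 ((volume.restrict I).prod (volume.restrict (Ioo c d))) →
      Filter.Tendsto (fun n => ∫ p, (χ p.1 * ψ n p.2) • w p
        ∂((volume.restrict I).prod (volume.restrict (Ioo c d)))) Filter.atTop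
        (nhds (∫ x in I, χ x • ∫ y in Ioo c d, w (x, y))) := by
    intro χ w hχ hχc hw
    have e : ∫ x in I, χ x • ∫ y in Ioo c d, w (x, y) =
        ∫ p, χ p.1 • w p ∂((volume.restrict I).prod (volume.restrict (Ioo c d))) := by
      rw [integral_prod _ (hint hχ hχc hw)]
      simp only [integral_smul]
    rw [e]
    have hae : ∀ᵐ p ∂((volume.restrict I).prod (volume.restrict (Ioo c d))), p.2 ∈ Ioo c d :=
      Measure.quasiMeasurePreserving_snd.ae (ae_restrict_mem measurableSet_Ioo)
    refine tendsto_integral_of_dominated_convergence (fun p => ‖χ p.1 • w p‖) (fun n => ?_)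
      (hint hχ hχc hw).norm (fun n => ae_of_all _ fun p => ?_) ?_
    · exact ((hχ.comp continuous_fst).mul ((h1 n).continuous.comp
        continuous_snd)).aestronglyMeasurable.smul hw.1
    · rw [norm_smul, norm_smul, norm_mul]
      gcongr
      refine mul_le_of_le_one_right (norm_nonneg _) ?_
      rw [Real.norm_of_nonneg (h4 n _).1]
      exact (h4 n _).2
    · filter_upwards [hae] with p hp
      refine tendsto_const_nhds.congr' ?_
      filter_upwards [h5 p.2 hp] with n hn
      rw [hn, mul_one]
  have l1 := hlim (hφ.continuous_deriv (by simp)) hφc.deriv hu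
  have l2 := (hlim hφ.continuous hφc hg).neg
  refine tendsto_nhds_unique l1 (l2.congr fun n => ?_)
  exact (h φ (ψ n) hφ hφc hφs (h1 n) (h2 n) (h3 n)).symm

theorem memLp_prod_of_subset {Ω : Set (ℝ × ℝ)} {I J : Set ℝ} (hIJ : I ×ˢ J ⊆ Ω) (u : L2 Ω) :
    MemLp u 2 ((volume.restrict I).prod (volume.restrict J)) := by
  rw [Measure.prod_restrict, ← Measure.volume_eq_prod]
  exact (Lp.memLp u).mono_measure (Measure.restrict_mono hIJ le_rfl)

theorem test_mul {φ ψ : ℝ → ℝ} (hφ : ContDiff ℝ ∞ φ) (hφc : HasCompactSupport φ)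
    (hψ : ContDiff ℝ ∞ ψ) (hψc : HasCompactSupport ψ) :
    ContDiff ℝ ∞ (fun p : ℝ × ℝ => φ p.1 * ψ p.2) ∧
      HasCompactSupport (fun p : ℝ × ℝ => φ p.1 * ψ p.2) ∧
      tsupport (fun p : ℝ × ℝ => φ p.1 * ψ p.2) ⊆ tsupport φ ×ˢ tsupport ψ ∧
      (∀ p, fderiv ℝ (fun p : ℝ × ℝ => φ p.1 * ψ p.2) p (1, 0) = deriv φ p.1 * ψ p.2) ∧
      ∀ p, fderiv ℝ (fun p : ℝ × ℝ => φ p.1 * ψ p.2) p (0, 1) = φ p.1 * deriv ψ p.2 := by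
  have hs : tsupport (fun p : ℝ × ℝ => φ p.1 * ψ p.2) ⊆ tsupport φ ×ˢ tsupport ψ := by
    refine closure_minimal (fun p hp => ?_) ((isClosed_tsupport _).prod (isClosed_tsupport _))
    exact ⟨subset_tsupport _ (left_ne_zero_of_mul hp), subset_tsupport _ (right_ne_zero_of_mul hp)⟩
  have hd : ∀ p : ℝ × ℝ, HasFDerivAt (fun p : ℝ × ℝ => φ p.1 * ψ p.2)
      (φ p.1 • (deriv ψ p.2 • ContinuousLinearMap.snd ℝ ℝ ℝ) +
        ψ p.2 • (deriv φ p.1 • ContinuousLinearMap.fst ℝ ℝ ℝ)) p := fun p =>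
    (((hφ.differentiable (by simp) p.1).hasDerivAt.comp_hasFDerivAt p hasFDerivAt_fst).mul
      ((hψ.differentiable (by simp) p.2).hasDerivAt.comp_hasFDerivAt p hasFDerivAt_snd))
  refine ⟨(hφ.comp contDiff_fst).mul (hψ.comp contDiff_snd),
    (hφc.isCompact.prod hψc.isCompact).of_isClosed_subset (isClosed_tsupport _) hs, hs,
    fun p => ?_, fun p => ?_⟩
  · rw [(hd p).fderiv]
    simp [mul_comm]
  · rw [(hd p).fderiv]
    simp

theorem setIntegral_test_smul_eq_prod {Ω : Set (ℝ × ℝ)} {I J : Set ℝ} (hIJ : I ×ˢ J ⊆ Ω)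
    {Φ : ℝ × ℝ → ℝ} (hΦ : tsupport Φ ⊆ I ×ˢ J) (u : ℝ × ℝ → ℂ) :
    ∫ p in Ω, Φ p • u p = ∫ p, Φ p • u p ∂((volume.restrict I).prod (volume.restrict J)) := by
  rw [setIntegral_smul_of_tsupport_subset (hΦ.trans hIJ), Measure.prod_restrict,
    ← Measure.volume_eq_prod, setIntegral_smul_of_tsupport_subset hΦ]

theorem RoomPassage.HasWeakDeriv.section_fst {Ω : Set (ℝ × ℝ)} {u g : L2 Ω}
    (h : HasWeakDeriv Ω (1, 0) u g) {I : Set ℝ} {c d : ℝ} (hcd : c < d)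
    (hI : I ×ˢ Ioo c d ⊆ Ω) :
    IsWeakDeriv I (fun x => ∫ y in Ioo c d, u (x, y)) (fun x => ∫ y in Ioo c d, g (x, y)) := by
  refine isWeakDeriv_section hcd (memLp_prod_of_subset hI u) (memLp_prod_of_subset hI g) ?_
  intro φ ψ hφ hφc hφs hψ hψc hψs
  obtain ⟨t1, t2, t3, t4, -⟩ := test_mul hφ hφc hψ hψc
  have e := h _ t1 t2 (t3.trans ((prod_mono hφs hψs).trans hI))
  have hφψ := t3.trans (prod_mono hφs hψs)
  have t3' := (test_mul (contDiff_infty_iff_deriv.1 hφ).2 hφc.deriv hψ hψc).2.2.1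
  simp only [t4] at e
  rw [setIntegral_test_smul_eq_prod hI hφψ, setIntegral_test_smul_eq_prod hI
    (t3'.trans (prod_mono ((tsupport_deriv_subset' φ).trans hφs) hψs))] at e
  exact e

theorem RoomPassage.HasWeakDeriv.section_snd {Ω : Set (ℝ × ℝ)} {u g : L2 Ω}
    (h : HasWeakDeriv Ω (0, 1) u g) {J : Set ℝ} {a b : ℝ} (hab : a < b)
    (hJ : Ioo a b ×ˢ J ⊆ Ω) :
    IsWeakDeriv J (fun y => ∫ x in Ioo a b, u (x, y)) (fun y => ∫ x in Ioo a b, g (x, y)) := by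
  have hu := (memLp_prod_of_subset hJ u).comp_measurePreserving
    (Measure.measurePreserving_swap (μ := volume.restrict J) (ν := volume.restrict (Ioo a b)))
  have hg := (memLp_prod_of_subset hJ g).comp_measurePreserving
    (Measure.measurePreserving_swap (μ := volume.restrict J) (ν := volume.restrict (Ioo a b)))
  refine isWeakDeriv_section hab hu hg ?_
  intro φ ψ hφ hφc hφs hψ hψc hψs
  obtain ⟨t1, t2, t3, -, t4⟩ := test_mul hψ hψc hφ hφc
  have e := h _ t1 t2 (t3.trans ((prod_mono hψs hφs).trans hJ))
  have hφψ := t3.trans (prod_mono hψs hφs)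
  have t3' := (test_mul hψ hψc (contDiff_infty_iff_deriv.1 hφ).2 hφc.deriv).2.2.1
  simp only [t4] at e
  rw [setIntegral_test_smul_eq_prod hJ hφψ, setIntegral_test_smul_eq_prod hJ
    (t3'.trans (prod_mono hψs ((tsupport_deriv_subset' φ).trans hφs))),
    ← integral_prod_swap, ← integral_prod_swap (fun p : ℝ × ℝ => (ψ p.1 * φ p.2) • g p)] at e
  simpa only [Prod.fst_swap, Prod.snd_swap, mul_comm (ψ _), Function.comp_apply] using e

/-! ### Means over rectangles -/

/-- Cauchy–Schwarz on each section: integrating over a length `d - c` costs the factor `√(d - c)`.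
-/
theorem section_fst_memLp {Ω : Set (ℝ × ℝ)} (g : L2 Ω) {I : Set ℝ} {c d : ℝ} (hcd : c ≤ d)
    (hI : I ×ˢ Ioo c d ⊆ Ω) :
    MemLp (fun x => ∫ y in Ioo c d, g (x, y)) 2 (volume.restrict I) ∧
      (eLpNorm (fun x => ∫ y in Ioo c d, g (x, y)) 2 (volume.restrict I)).toReal ≤
        √(d - c) * ‖g‖ := by
  have hg := memLp_prod_of_subset hI g
  have h1 := eLpNorm_section_integral_le hg.1
  have h2 : eLpNorm g 2 ((volume.restrict I).prod (volume.restrict (Ioo c d))) ≤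
      eLpNorm g 2 (volume.restrict Ω) := by
    rw [Measure.prod_restrict, ← Measure.volume_eq_prod]
    exact eLpNorm_mono_measure _ (Measure.restrict_mono hI le_rfl)
  have h3 : (volume.restrict (Ioo c d) univ) ^ (1 / 2 : ℝ) = ENNReal.ofReal √(d - c) := by
    rw [Measure.restrict_apply_univ, Real.volume_Ioo, Real.sqrt_eq_rpow,
      ENNReal.ofReal_rpow_of_nonneg (sub_nonneg.2 hcd) (by norm_num)]
  have h4 := h1.trans (mul_le_mul' h3.le h2)
  have hfin : ENNReal.ofReal √(d - c) * eLpNorm g 2 (volume.restrict Ω) ≠ ⊤ :=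
    ENNReal.mul_ne_top ENNReal.ofReal_ne_top (Lp.eLpNorm_ne_top g)
  refine ⟨⟨hg.1.integral_prod_right', h4.trans_lt hfin.lt_top⟩, ?_⟩
  have h5 := ENNReal.toReal_mono hfin h4
  rwa [ENNReal.toReal_mul, ENNReal.toReal_ofReal (Real.sqrt_nonneg _), ← Lp.norm_def] at h5

theorem section_snd_memLp {Ω : Set (ℝ × ℝ)} (g : L2 Ω) {J : Set ℝ} {a b : ℝ} (hab : a ≤ b)
    (hJ : Ioo a b ×ˢ J ⊆ Ω) :
    MemLp (fun y => ∫ x in Ioo a b, g (x, y)) 2 (volume.restrict J) ∧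
      (eLpNorm (fun y => ∫ x in Ioo a b, g (x, y)) 2 (volume.restrict J)).toReal ≤
        √(b - a) * ‖g‖ := by
  have hms := Measure.measurePreserving_swap (μ := volume.restrict J)
    (ν := volume.restrict (Ioo a b))
  have hg := memLp_prod_of_subset hJ g
  have hgs := hg.comp_measurePreserving hms
  have h1 := eLpNorm_section_integral_le hgs.1
  rw [eLpNorm_comp_measurePreserving hg.1 hms] at h1
  have h2 : eLpNorm g 2 ((volume.restrict (Ioo a b)).prod (volume.restrict J)) ≤
      eLpNorm g 2 (volume.restrict Ω) := by
    rw [Measure.prod_restrict, ← Measure.volume_eq_prod]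
    exact eLpNorm_mono_measure _ (Measure.restrict_mono hJ le_rfl)
  have h3 : (volume.restrict (Ioo a b) univ) ^ (1 / 2 : ℝ) = ENNReal.ofReal √(b - a) := by
    rw [Measure.restrict_apply_univ, Real.volume_Ioo, Real.sqrt_eq_rpow,
      ENNReal.ofReal_rpow_of_nonneg (sub_nonneg.2 hab) (by norm_num)]
  have h4 := h1.trans (mul_le_mul' h3.le h2)
  have hfin : ENNReal.ofReal √(b - a) * eLpNorm g 2 (volume.restrict Ω) ≠ ⊤ :=
    ENNReal.mul_ne_top ENNReal.ofReal_ne_top (Lp.eLpNorm_ne_top g)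
  refine ⟨⟨hgs.1.integral_prod_right', h4.trans_lt hfin.lt_top⟩, ?_⟩
  have h5 := ENNReal.toReal_mono hfin h4
  rwa [ENNReal.toReal_mul, ENNReal.toReal_ofReal (Real.sqrt_nonneg _), ← Lp.norm_def] at h5

/-- The mean of `u` over the rectangle `(a, b) × (c, d)`. -/
noncomputable def rectMean (u : ℝ × ℝ → ℂ) (a b c d : ℝ) : ℂ :=
  ((b - a) * (d - c))⁻¹ • ∫ p in Ioo a b ×ˢ Ioo c d, u p

theorem integrable_prod_of_subset {Ω : Set (ℝ × ℝ)} (u : L2 Ω) {a b c d : ℝ}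
    (hsub : Ioo a b ×ˢ Ioo c d ⊆ Ω) :
    Integrable u ((volume.restrict (Ioo a b)).prod (volume.restrict (Ioo c d))) :=
  (memLp_prod_of_subset hsub u).integrable (by norm_num)

theorem setIntegral_rect_fst {u : ℝ × ℝ → ℂ} {I J : Set ℝ}
    (hu : Integrable u ((volume.restrict I).prod (volume.restrict J))) :
    ∫ p in I ×ˢ J, u p = ∫ x in I, ∫ y in J, u (x, y) := by
  rw [Measure.volume_eq_prod, ← Measure.prod_restrict, integral_prod _ hu]

theorem setIntegral_rect_snd {u : ℝ × ℝ → ℂ} {I J : Set ℝ}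
    (hu : Integrable u ((volume.restrict I).prod (volume.restrict J))) :
    ∫ p in I ×ˢ J, u p = ∫ y in J, ∫ x in I, u (x, y) := by
  rw [Measure.volume_eq_prod, ← Measure.prod_restrict, integral_prod_symm _ hu]

/-- Both means are compared with the section integral at the midpoint of `(a, b)`, whence the factor
`2`. The oscillation gives `√(b - a) √(d - c)`, the normalisation `(d - c)⁻¹`. The bound depends
only on the shape of the rectangle, not on its size. -/
theorem norm_rectMean_sub_le_fst {Ω : Set (ℝ × ℝ)} {u g : L2 Ω}
    (h : HasWeakDeriv Ω (1, 0) u g) {a b c d a₁ b₁ : ℝ} (hsub : Ioo a b ×ˢ Ioo c d ⊆ Ω)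
    (hcd : c < d) (ha₁ : a ≤ a₁) (hab₁ : a₁ < b₁) (hb₁ : b₁ ≤ b) :
    ‖rectMean u a₁ b₁ c d - rectMean u a b c d‖ ≤ 2 * √((b - a) / (d - c)) * ‖g‖ := by
  have hw := h.section_fst hcd hsub
  obtain ⟨hu, -⟩ := section_fst_memLp u hcd.le hsub
  obtain ⟨hg, hgn⟩ := section_fst_memLp g hcd.le hsub
  obtain ⟨Fc, -, hae, hFc⟩ := hw.exists_continuousOn isOpen_Ioo ordConnected_Ioo
    hu.locallyIntegrableOn_restrict hg.locallyIntegrableOn_restrict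
  have hab : a < b := ha₁.trans_lt (hab₁.trans_le hb₁)
  have hy : (a + b) / 2 ∈ Ioo a b := ⟨by linarith, by linarith⟩
  have e1 := norm_mean_sub_le_of_primitive hu hg hae hFc hy ha₁ hab₁ hb₁
  have e2 := norm_mean_sub_le_of_primitive hu hg hae hFc hy le_rfl hab le_rfl
  have hdc : 0 < d - c := sub_pos.2 hcd
  have key : ∀ a' b', a ≤ a' → b' ≤ b → rectMean u a' b' c d =
      (d - c)⁻¹ • (b' - a')⁻¹ • ∫ x in Ioo a' b', ∫ y in Ioo c d, u (x, y) := by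
    intro a' b' h1 h2
    rw [rectMean, setIntegral_rect_fst
      (integrable_prod_of_subset u ((prod_mono (Ioo_subset_Ioo h1 h2) le_rfl).trans hsub)),
      mul_inv, smul_smul, mul_comm]
  rw [key a₁ b₁ ha₁ hb₁, key a b le_rfl le_rfl, ← smul_sub, norm_smul, norm_inv,
    Real.norm_of_nonneg hdc.le, inv_mul_le_iff₀ hdc]
  refine ((norm_sub_le_norm_sub_add_norm_sub _ (Fc ((a + b) / 2)) _).trans
    (add_le_add e1 ((norm_sub_rev _ _).le.trans e2))).trans ?_
  have h3 : √(b - a) * (√(d - c) * ‖g‖) = (d - c) * (√((b - a) / (d - c)) * ‖g‖) := by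
    rw [Real.sqrt_div (sub_pos.2 hab).le]
    have : √(d - c) ≠ 0 := (Real.sqrt_pos.2 hdc).ne'
    field_simp
    rw [Real.sq_sqrt hdc.le]
  have h4 := mul_le_mul_of_nonneg_left hgn (Real.sqrt_nonneg (b - a))
  rw [h3] at h4
  linarith

theorem norm_rectMean_sub_le_snd {Ω : Set (ℝ × ℝ)} {u g : L2 Ω}
    (h : HasWeakDeriv Ω (0, 1) u g) {a b c d c₁ d₁ : ℝ} (hsub : Ioo a b ×ˢ Ioo c d ⊆ Ω)
    (hab : a < b) (hc₁ : c ≤ c₁) (hcd₁ : c₁ < d₁) (hd₁ : d₁ ≤ d) :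
    ‖rectMean u a b c₁ d₁ - rectMean u a b c d‖ ≤ 2 * √((d - c) / (b - a)) * ‖g‖ := by
  have hw := h.section_snd hab hsub
  obtain ⟨hu, -⟩ := section_snd_memLp u hab.le hsub
  obtain ⟨hg, hgn⟩ := section_snd_memLp g hab.le hsub
  obtain ⟨Fc, -, hae, hFc⟩ := hw.exists_continuousOn isOpen_Ioo ordConnected_Ioo
    hu.locallyIntegrableOn_restrict hg.locallyIntegrableOn_restrict
  have hcd : c < d := hc₁.trans_lt (hcd₁.trans_le hd₁)
  have hy : (c + d) / 2 ∈ Ioo c d := ⟨by linarith, by linarith⟩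
  have e1 := norm_mean_sub_le_of_primitive hu hg hae hFc hy hc₁ hcd₁ hd₁
  have e2 := norm_mean_sub_le_of_primitive hu hg hae hFc hy le_rfl hcd le_rfl
  have hba : 0 < b - a := sub_pos.2 hab
  have key : ∀ c' d', c ≤ c' → d' ≤ d → rectMean u a b c' d' =
      (b - a)⁻¹ • (d' - c')⁻¹ • ∫ y in Ioo c' d', ∫ x in Ioo a b, u (x, y) := by
    intro c' d' h1 h2
    rw [rectMean, setIntegral_rect_snd
      (integrable_prod_of_subset u ((prod_mono le_rfl (Ioo_subset_Ioo h1 h2)).trans hsub)),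
      mul_inv, smul_smul]
  rw [key c₁ d₁ hc₁ hd₁, key c d le_rfl le_rfl, ← smul_sub, norm_smul, norm_inv,
    Real.norm_of_nonneg hba.le, inv_mul_le_iff₀ hba]
  refine ((norm_sub_le_norm_sub_add_norm_sub _ (Fc ((c + d) / 2)) _).trans
    (add_le_add e1 ((norm_sub_rev _ _).le.trans e2))).trans ?_
  have h3 : √(d - c) * (√(b - a) * ‖g‖) = (b - a) * (√((d - c) / (b - a)) * ‖g‖) := by
    rw [Real.sqrt_div (sub_pos.2 hcd).le]
    have : √(b - a) ≠ 0 := (Real.sqrt_pos.2 hba).ne'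
    field_simp
    rw [Real.sq_sqrt hba.le]
  have h4 := mul_le_mul_of_nonneg_left hgn (Real.sqrt_nonneg (d - c))
  rw [h3] at h4
  linarith

/-- The squares are joined through the rectangle as wide as the larger and as high as the smaller
one. The horizontal comparison costs `3`, because `√(S / s) ≤ √2 ≤ 3 / 2`, and the vertical one
costs `2`. -/
theorem norm_rectMean_square_sub_le {Ω : Set (ℝ × ℝ)} {u g₁ g₂ : L2 Ω}
    (h₁ : HasWeakDeriv Ω (1, 0) u g₁) (h₂ : HasWeakDeriv Ω (0, 1) u g₂) {N : ℝ}
    (hN₁ : ‖g₁‖ ≤ N) (hN₂ : ‖g₂‖ ≤ N) {s S lo lo' : ℝ} (hs : 0 < s) (hsS : s ≤ S) (hS : S ≤ 2 * s)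
    (hlo : lo' ≤ lo) (hlo' : lo + s ≤ lo' + S)
    (hsub : Ioo (-(S / 2)) (S / 2) ×ˢ Ioo lo' (lo' + S) ⊆ Ω) :
    ‖rectMean u (-(s / 2)) (s / 2) lo (lo + s) - rectMean u (-(S / 2)) (S / 2) lo' (lo' + S)‖ ≤
      5 * N := by
  have hN : 0 ≤ N := (norm_nonneg _).trans hN₁
  have e1 := norm_rectMean_sub_le_fst h₁ (a := -(S / 2)) (b := S / 2) (c := lo) (d := lo + s)
    (a₁ := -(s / 2)) (b₁ := s / 2) ((prod_mono le_rfl (Ioo_subset_Ioo hlo hlo')).trans hsub)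
    (by linarith) (by linarith) (by linarith) (by linarith)
  have e2 := norm_rectMean_sub_le_snd h₂ hsub (c₁ := lo) (d₁ := lo + s) (by linarith) hlo
    (by linarith) hlo'
  have s1 : √((S / 2 - -(S / 2)) / (lo + s - lo)) ≤ 3 / 2 := by
    rw [Real.sqrt_le_left (by norm_num), div_le_iff₀ (by linarith)]
    linarith
  have s2 : √((lo' + S - lo') / (S / 2 - -(S / 2))) = 1 := by
    rw [Real.sqrt_eq_one]
    have : S ≠ 0 := by linarith
    field_simp
    ring
  rw [s2] at e2
  have e1' : 2 * √((S / 2 - -(S / 2)) / (lo + s - lo)) * ‖g₁‖ ≤ 3 * N := by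
    have := mul_le_mul s1 hN₁ (norm_nonneg _) (by norm_num)
    linarith
  refine (norm_sub_le_norm_sub_add_norm_sub _
    (rectMean u (-(S / 2)) (S / 2) lo (lo + s)) _).trans ?_
  linarith

/-- Comparison of the means over two nested squares by successive doubling. -/
theorem norm_rectMean_dyadic_sub_le {Ω : Set (ℝ × ℝ)} {u g₁ g₂ : L2 Ω}
    (h₁ : HasWeakDeriv Ω (1, 0) u g₁) (h₂ : HasWeakDeriv Ω (0, 1) u g₂) {N : ℝ}
    (hN₁ : ‖g₁‖ ≤ N) (hN₂ : ‖g₂‖ ≤ N) {lo : ℝ → ℝ}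
    (hlo : ∀ s S, s ≤ S → lo S ≤ lo s ∧ lo s + s ≤ lo S + S) (n : ℕ) {s S : ℝ} (hs : 0 < s)
    (hsS : s ≤ S) (hS : S ≤ 2 ^ n * s)
    (hsub : Ioo (-(S / 2)) (S / 2) ×ˢ Ioo (lo S) (lo S + S) ⊆ Ω) :
    ‖rectMean u (-(s / 2)) (s / 2) (lo s) (lo s + s) -
      rectMean u (-(S / 2)) (S / 2) (lo S) (lo S + S)‖ ≤ 5 * n * N := by
  induction n generalizing S with
  | zero =>
    obtain rfl : s = S := le_antisymm hsS (by simpa using hS)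
    simp
  | succ n ih =>
    -- The intermediate square has side `max s (S / 2)`: one doubling leads from it to `S`, it is at
    -- most `2 ^ n * s` as the induction hypothesis requires, and the maximum prevents it from being
    -- smaller than the first square.
    have hT : max s (S / 2) ≤ S := max_le hsS (by linarith)
    have hsT : s ≤ max s (S / 2) := le_max_left _ _
    have hone : (1 : ℝ) ≤ 2 ^ n := one_le_pow₀ (by norm_num)
    have e1 := ih hsT (max_le (by nlinarith) (by rw [pow_succ] at hS; linarith))
      ((prod_mono (Ioo_subset_Ioo (by linarith) (by linarith))
        (Ioo_subset_Ioo (hlo _ _ hT).1 (hlo _ _ hT).2)).trans hsub)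
    have e2 := norm_rectMean_square_sub_le h₁ h₂ hN₁ hN₂ (hs.trans_le hsT) hT
      (by linarith [le_max_right s (S / 2)]) (hlo _ _ hT).1 (hlo _ _ hT).2 hsub
    refine (norm_sub_le_norm_sub_add_norm_sub _ _ _).trans ((add_le_add e1 e2).trans (le_of_eq ?_))
    push_cast
    ring

theorem norm_rectMean_le {Ω : Set (ℝ × ℝ)} (u : L2 Ω) {a b c d : ℝ} (hab : a < b) (hcd : c < d)
    (hsub : Ioo a b ×ˢ Ioo c d ⊆ Ω) :
    ‖rectMean u a b c d‖ ≤ (√((b - a) * (d - c)))⁻¹ * ‖u‖ := by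
  have hA : 0 < (b - a) * (d - c) := mul_pos (sub_pos.2 hab) (sub_pos.2 hcd)
  have hfin : IsFiniteMeasure ((volume : Measure (ℝ × ℝ)).restrict (Ioo a b ×ˢ Ioo c d)) := by
    rw [Measure.volume_eq_prod, ← Measure.prod_restrict]
    infer_instance
  have hu : MemLp u 2 (volume.restrict (Ioo a b ×ˢ Ioo c d)) :=
    (Lp.memLp u).mono_measure (Measure.restrict_mono hsub le_rfl)
  have h1 := integral_norm_le_sqrt_mul hu
  have h2 : (eLpNorm u 2 (volume.restrict (Ioo a b ×ˢ Ioo c d))).toReal ≤ ‖u‖ := by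
    rw [Lp.norm_def]
    exact ENNReal.toReal_mono (Lp.eLpNorm_ne_top u)
      (eLpNorm_mono_measure _ (Measure.restrict_mono hsub le_rfl))
  have h3 : (volume.restrict (Ioo a b ×ˢ Ioo c d)).real univ = (b - a) * (d - c) := by
    rw [measureReal_restrict_apply_univ, Measure.volume_eq_prod, measureReal_prod_prod]
    simp [hab.le, hcd.le]
  rw [h3] at h1
  rw [rectMean, norm_smul, norm_inv, Real.norm_of_nonneg hA.le, inv_mul_le_iff₀ hA]
  refine (norm_integral_le_integral_norm _).trans (h1.trans
    ((mul_le_mul_of_nonneg_left h2 (Real.sqrt_nonneg _)).trans (le_of_eq ?_)))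
  have h4 : √((b - a) * (d - c)) ≠ 0 := (Real.sqrt_pos.2 hA).ne'
  field_simp
  rw [Real.sq_sqrt hA.le]

/-! ### The flux through the passage -/

theorem eLpNorm_toReal_mono_restrict {I I' : Set ℝ} (hI : I' ⊆ I) {G : ℝ → ℂ}
    (hG : MemLp G 2 (volume.restrict I)) :
    (eLpNorm G 2 (volume.restrict I')).toReal ≤ (eLpNorm G 2 (volume.restrict I)).toReal :=
  ENNReal.toReal_mono hG.2.ne (eLpNorm_mono_measure _ (Measure.restrict_mono hI le_rfl))

/-- The flux through a rectangle `(-d/2, d/2) × (0, h)` is, up to a small error, the difference of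
the means over squares of side `d` adjacent to its ends. -/
theorem norm_flux_sub_le {Ω : Set (ℝ × ℝ)} {u g : L2 Ω} (hw : HasWeakDeriv Ω (0, 1) u g)
    {d h lo hi : ℝ} (hd : 0 < d) (hdh : d ≤ h) (hlo : lo ≤ -d) (hhi : h + d ≤ hi)
    (hsub : Ioo (-(d / 2)) (d / 2) ×ˢ Ioo lo hi ⊆ Ω) :
    ‖d⁻¹ • (∫ p in Ioo (-(d / 2)) (d / 2) ×ˢ Ioo 0 h, g p) -
      (rectMean u (-(d / 2)) (d / 2) h (h + d) - rectMean u (-(d / 2)) (d / 2) (-d) 0)‖ ≤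
      4 * ‖g‖ := by
  have hdd : -(d / 2) < d / 2 := by linarith
  have hF := hw.section_snd hdd hsub
  obtain ⟨hu, -⟩ := section_snd_memLp u hdd.le hsub
  obtain ⟨hg, hgn⟩ := section_snd_memLp g hdd.le hsub
  obtain ⟨Fc, -, hae, hFc⟩ := hF.exists_continuousOn isOpen_Ioo ordConnected_Ioo
    hu.locallyIntegrableOn_restrict hg.locallyIntegrableOn_restrict
  have hrect : ∀ c' d', lo ≤ c' → d' ≤ hi → ∀ w : L2 Ω,
      ∫ p in Ioo (-(d / 2)) (d / 2) ×ˢ Ioo c' d', w p =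
        ∫ y in Ioo c' d', ∫ x in Ioo (-(d / 2)) (d / 2), w (x, y) := fun c' d' h1 h2 w =>
    setIntegral_rect_snd
      (integrable_prod_of_subset w ((prod_mono le_rfl (Ioo_subset_Ioo h1 h2)).trans hsub))
  -- The section integral at height `y` against the mean over a square of side `d` inside the window
  -- `(y - d, y + d)`. The oscillation over this window gives `√(2d · d) / d = √2 ≤ 2`. It is
  -- applied at the top of the passage with the square above and at the bottom with the square
  -- below.
  have hmean : ∀ y c' : ℝ, lo ≤ y - d → y + d ≤ hi → y - d ≤ c' → c' + d ≤ y + d →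
      ‖d⁻¹ • Fc y - rectMean u (-(d / 2)) (d / 2) c' (c' + d)‖ ≤ 2 * ‖g‖ := by
    intro y c' h1 h2 h3 h4
    have hs : Ioo (y - d) (y + d) ⊆ Ioo lo hi := Ioo_subset_Ioo h1 h2
    have e := norm_mean_sub_le_of_primitive (hu.mono_measure (Measure.restrict_mono hs le_rfl))
      (hg.mono_measure (Measure.restrict_mono hs le_rfl))
      (ae_restrict_of_ae_restrict_of_subset hs hae)
      (fun x hx z hz => hFc x (hs hx) z (hs hz)) (y := y) ⟨by linarith, by linarith⟩ h3
      (by linarith : c' < c' + d) h4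
    have e' := e.trans (mul_le_mul_of_nonneg_left
      ((eLpNorm_toReal_mono_restrict hs hg).trans hgn) (Real.sqrt_nonneg _))
    have hr : rectMean u (-(d / 2)) (d / 2) c' (c' + d) =
        d⁻¹ • (c' + d - c')⁻¹ • ∫ y in Ioo c' (c' + d), ∫ x in Ioo (-(d / 2)) (d / 2), u (x, y) := by
      rw [rectMean, hrect _ _ (h1.trans h3) (h4.trans h2), mul_inv, smul_smul]
      congr 3
      ring
    rw [hr, ← smul_sub, norm_smul, norm_inv, Real.norm_of_nonneg hd.le, inv_mul_le_iff₀ hd,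
      norm_sub_rev]
    refine e'.trans ?_
    rw [← mul_assoc, ← Real.sqrt_mul (by linarith)]
    have : √((y + d - (y - d)) * (d / 2 - -(d / 2))) ≤ 2 * d := by
      rw [Real.sqrt_le_left (by linarith)]
      nlinarith
    nlinarith [norm_nonneg g]
  have h0 : (0 : ℝ) ∈ Ioo lo hi := ⟨by linarith, by linarith⟩
  have hh : h ∈ Ioo lo hi := ⟨by linarith, by linarith⟩
  have hflux : ∫ p in Ioo (-(d / 2)) (d / 2) ×ˢ Ioo 0 h, g p = Fc h - Fc 0 := by
    rw [hrect 0 h h0.1.le hh.2.le, hFc 0 h0 h hh,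
      intervalIntegral.integral_of_le (hd.le.trans hdh), integral_Ioc_eq_integral_Ioo]
  have m1 := hmean h h (by linarith) hhi (by linarith) le_rfl
  have m2 := hmean 0 (-d) (by linarith) (by linarith) (by linarith) (by linarith)
  rw [neg_add_cancel] at m2
  rw [hflux, smul_sub, sub_sub_sub_comm]
  refine (norm_sub_le _ _).trans ?_
  linarith

/-- The main estimate for the flux through the passage: it is governed by the value at the origin
of the cross-sectional average in the strip. -/
theorem norm_flux_add_le {Ω : Set (ℝ × ℝ)} {u g₁ g₂ : L2 Ω}
    (h₁ : HasWeakDeriv Ω (1, 0) u g₁) (h₂ : HasWeakDeriv Ω (0, 1) u g₂) {N : ℝ}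
    (hN : ‖u‖ ≤ N) (hN₁ : ‖g₁‖ ≤ N) (hN₂ : ‖g₂‖ ≤ N) {d h b ε : ℝ} (hd : 0 < d) (hdh : d ≤ h)
    (hdε : d ≤ ε) (hdb : d ≤ b) {n : ℕ} (hbn : b ≤ 2 ^ n * d) (hεn : ε ≤ 2 ^ n * d)
    (htall : Ioo (-(d / 2)) (d / 2) ×ˢ Ioo (-ε) (h + b) ⊆ Ω)
    {I : Set ℝ} (hI : I ×ˢ Ioo (-ε) 0 ⊆ Ω) (hεI : Ioo (-(ε / 2)) (ε / 2) ⊆ I)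
    (hroom : Ioo (-(b / 2)) (b / 2) ×ˢ Ioo h (h + b) ⊆ Ω) {Fc : ℝ → ℂ}
    (hae : (fun x => ∫ y in Ioo (-ε) 0, u (x, y)) =ᵐ[volume.restrict I] Fc)
    (hFc : ∀ x ∈ I, ∀ y ∈ I, Fc y - Fc x = ∫ t in x..y, ∫ y in Ioo (-ε) 0, g₁ (t, y)) :
    ‖d⁻¹ • (∫ p in Ioo (-(d / 2)) (d / 2) ×ˢ Ioo 0 h, g₂ p) + ε⁻¹ • Fc 0‖ ≤
      (5 + 10 * n + b⁻¹) * N := by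
  have hε : 0 < ε := hd.trans_le hdε
  have hb : 0 < b := hd.trans_le hdb
  have hsq : Ioo (-(ε / 2)) (ε / 2) ×ˢ Ioo (-ε) (-ε + ε) ⊆ Ω := by
    rw [neg_add_cancel]
    exact (prod_mono hεI le_rfl).trans hI
  have e1 := norm_flux_sub_le h₂ hd hdh (neg_le_neg hdε) (by linarith) htall
  -- Above the passage the squares stand on the line `x₂ = h` and grow to the room; below it they
  -- hang from `x₂ = 0` and grow until they fill the height of the strip.
  have e2 := norm_rectMean_dyadic_sub_le h₁ h₂ hN₁ hN₂ (lo := fun _ => h)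
    (fun s S hsS => ⟨le_rfl, by linarith⟩) n hd hdb hbn hroom
  have e3 := norm_rectMean_dyadic_sub_le h₁ h₂ hN₁ hN₂ (lo := fun s => -s)
    (fun s S hsS => ⟨by linarith, by linarith⟩) n hd hdε hεn hsq
  have e4 : ‖rectMean u (-(b / 2)) (b / 2) h (h + b)‖ ≤ b⁻¹ * N := by
    refine (norm_rectMean_le u (by linarith) (by linarith) hroom).trans ?_
    have : √((b / 2 - -(b / 2)) * (h + b - h)) = b := by
      rw [Real.sqrt_eq_iff_mul_self_eq (by nlinarith) hb.le]
      ring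
    rw [this]
    exact mul_le_mul_of_nonneg_left hN (inv_nonneg.2 hb.le)
  -- The square of side `ε` fills the height of the strip, so its mean is a mean of `ε⁻¹ Fc`; the
  -- oscillation over the length `ε` costs `√(ε · ε) / ε = 1`.
  have e5 : ‖rectMean u (-(ε / 2)) (ε / 2) (-ε) (-ε + ε) - ε⁻¹ • Fc 0‖ ≤ N := by
    rw [neg_add_cancel] at hsq ⊢
    obtain ⟨hu, -⟩ := section_fst_memLp u (by linarith : -ε ≤ 0) hsq
    obtain ⟨hg, hgn⟩ := section_fst_memLp g₁ (by linarith : -ε ≤ 0) hsq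
    have e := norm_mean_sub_le_of_primitive hu hg
      (ae_restrict_of_ae_restrict_of_subset hεI hae)
      (fun x hx z hz => hFc x (hεI hx) z (hεI hz)) (y := 0) ⟨by linarith, by linarith⟩ le_rfl
      (by linarith) le_rfl
    have e' := e.trans (mul_le_mul_of_nonneg_left hgn (Real.sqrt_nonneg _))
    have hr : rectMean u (-(ε / 2)) (ε / 2) (-ε) 0 = ε⁻¹ • (ε / 2 - -(ε / 2))⁻¹ •
        ∫ x in Ioo (-(ε / 2)) (ε / 2), ∫ y in Ioo (-ε) 0, u (x, y) := by
      rw [rectMean, setIntegral_rect_fst (integrable_prod_of_subset u hsq), mul_inv_rev, smul_smul]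
      congr 3
      ring
    rw [hr, ← smul_sub, norm_smul, norm_inv, Real.norm_of_nonneg hε.le, inv_mul_le_iff₀ hε]
    refine e'.trans ?_
    rw [← mul_assoc, ← Real.sqrt_mul (by linarith)]
    have : √((ε / 2 - -(ε / 2)) * (0 - -ε)) = ε := by
      rw [Real.sqrt_eq_iff_mul_self_eq (by nlinarith) hε.le]
      ring
    rw [this]
    exact mul_le_mul_of_nonneg_left hN₁ hε.le
  rw [neg_add_cancel] at e3 e5
  rw [neg_add_cancel] at e3
  -- Telescoping: `A` is the flux, `T` and `B` the means over the small squares at the top and the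
  -- bottom of the passage, `R` and `Q` those over the room and the large square in the strip, `c`
  -- the cross-sectional mean at the origin. The errors add up to `4 + 5n + b⁻¹ + 5n + 1`.
  have key : ∀ A T B R Q c : ℂ, A + c = (A - (T - B)) + (T - R) + R - (B - Q) - (Q - c) := by
    intros
    ring
  rw [key _ (rectMean u (-(d / 2)) (d / 2) h (h + d)) (rectMean u (-(d / 2)) (d / 2) (-d) 0)
    (rectMean u (-(b / 2)) (b / 2) h (h + b)) (rectMean u (-(ε / 2)) (ε / 2) (-ε) 0)]
  refine (norm_sub_le _ _).trans ((add_le_add_left (norm_sub_le _ _) _).trans ?_)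
  refine (add_le_add_left (add_le_add_left (norm_add_le _ _) _) _).trans ?_
  refine (add_le_add_left (add_le_add_left (add_le_add_left (norm_add_le _ _) _) _) _).trans ?_
  linarith

/-! ### Resolvents of operators associated with closed forms -/

section Resolvent

variable {H X : Type*} [NormedAddCommGroup H] [InnerProductSpace ℂ H]
  [NormedAddCommGroup X] [InnerProductSpace ℂ X]

theorem formResolvent_eq {G : Set (H × H)} {R : H →L[ℂ] H} (h : IsResolvent G R) :
    formResolvent G = R := by
  have hex : ∃ R : H →L[ℂ] H, IsResolvent G R := ⟨R, h⟩
  rw [formResolvent, dif_pos hex]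
  exact hex.choose_spec.unique h

/-- A form which is represented as the inner product of a Hilbert space `Γ`, embedded
contractively in `H`, has a self-adjoint resolvent. -/
theorem formResolvent_spec [CompleteSpace H] [CompleteSpace X] (Γ : Submodule ℂ X) (hΓ : IsClosed (Γ : Set X)) (π : X →L[ℂ] H)
    (hπ : ∀ p, ‖π p‖ ≤ ‖p‖) {D : Set H} {a : H → H → ℂ} (hD : D = π '' Γ)
    (ha : ∀ p ∈ Γ, ∀ q ∈ Γ, a (π p) (π q) + inner ℂ (π q) (π p) = inner ℂ q p) :
    IsResolvent (operatorGraph D a) (formResolvent (operatorGraph D a)) ∧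
      IsSelfAdjoint (formResolvent (operatorGraph D a)) ∧
      ∀ f, ∃ p ∈ Γ, π p = formResolvent (operatorGraph D a) f ∧ ‖p‖ ≤ ‖f‖ ∧
        ∀ q ∈ Γ, inner ℂ q p = inner ℂ (π q) f := by
  have : CompleteSpace Γ := hΓ.completeSpace_coe
  -- The resolvent is `P P*`: by the Riesz theorem `P* f` is the variational solution together with
  -- its remaining graph components. Self-adjointness is then evident, and `‖P‖ ≤ 1` bounds the
  -- solution and its derivatives by `‖f‖` at once.
  let P : Γ →L[ℂ] H := π ∘L Γ.subtypeL
  have hP : ∀ (f : H) (q : Γ), inner ℂ (q : X) ((P.adjoint f : Γ) : X) = inner ℂ (π q) f :=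
    fun f q => ContinuousLinearMap.adjoint_inner_right P q f
  have hR : IsResolvent (operatorGraph D a) (P ∘L P.adjoint) := by
    intro f u
    constructor
    · rintro rfl
      refine ⟨hD ▸ ⟨P.adjoint f, (P.adjoint f).2, rfl⟩, fun v hv => ?_⟩
      obtain ⟨q, hq, rfl⟩ := hD ▸ hv
      have h1 := hP f ⟨q, hq⟩
      have h2 := ha _ (P.adjoint f).2 q hq
      rw [inner_sub_right]
      change inner ℂ (π q) f - inner ℂ (π q) (π (P.adjoint f)) = a (π (P.adjoint f)) (π q)
      rw [← h1, ← h2]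
      ring
    · rintro ⟨hu, hv⟩
      obtain ⟨p, hp, rfl⟩ := hD ▸ hu
      have h1 : P.adjoint f = ⟨p, hp⟩ := by
        refine ext_inner_left ℂ fun q => ?_
        change inner ℂ (q : X) ((P.adjoint f : Γ) : X) = inner ℂ (q : X) p
        have h2 := hv (π q) (hD ▸ ⟨q, q.2, rfl⟩)
        dsimp only at h2
        rw [hP, ← ha p hp q q.2, ← h2, inner_sub_right, sub_add_cancel]
      change π (P.adjoint f : Γ) = π p
      rw [h1]
  rw [formResolvent_eq hR]
  refine ⟨hR, ?_, fun f => ⟨P.adjoint f, (P.adjoint f).2, rfl, ?_, fun q hq => hP f ⟨q, hq⟩⟩⟩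
  · rw [ContinuousLinearMap.isSelfAdjoint_iff', ContinuousLinearMap.adjoint_comp,
      ContinuousLinearMap.adjoint_adjoint]
  · have hn : ‖P‖ ≤ 1 := P.opNorm_le_bound zero_le_one fun q => by
      rw [one_mul]
      exact hπ q
    have h1 := P.adjoint.le_opNorm f
    rw [LinearIsometryEquiv.norm_map] at h1
    exact h1.trans (mul_le_of_le_one_left (norm_nonneg _) hn)

end Resolvent

/-! ### Weak derivatives as closed operators -/

section WeakDerivative

theorem exists_mulOperator {X : Type*} [MeasurableSpace X] {μ : Measure X} {m : X → ℝ}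
    (hm : MemLp m ⊤ μ) :
    ∃ M : Lp ℂ 2 μ →L[ℂ] Lp ℂ 2 μ, ∀ u, M u =ᵐ[μ] fun x => (m x : ℂ) * u x := by
  have hm' : MemLp (fun x => (m x : ℂ)) ⊤ μ := hm.ofReal
  refine ⟨(ContinuousLinearMap.mul ℂ ℂ).holderL μ ⊤ 2 2 hm'.toLp, fun u => ?_⟩
  refine (ContinuousLinearMap.coeFn_holder (r := 2) (ContinuousLinearMap.mul ℂ ℂ) hm'.toLp u).trans ?_
  filter_upwards [hm'.coeFn_toLp] with x hx
  rw [hx, ContinuousLinearMap.mul_apply']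

theorem exists_integral_functional {X : Type*} [MeasurableSpace X] {μ : Measure X} {χ : X → ℝ}
    (hχ : MemLp χ 2 μ) :
    ∃ T : Lp ℂ 2 μ →L[ℂ] ℂ, ∀ u, T u = ∫ x, χ x • u x ∂μ := by
  have hχ' : MemLp (fun x => (χ x : ℂ)) 2 μ := hχ.ofReal
  refine ⟨innerSL ℂ hχ'.toLp, fun u => ?_⟩
  rw [innerSL_apply_apply, L2.inner_def]
  refine integral_congr_ae ?_
  filter_upwards [hχ'.coeFn_toLp] with x hx
  rw [hx, RCLike.inner_apply, Complex.conj_ofReal, mul_comm, Complex.real_smul]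

theorem RoomPassage.HasWeakDeriv.dir_smul {E : Type*} [NormedAddCommGroup E]
    [NormedSpace ℝ E] [MeasureSpace E] {Ω : Set E} {v : E} {u g : L2 Ω} (h : HasWeakDeriv Ω v u g)
    (c : ℝ) : HasWeakDeriv Ω (c • v) u ((c : ℂ) • g) := by
  intro φ hφ hc hs
  have h1 : ∫ x in Ω, φ x • ((c : ℂ) • g) x = (c : ℂ) • ∫ x in Ω, φ x • g x := by
    rw [← integral_smul]
    refine integral_congr_ae ?_
    filter_upwards [Lp.coeFn_smul (c : ℂ) g] with x hx
    rw [hx, Pi.smul_apply, smul_comm]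
  have h2 : ∀ x, fderiv ℝ φ x (c • v) • u x = (c : ℂ) • (fderiv ℝ φ x v • u x) := fun x => by
    rw [map_smul, smul_assoc, Complex.coe_smul]
  simp only [h2]
  rw [integral_smul, h φ hφ hc hs, h1, smul_neg]

variable {E : Type*} [NormedAddCommGroup E] [NormedSpace ℝ E] [MeasureSpace E] [BorelSpace E]
  [FiniteDimensional ℝ E] [IsLocallyFiniteMeasure (volume : Measure E)]

theorem memLp_test {φ : E → ℝ} (hφ : Continuous φ) (hc : HasCompactSupport φ) (Ω : Set E) :
    MemLp φ 2 (volume.restrict Ω) :=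
  (hφ.memLp_of_hasCompactSupport hc).mono_measure Measure.restrict_le_self

/-- The set of pairs `(u, g)` such that `g` is the weak derivative of `u` is a closed subspace. -/
theorem exists_weakDerivGraph (Ω : Set E) (v : E) :
    ∃ S : Submodule ℂ (L2 Ω × L2 Ω), IsClosed (S : Set (L2 Ω × L2 Ω)) ∧
      ∀ p, p ∈ S ↔ HasWeakDeriv Ω v p.1 p.2 := by
  have hT : ∀ φ : {φ : E → ℝ // ContDiff ℝ ∞ φ ∧ HasCompactSupport φ ∧ tsupport φ ⊆ Ω},
      ∃ T : L2 Ω × L2 Ω →L[ℂ] ℂ, ∀ p, T p =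
        (∫ x in Ω, (fderiv ℝ φ.1 x v) • p.1 x) + ∫ x in Ω, φ.1 x • p.2 x := by
    rintro ⟨φ, hφ, hc, hs⟩
    have hd : Continuous fun x => fderiv ℝ φ x v :=
      (hφ.continuous_fderiv (by simp)).clm_apply continuous_const
    have hdc : HasCompactSupport fun x => fderiv ℝ φ x v := hc.fderiv_apply ℝ v
    obtain ⟨T₁, hT₁⟩ := exists_integral_functional (memLp_test hd hdc Ω)
    obtain ⟨T₂, hT₂⟩ := exists_integral_functional (memLp_test hφ.continuous hc Ω)
    refine ⟨T₁ ∘L ContinuousLinearMap.fst ℂ _ _ + T₂ ∘L ContinuousLinearMap.snd ℂ _ _,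
      fun p => ?_⟩
    rw [← hT₁, ← hT₂]
    rfl
  choose T hT using hT
  -- Each test function imposes one continuous linear condition on the pair; the graph is the
  -- intersection of the kernels.
  refine ⟨⨅ φ, LinearMap.ker (T φ : L2 Ω × L2 Ω →ₗ[ℂ] ℂ), ?_, fun p => ?_⟩
  · rw [Submodule.coe_iInf]
    exact isClosed_iInter fun φ => (T φ).isClosed_ker
  · rw [Submodule.mem_iInf]
    simp only [LinearMap.mem_ker, ContinuousLinearMap.coe_coe, hT, HasWeakDeriv, Subtype.forall,
      and_imp, add_eq_zero_iff_eq_neg]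

theorem RoomPassage.HasWeakDeriv.unique {Ω : Set E} (hΩ : IsOpen Ω) {v : E} {u g g' : L2 Ω}
    (h : HasWeakDeriv Ω v u g) (h' : HasWeakDeriv Ω v u g') : g = g' := by
  have hg := (Lp.memLp g).locallyIntegrableOn_restrict
  have hg' := (Lp.memLp g').locallyIntegrableOn_restrict
  refine Lp.ext ?_
  have h0 := hΩ.ae_eq_zero_of_integral_contDiff_smul_eq_zero (hg.sub hg') fun φ hφ hc hs => ?_
  · rw [Filter.EventuallyEq, ae_restrict_iff' hΩ.measurableSet]
    filter_upwards [h0] with x hx hxΩ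
    exact sub_eq_zero.1 (hx hxΩ)
  · have i1 := integrable_test_smul hg hφ.continuous hc hs
    have i2 := integrable_test_smul hg' hφ.continuous hc hs
    have e := (h φ hφ hc hs).symm.trans (h' φ hφ hc hs)
    rw [neg_inj, setIntegral_smul_of_tsupport_subset hs,
      setIntegral_smul_of_tsupport_subset hs] at e
    simp only [Pi.sub_apply, smul_sub]
    rw [integral_sub i1 i2, e, sub_self]

theorem RoomPassage.HasWeakDeriv.weakDeriv_eq {Ω : Set E} (hΩ : IsOpen Ω) {v : E} {u g : L2 Ω}
    (h : HasWeakDeriv Ω v u g) : weakDeriv Ω v u = g := by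
  have hex : ∃ g : L2 Ω, HasWeakDeriv Ω v u g := ⟨g, h⟩
  rw [weakDeriv, dif_pos hex]
  exact hex.choose_spec.unique hΩ h

theorem RoomPassage.HasWeakDeriv.dir_add {Ω : Set E} {v w : E} {u g k : L2 Ω} (h : HasWeakDeriv Ω v u g)
    (h' : HasWeakDeriv Ω w u k) : HasWeakDeriv Ω (v + w) u (g + k) := by
  intro φ hφ hc hs
  have hint : ∀ {χ : E → ℝ} (f : L2 Ω), Continuous χ → HasCompactSupport χ →
      Integrable (fun x => χ x • f x) (volume.restrict Ω) := fun f hχ hχc =>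
    memLp_one_iff_integrable.1 ((Lp.memLp f).smul (memLp_test hχ hχc Ω))
  have hd : ∀ v : E, Continuous fun x => fderiv ℝ φ x v := fun v =>
    (hφ.continuous_fderiv (by simp)).clm_apply continuous_const
  have hdc : ∀ v : E, HasCompactSupport fun x => fderiv ℝ φ x v := fun v => hc.fderiv_apply ℝ v
  have h1 : ∫ x in Ω, φ x • (g + k) x = (∫ x in Ω, φ x • g x) + ∫ x in Ω, φ x • k x := by
    rw [← integral_add (hint g hφ.continuous hc) (hint k hφ.continuous hc)]
    refine integral_congr_ae ?_
    filter_upwards [Lp.coeFn_add g k] with x hx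
    rw [hx, Pi.add_apply, smul_add]
  simp only [map_add, add_smul]
  rw [integral_add (hint u (hd v) (hdc v)) (hint u (hd w) (hdc w)), h φ hφ hc hs, h' φ hφ hc hs, h1,
    neg_add]

end WeakDerivative

theorem mem_H1_planar_iff {Ω : Set (ℝ × ℝ)} {u : L2 Ω} :
    u ∈ H1 Ω ↔ ∃ g₁ g₂ : L2 Ω, HasWeakDeriv Ω (1, 0) u g₁ ∧ HasWeakDeriv Ω (0, 1) u g₂ := by
  refine ⟨fun h => ?_, fun ⟨g₁, g₂, h₁, h₂⟩ v => ?_⟩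
  · obtain ⟨g₁, h₁⟩ := h (1, 0)
    obtain ⟨g₂, h₂⟩ := h (0, 1)
    exact ⟨g₁, g₂, h₁, h₂⟩
  · have := (h₁.dir_smul v.1).dir_add (h₂.dir_smul v.2)
    have hv : v.1 • ((1 : ℝ), (0 : ℝ)) + v.2 • ((0 : ℝ), (1 : ℝ)) = v := by
      ext <;> simp
    rw [hv] at this
    exact ⟨_, this⟩

theorem mem_H1_line_iff {Ω : Set ℝ} {u : L2 Ω} :
    u ∈ H1 Ω ↔ ∃ g : L2 Ω, HasWeakDeriv Ω 1 u g := by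
  refine ⟨fun h => h 1, fun ⟨g, h⟩ v => ?_⟩
  have := h.dir_smul v
  rw [smul_eq_mul, mul_one] at this
  exact ⟨_, this⟩

theorem hasWeakDeriv_line_iff {Ω : Set ℝ} {u g : L2 Ω} :
    HasWeakDeriv Ω 1 u g ↔ IsWeakDeriv Ω u g := by
  simp only [HasWeakDeriv, IsWeakDeriv, fderiv_eq_smul_deriv, one_smul]

/-! ### The resolvents of the Neumann operator and of the limit operator -/

/-- For `V ≥ 0` the potential term is the inner product of `√V u` and `√V v`, so it can be recorded
as one more component of the graph on which the form becomes an inner product. -/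
theorem exists_sqrtOperator {X : Type*} [MeasurableSpace X] {μ : Measure X} {V : X → ℝ}
    (hV : MemLp V ⊤ μ) (hV0 : ∀ᵐ x ∂μ, 0 ≤ V x) :
    ∃ M : Lp ℂ 2 μ →L[ℂ] Lp ℂ 2 μ, ∀ u v : Lp ℂ 2 μ,
      Integrable (fun x => (V x : ℂ) * u x * conj (v x)) μ ∧
        inner ℂ (M v) (M u) = ∫ x, (V x : ℂ) * u x * conj (v x) ∂μ := by
  have hs : MemLp (fun x => √(V x)) ⊤ μ := by
    refine memLp_top_of_bound (Real.continuous_sqrt.comp_aestronglyMeasurable hV.1)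
      (√(eLpNorm V ⊤ μ).toReal) ?_
    rw [eLpNorm_exponent_top]
    filter_upwards [ae_le_eLpNormEssSup (f := V) (μ := μ)] with x hx
    rw [Real.norm_of_nonneg (Real.sqrt_nonneg _)]
    refine Real.sqrt_le_sqrt ((le_abs_self _).trans ?_)
    rw [← Real.norm_eq_abs, ← toReal_enorm]
    have hfin : eLpNormEssSup V μ ≠ ⊤ := by
      rw [← eLpNorm_exponent_top]
      exact hV.2.ne
    exact ENNReal.toReal_mono hfin hx
  obtain ⟨M, hM⟩ := exists_mulOperator hs
  refine ⟨M, fun u v => ?_⟩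
  have hae : (fun x => inner ℂ (M v x) (M u x)) =ᵐ[μ] fun x => (V x : ℂ) * u x * conj (v x) := by
    filter_upwards [hM u, hM v, hV0] with x h1 h2 h3
    rw [h1, h2, RCLike.inner_apply, map_mul, Complex.conj_ofReal]
    have : ((√(V x) : ℝ) : ℂ) * ((√(V x) : ℝ) : ℂ) = V x := by
      rw [← Complex.ofReal_mul, Real.mul_self_sqrt h3]
    rw [← this]
    ring
  exact ⟨(L2.integrable_inner (𝕜 := ℂ) (M v) (M u)).congr hae,
    (L2.inner_def (𝕜 := ℂ) (M v) (M u)).trans (integral_congr_ae hae)⟩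

theorem L2_inner_eq {X : Type*} [MeasurableSpace X] {μ : Measure X} (u v : Lp ℂ 2 μ) :
    Integrable (fun x => u x * conj (v x)) μ ∧ inner ℂ v u = ∫ x, u x * conj (v x) ∂μ :=
  ⟨L2.integrable_inner (𝕜 := ℂ) v u, L2.inner_def (𝕜 := ℂ) v u⟩

/-- `formResolvent_spec` for the closed graph of `u ↦ (u, ∂₁u, ∂₂u, √V u)`, whose inner product is
the form plus that of `L²`. -/
theorem neumannResolvent_spec {Ω : Set (ℝ × ℝ)} (hΩ : IsOpen Ω) {V : ℝ × ℝ → ℝ}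
    (hV : MemLp V ⊤ (volume.restrict Ω)) (hV0 : ∀ᵐ x ∂(volume.restrict Ω), 0 ≤ V x) :
    IsResolvent (neumannGraph Ω V) (formResolvent (neumannGraph Ω V)) ∧
      IsSelfAdjoint (formResolvent (neumannGraph Ω V)) ∧
      ∀ w, ∃ g₁ g₂ : L2 Ω, HasWeakDeriv Ω (1, 0) (formResolvent (neumannGraph Ω V) w) g₁ ∧
        HasWeakDeriv Ω (0, 1) (formResolvent (neumannGraph Ω V) w) g₂ ∧
        ‖formResolvent (neumannGraph Ω V) w‖ ≤ ‖w‖ ∧ ‖g₁‖ ≤ ‖w‖ ∧ ‖g₂‖ ≤ ‖w‖ ∧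
        ∀ v k₁ k₂ : L2 Ω, HasWeakDeriv Ω (1, 0) v k₁ → HasWeakDeriv Ω (0, 1) v k₂ →
          inner ℂ v (w - formResolvent (neumannGraph Ω V) w) =
            inner ℂ k₁ g₁ + inner ℂ k₂ g₂ +
              ∫ x in Ω, (V x : ℂ) * formResolvent (neumannGraph Ω V) w x * conj (v x) := by
  obtain ⟨M, hM⟩ := exists_sqrtOperator hV hV0
  obtain ⟨S₁, hS₁c, hS₁⟩ := exists_weakDerivGraph Ω ((1, 0) : ℝ × ℝ)
  obtain ⟨S₂, hS₂c, hS₂⟩ := exists_weakDerivGraph Ω ((0, 1) : ℝ × ℝ)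
  let X := PiLp 2 fun _ : Fin 4 => L2 Ω
  let pr : Fin 4 → X →L[ℂ] L2 Ω := fun i => PiLp.proj 2 (fun _ : Fin 4 => L2 Ω) i
  let Γ : Submodule ℂ X :=
    S₁.comap ((pr 0).prod (pr 1) : X →ₗ[ℂ] L2 Ω × L2 Ω) ⊓
      S₂.comap ((pr 0).prod (pr 2) : X →ₗ[ℂ] L2 Ω × L2 Ω) ⊓
      LinearMap.ker (pr 3 - M ∘L pr 0 : X →ₗ[ℂ] L2 Ω)
  have hΓ : ∀ p : X, p ∈ Γ ↔ HasWeakDeriv Ω (1, 0) (p 0) (p 1) ∧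
      HasWeakDeriv Ω (0, 1) (p 0) (p 2) ∧ p 3 = M (p 0) := by
    intro p
    rw [← hS₁ (p 0, p 1), ← hS₂ (p 0, p 2), ← and_assoc]
    exact and_congr Iff.rfl sub_eq_zero
  have hΓc : IsClosed (Γ : Set X) :=
    ((hS₁c.preimage ((pr 0).prod (pr 1)).continuous).inter
      (hS₂c.preimage ((pr 0).prod (pr 2)).continuous)).inter (pr 3 - M ∘L pr 0).isClosed_ker
  have hD : H1 Ω = pr 0 '' Γ := by
    ext u
    rw [mem_H1_planar_iff]
    constructor
    · rintro ⟨g₁, g₂, h₁, h₂⟩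
      exact ⟨WithLp.toLp 2 ![u, g₁, g₂, M u], (hΓ _).2 ⟨h₁, h₂, rfl⟩, rfl⟩
    · rintro ⟨p, hp, rfl⟩
      exact ⟨p 1, p 2, ((hΓ p).1 hp).1, ((hΓ p).1 hp).2.1⟩
  have hinner : ∀ p q : X, inner ℂ q p = inner ℂ (q 0) (p 0) + inner ℂ (q 1) (p 1) +
      inner ℂ (q 2) (p 2) + inner ℂ (q 3) (p 3) := fun p q => by
    rw [PiLp.inner_apply, Fin.sum_univ_four]
  have ha : ∀ p ∈ Γ, ∀ q ∈ Γ, planarForm Ω V (pr 0 p) (pr 0 q) + inner ℂ (pr 0 q) (pr 0 p) =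
      inner ℂ q p := by
    intro p hp q hq
    obtain ⟨hp1, hp2, hp3⟩ := (hΓ p).1 hp
    obtain ⟨hq1, hq2, hq3⟩ := (hΓ q).1 hq
    change planarForm Ω V (p 0) (q 0) + inner ℂ (q 0) (p 0) = _
    rw [hinner, planarForm, hp1.weakDeriv_eq hΩ, hp2.weakDeriv_eq hΩ, hq1.weakDeriv_eq hΩ,
      hq2.weakDeriv_eq hΩ, integral_add ((L2_inner_eq (p 1) (q 1)).1.fun_add
        (L2_inner_eq (p 2) (q 2)).1) (hM (p 0) (q 0)).1,
      integral_add (L2_inner_eq (p 1) (q 1)).1 (L2_inner_eq (p 2) (q 2)).1,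
      ← (L2_inner_eq (p 1) (q 1)).2, ← (L2_inner_eq (p 2) (q 2)).2, ← (hM (p 0) (q 0)).2, hp3, hq3]
    ring
  obtain ⟨hR, hsa, hex⟩ := formResolvent_spec Γ hΓc (pr 0)
    (fun p => PiLp.norm_apply_le p 0) hD ha
  refine ⟨hR, hsa, fun w => ?_⟩
  obtain ⟨p, hp, hpR, hpn, hq⟩ := hex w
  change p 0 = formResolvent (neumannGraph Ω V) w at hpR
  obtain ⟨hp1, hp2, hp3⟩ := (hΓ p).1 hp
  rw [← hpR]
  refine ⟨p 1, p 2, hp1, hp2, (PiLp.norm_apply_le p 0).trans hpn,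
    (PiLp.norm_apply_le p 1).trans hpn, (PiLp.norm_apply_le p 2).trans hpn,
    fun v k₁ k₂ h₁ h₂ => ?_⟩
  have e := hq (WithLp.toLp 2 ![v, k₁, k₂, M v]) ((hΓ _).2 ⟨h₁, h₂, rfl⟩)
  rw [hinner] at e
  change inner ℂ v (p 0) + inner ℂ k₁ (p 1) + inner ℂ k₂ (p 2) + inner ℂ (M v) (p 3) =
    inner ℂ v w at e
  rw [inner_sub_right, ← e, hp3, (hM (p 0) v).2]
  ring

/-! ### Point values -/

theorem pointValue_eq {Ω : Set ℝ} (hΩ : IsOpen Ω) {f : L2 Ω} {Fc : ℝ → ℂ}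
    (hc : ContinuousOn Fc Ω) (hf : f =ᵐ[volume.restrict Ω] Fc) {x : ℝ} (hx : x ∈ Ω) :
    pointValue Ω f x = Fc x := by
  have hex : ∃ g : ℝ → ℂ, ContinuousOn g Ω ∧ f =ᵐ[volume.restrict Ω] g := ⟨Fc, hc, hf⟩
  rw [pointValue, dif_pos hex]
  exact Measure.eqOn_open_of_ae_eq (hex.choose_spec.2.symm.trans hf) hΩ hex.choose_spec.1 hc hx

theorem RoomPassage.HasWeakDeriv.exists_continuousOn {Ω : Set ℝ} (hΩ : IsOpen Ω)
    (hord : Ω.OrdConnected) {f g : L2 Ω} (h : HasWeakDeriv Ω 1 f g) :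
    ∃ Fc : ℝ → ℂ, ContinuousOn Fc Ω ∧ f =ᵐ[volume.restrict Ω] Fc ∧
      (∀ x ∈ Ω, ∀ y ∈ Ω, Fc y - Fc x = ∫ t in x..y, g t) ∧ ∀ x ∈ Ω, pointValue Ω f x = Fc x := by
  obtain ⟨Fc, h1, h2, h3⟩ := (hasWeakDeriv_line_iff.1 h).exists_continuousOn hΩ hord
    (Lp.memLp f).locallyIntegrableOn_restrict (Lp.memLp g).locallyIntegrableOn_restrict
  exact ⟨Fc, h1, h2, h3, fun x hx => pointValue_eq hΩ h1 h2 hx⟩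

/-- One-dimensional Sobolev embedding with explicit constants: the mean is controlled by `F`, the
deviation from it by `G`. -/
theorem norm_le_of_primitive {a b : ℝ} (hab : a < b) {F Fc G : ℝ → ℂ}
    (hF : MemLp F 2 (volume.restrict (Ioo a b))) (hG : MemLp G 2 (volume.restrict (Ioo a b)))
    (hae : F =ᵐ[volume.restrict (Ioo a b)] Fc)
    (hFc : ∀ x ∈ Ioo a b, ∀ y ∈ Ioo a b, Fc y - Fc x = ∫ t in x..y, G t) {y : ℝ}
    (hy : y ∈ Ioo a b) :
    ‖Fc y‖ ≤ (√(b - a))⁻¹ * (eLpNorm F 2 (volume.restrict (Ioo a b))).toReal +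
      √(b - a) * (eLpNorm G 2 (volume.restrict (Ioo a b))).toReal := by
  have hpos : 0 < b - a := sub_pos.2 hab
  have e1 := norm_mean_sub_le_of_primitive hF hG hae hFc hy le_rfl hab le_rfl
  have e2 : ‖(b - a)⁻¹ • (∫ x in Ioo a b, F x)‖ ≤
      (√(b - a))⁻¹ * (eLpNorm F 2 (volume.restrict (Ioo a b))).toReal := by
    have h := (norm_integral_le_integral_norm F).trans (integral_norm_le_sqrt_mul hF)
    rw [measureReal_restrict_apply_univ, Real.volume_real_Ioo_of_le hab.le] at h
    rw [norm_smul, norm_inv, Real.norm_of_nonneg hpos.le, inv_mul_le_iff₀ hpos]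
    refine h.trans (le_of_eq ?_)
    have : √(b - a) ≠ 0 := (Real.sqrt_pos.2 hpos).ne'
    field_simp
    rw [Real.sq_sqrt hpos.le]
  have e3 := norm_sub_norm_le (Fc y) ((b - a)⁻¹ • ∫ x in Ioo a b, F x)
  rw [norm_sub_rev] at e3
  linarith

theorem eLpNorm_restrict_toReal_le {Ω I : Set ℝ} (hI : I ⊆ Ω) (f : L2 Ω) :
    (eLpNorm f 2 (volume.restrict I)).toReal ≤ ‖f‖ := by
  rw [Lp.norm_def]
  exact eLpNorm_toReal_mono_restrict hI (Lp.memLp f)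

/-- Evaluation at a point as a continuous functional of a function and its weak derivative. -/
theorem exists_pointValue_functional {Ω : Set ℝ} (hΩ : IsOpen Ω) (hord : Ω.OrdConnected) {x : ℝ}
    (hx : x ∈ Ω) :
    ∃ T : L2 Ω × L2 Ω →L[ℂ] ℂ, ∀ f g : L2 Ω, HasWeakDeriv Ω 1 f g →
      T (f, g) = pointValue Ω f x := by
  obtain ⟨S, -, hS⟩ := exists_weakDerivGraph Ω (1 : ℝ)
  obtain ⟨r, hr, hball⟩ := Metric.isOpen_iff.1 hΩ x hx
  rw [Real.ball_eq_Ioo] at hball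
  have hxI : x ∈ Ioo (x - r) (x + r) := ⟨by linarith, by linarith⟩
  let L : S →ₗ[ℂ] ℂ :=
    { toFun := fun p => pointValue Ω p.1.1 x
      map_add' := fun p q => by
        obtain ⟨F, hF1, hF2, -, hF4⟩ := ((hS p.1).1 p.2).exists_continuousOn hΩ hord
        obtain ⟨G, hG1, hG2, -, hG4⟩ := ((hS q.1).1 q.2).exists_continuousOn hΩ hord
        rw [hF4 x hx, hG4 x hx]
        refine pointValue_eq hΩ (hF1.add hG1) ?_ hx
        exact (Lp.coeFn_add p.1.1 q.1.1).trans (hF2.add hG2)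
      map_smul' := fun c p => by
        obtain ⟨F, hF1, hF2, -, hF4⟩ := ((hS p.1).1 p.2).exists_continuousOn hΩ hord
        rw [hF4 x hx]
        refine pointValue_eq hΩ (hF1.const_smul c) ?_ hx
        exact (Lp.coeFn_smul c p.1.1).trans (hF2.const_smul c) }
  have hL : ∀ p, ‖L p‖ ≤ ((√(x + r - (x - r)))⁻¹ + √(x + r - (x - r))) * ‖p‖ := by
    intro p
    obtain ⟨F, -, hF2, hF3, hF4⟩ := ((hS p.1).1 p.2).exists_continuousOn hΩ hord
    have hm : ∀ f : L2 Ω, MemLp f 2 (volume.restrict (Ioo (x - r) (x + r))) := fun f =>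
      (Lp.memLp f).mono_measure (Measure.restrict_mono hball le_rfl)
    have e := norm_le_of_primitive (by linarith) (hm p.1.1) (hm p.1.2)
      (ae_restrict_of_ae_restrict_of_subset hball hF2)
      (fun y hy z hz => hF3 y (hball hy) z (hball hz)) hxI
    change ‖pointValue Ω p.1.1 x‖ ≤ _
    rw [hF4 x hx, add_mul]
    have e1 : ‖p.1.1‖ ≤ ‖p‖ := norm_fst_le p.1
    have e2 : ‖p.1.2‖ ≤ ‖p‖ := norm_snd_le p.1
    refine e.trans (add_le_add ?_ ?_)
    · exact mul_le_mul_of_nonneg_left ((eLpNorm_restrict_toReal_le hball _).trans e1)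
        (by positivity)
    · exact mul_le_mul_of_nonneg_left ((eLpNorm_restrict_toReal_le hball _).trans e2)
        (by positivity)
  -- Evaluation is linear and bounded only on the graph `S`. The Hahn–Banach extension makes it a
  -- continuous functional on all pairs; its values off `S` play no role.
  obtain ⟨T, hT, -⟩ := exists_extension_norm_eq S (L.mkContinuous _ hL)
  exact ⟨T, fun f g h => hT ⟨(f, g), (hS (f, g)).2 h⟩⟩

/-- `formResolvent_spec` for the components `f`, `f₁'`, `√V f₁` and `√γ f₁(0)`. The last one encodes
the δ-interaction, closedness being due to the continuity of point evaluation along the graph. The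
summand `ℂ` enters only through `f` itself, as the form vanishes there. -/
theorem limitResolvent_spec {Ω : Set ℝ} (hΩ : IsOpen Ω) (hord : Ω.OrdConnected)
    (h0 : (0 : ℝ) ∈ Ω) {V : ℝ → ℝ} (hV : MemLp V ⊤ (volume.restrict Ω))
    (hV0 : ∀ᵐ x ∂(volume.restrict Ω), 0 ≤ V x) {γ : ℝ} (hγ : 0 ≤ γ) :
    IsResolvent (limitGraph Ω V γ) (formResolvent (limitGraph Ω V γ)) ∧
      IsSelfAdjoint (formResolvent (limitGraph Ω V γ)) ∧
      ∀ f, ∃ g' : L2 Ω, HasWeakDeriv Ω 1 (formResolvent (limitGraph Ω V γ) f).fst g' ∧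
        ‖formResolvent (limitGraph Ω V γ) f‖ ≤ ‖f‖ ∧ ‖g'‖ ≤ ‖f‖ ∧
        ∀ (v : LimitSpace Ω) (k : L2 Ω), HasWeakDeriv Ω 1 v.fst k →
          inner ℂ v (f - formResolvent (limitGraph Ω V γ) f) = inner ℂ k g' +
            (∫ x in Ω, (V x : ℂ) * (formResolvent (limitGraph Ω V γ) f).fst x * conj (v.fst x)) +
            γ * pointValue Ω (formResolvent (limitGraph Ω V γ) f).fst 0 *
              conj (pointValue Ω v.fst 0) := by
  obtain ⟨M, hM⟩ := exists_sqrtOperator hV hV0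
  obtain ⟨S, hSc, hS⟩ := exists_weakDerivGraph Ω (1 : ℝ)
  obtain ⟨T, hT⟩ := exists_pointValue_functional hΩ hord h0
  let X := WithLp 2 (LimitSpace Ω × WithLp 2 (WithLp 2 (L2 Ω × L2 Ω) × ℂ))
  let π : X →L[ℂ] LimitSpace Ω := WithLp.fstL 2 ℂ _ _
  let p₀ : X →L[ℂ] L2 Ω := WithLp.fstL 2 ℂ _ _ ∘L π
  let p₁ : X →L[ℂ] L2 Ω := WithLp.fstL 2 ℂ _ _ ∘L WithLp.fstL 2 ℂ _ _ ∘L WithLp.sndL 2 ℂ _ _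
  let p₂ : X →L[ℂ] L2 Ω := WithLp.sndL 2 ℂ _ _ ∘L WithLp.fstL 2 ℂ _ _ ∘L WithLp.sndL 2 ℂ _ _
  let p₃ : X →L[ℂ] ℂ := WithLp.sndL 2 ℂ _ _ ∘L WithLp.sndL 2 ℂ _ _
  let mk : LimitSpace Ω → L2 Ω → L2 Ω → ℂ → X := fun f g m c =>
    WithLp.toLp 2 (f, WithLp.toLp 2 (WithLp.toLp 2 (g, m), c))
  let Γ : Submodule ℂ X :=
    S.comap (p₀.prod p₁ : X →ₗ[ℂ] L2 Ω × L2 Ω) ⊓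
      LinearMap.ker (p₂ - M ∘L p₀ : X →ₗ[ℂ] L2 Ω) ⊓
      LinearMap.ker (p₃ - ((√γ : ℝ) : ℂ) • (T ∘L p₀.prod p₁) : X →ₗ[ℂ] ℂ)
  have hΓ : ∀ p : X, p ∈ Γ ↔ HasWeakDeriv Ω 1 (π p).fst (p₁ p) ∧ p₂ p = M (π p).fst ∧
      p₃ p = ((√γ : ℝ) : ℂ) * pointValue Ω (π p).fst 0 := by
    intro p
    rw [← and_assoc]
    constructor
    · rintro ⟨⟨h1, h2⟩, h3⟩
      have h1' : HasWeakDeriv Ω 1 (π p).fst (p₁ p) := (hS (p₀ p, p₁ p)).1 h1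
      refine ⟨⟨h1', sub_eq_zero.1 h2⟩, ?_⟩
      rw [← hT _ _ h1']
      exact sub_eq_zero.1 h3
    · rintro ⟨⟨h1, h2⟩, h3⟩
      refine ⟨⟨(hS (p₀ p, p₁ p)).2 h1, sub_eq_zero.2 h2⟩, ?_⟩
      rw [← hT _ _ h1] at h3
      exact sub_eq_zero.2 h3
  have hΓc : IsClosed (Γ : Set X) :=
    ((hSc.preimage (p₀.prod p₁).continuous).inter (p₂ - M ∘L p₀).isClosed_ker).inter
      (p₃ - ((√γ : ℝ) : ℂ) • (T ∘L p₀.prod p₁)).isClosed_ker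
  have hmk : ∀ (f : LimitSpace Ω) (g : L2 Ω), HasWeakDeriv Ω 1 f.fst g →
      mk f g (M f.fst) (((√γ : ℝ) : ℂ) * pointValue Ω f.fst 0) ∈ Γ := fun f g h =>
    (hΓ _).2 ⟨h, rfl, rfl⟩
  have hD : limitDomain Ω = π '' Γ := by
    ext f
    constructor
    · intro hf
      obtain ⟨g, hg⟩ := mem_H1_line_iff.1 hf
      exact ⟨_, hmk f g hg, rfl⟩
    · rintro ⟨p, hp, rfl⟩
      exact mem_H1_line_iff.2 ⟨_, ((hΓ p).1 hp).1⟩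
  have hinner : ∀ p q : X, inner ℂ q p = inner ℂ (π q) (π p) + (inner ℂ (p₁ q) (p₁ p) +
      inner ℂ (p₂ q) (p₂ p) + inner ℂ (p₃ q) (p₃ p)) := fun p q => by
    rw [WithLp.prod_inner_apply, WithLp.prod_inner_apply, WithLp.prod_inner_apply]
    rfl
  have hpv : ∀ a b : ℂ, inner ℂ (((√γ : ℝ) : ℂ) * b) (((√γ : ℝ) : ℂ) * a) = γ * a * conj b := by
    intro a b
    rw [RCLike.inner_apply, map_mul, Complex.conj_ofReal]
    have : ((√γ : ℝ) : ℂ) * ((√γ : ℝ) : ℂ) = γ := by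
      rw [← Complex.ofReal_mul, Real.mul_self_sqrt hγ]
    rw [← this]
    ring
  have ha : ∀ p ∈ Γ, ∀ q ∈ Γ, limitForm Ω V γ (π p) (π q) + inner ℂ (π q) (π p) =
      inner ℂ q p := by
    intro p hp q hq
    obtain ⟨hp1, hp2, hp3⟩ := (hΓ p).1 hp
    obtain ⟨hq1, hq2, hq3⟩ := (hΓ q).1 hq
    rw [hinner, limitForm, hp1.weakDeriv_eq hΩ, hq1.weakDeriv_eq hΩ,
      integral_add (L2_inner_eq (p₁ p) (p₁ q)).1 (hM (π p).fst (π q).fst).1,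
      ← (L2_inner_eq (p₁ p) (p₁ q)).2, ← (hM (π p).fst (π q).fst).2, hp2, hq2, hp3, hq3, hpv]
    ring
  have hle₁ : ∀ p : X, ‖p₁ p‖ ≤ ‖p‖ := fun p =>
    (WithLp.norm_fst_le _ _).trans ((WithLp.norm_fst_le _ _).trans (WithLp.norm_snd_le _ _))
  obtain ⟨hR, hsa, hex⟩ := formResolvent_spec Γ hΓc π (fun p => WithLp.norm_fst_le _ p) hD ha
  refine ⟨hR, hsa, fun f => ?_⟩
  obtain ⟨p, hp, hpR, hpn, hq⟩ := hex f
  change π p = formResolvent (limitGraph Ω V γ) f at hpR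
  obtain ⟨hp1, hp2, hp3⟩ := (hΓ p).1 hp
  rw [← hpR]
  refine ⟨p₁ p, hp1, (WithLp.norm_fst_le _ p).trans hpn, (hle₁ p).trans hpn, fun v k hk => ?_⟩
  have e := hq _ (hmk v k hk)
  rw [hinner] at e
  change inner ℂ v (π p) + (inner ℂ k (p₁ p) + inner ℂ (M v.fst) (p₂ p) +
    inner ℂ (((√γ : ℝ) : ℂ) * pointValue Ω v.fst 0) (p₃ p)) = inner ℂ v f at e
  rw [inner_sub_right, ← e, hp2, hp3, (hM (π p).fst v.fst).2, hpv]
  ring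

/-! ### Geometry of the waveguide -/

theorem ordConnected_interval (lm lp : EReal) : (interval lm lp).OrdConnected :=
  ⟨fun _ hx _ hy _ hz => ⟨hx.1.trans_le (EReal.coe_le_coe_iff.2 hz.1),
    (EReal.coe_le_coe_iff.2 hz.2).trans_lt hy.2⟩⟩

theorem passage_eq_prod (d h : ℝ) : passage d h = Ioo (-(d / 2)) (d / 2) ×ˢ Ioo 0 h := by
  ext x
  simp [passage, abs_lt]

theorem room_eq_prod (h b : ℝ) : room h b = Ioo (-(b / 2)) (b / 2) ×ˢ Ioo h (h + b) := by
  ext x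
  simp [room, abs_lt]

theorem isOpen_waveguide (lm lp : EReal) (ε d h b : ℝ) : IsOpen (waveguide lm lp ε d h b) :=
  isOpen_interior

theorem passage_subset (lm lp : EReal) (ε d h b : ℝ) :
    passage d h ⊆ waveguide lm lp ε d h b := fun _ hx =>
  union_subset_waveguide lm lp ε d h b (Or.inl (Or.inr hx))

/-- Passing to the interior of the closure adds only points of the three frontiers, and frontiers of
convex sets are null sets. -/
theorem ae_mem_waveguide (lm lp : EReal) (ε d h b : ℝ) :
    ∀ᵐ x ∂((volume : Measure (ℝ × ℝ)).restrict (waveguide lm lp ε d h b)),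
      x ∈ strip lm lp ε ∪ passage d h ∪ room h b := by
  have h0 : volume (frontier (strip lm lp ε)) = 0 :=
    ((ordConnected_interval lm lp).convex.prod (convex_Ioo _ _)).addHaar_frontier volume
  have h1 : volume (frontier (passage d h)) = 0 := by
    rw [passage_eq_prod]
    exact ((convex_Ioo _ _).prod (convex_Ioo _ _)).addHaar_frontier volume
  have h2 : volume (frontier (room h b)) = 0 := by
    rw [room_eq_prod]
    exact ((convex_Ioo _ _).prod (convex_Ioo _ _)).addHaar_frontier volume
  rw [ae_restrict_iff' (isOpen_waveguide lm lp ε d h b).measurableSet]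
  filter_upwards [compl_mem_ae_iff.2 h0, compl_mem_ae_iff.2 h1, compl_mem_ae_iff.2 h2]
    with x hx0 hx1 hx2 hx
  have hcl := interior_subset hx
  rw [closure_union, closure_union] at hcl
  rcases hcl with (hc | hc) | hc
  · exact Or.inl (Or.inl (by_contra fun hn => hx0
      ⟨hc, by rwa [(isOpen_strip lm lp ε).interior_eq]⟩))
  · exact Or.inl (Or.inr (by_contra fun hn => hx1 ⟨hc, by rwa [(isOpen_passage d h).interior_eq]⟩))
  · exact Or.inr (by_contra fun hn => hx2 ⟨hc, by rwa [(isOpen_room h b).interior_eq]⟩)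

/-- The column is open and contained in the closure of the union, so it lies in the waveguide. It
crosses both mouths of the passage, which allows vertical section integrals to be followed from the
strip into the room. -/
theorem tall_subset_waveguide {lm lp : EReal} {ε d h b : ℝ} (hd : 0 < d) (hh : 0 < h)
    (hdb : d ≤ b) (hdI : Ioo (-(d / 2)) (d / 2) ⊆ interval lm lp) :
    Ioo (-(d / 2)) (d / 2) ×ˢ Ioo (-ε) (h + b) ⊆ waveguide lm lp ε d h b := by
  refine interior_maximal ?_ (isOpen_Ioo.prod isOpen_Ioo)
  have hP : Icc (-(d / 2)) (d / 2) ×ˢ Icc 0 h ⊆ closure (passage d h) := by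
    rw [passage_eq_prod, closure_prod_eq, closure_Ioo (by linarith), closure_Ioo (by linarith)]
  rintro ⟨x, y⟩ ⟨hx, hy⟩
  rcases lt_or_ge y 0 with h0 | h0
  · exact subset_closure (Or.inl (Or.inl ⟨hdI hx, hy.1, h0⟩))
  rcases le_or_gt y h with h1 | h1
  · exact closure_mono (subset_union_right.trans subset_union_left)
      (hP ⟨Ioo_subset_Icc_self hx, h0, h1⟩)
  · refine subset_closure (Or.inr ?_)
    rw [room_eq_prod]
    exact ⟨⟨by linarith [hx.1], by linarith [hx.2]⟩, h1, hy.2⟩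

/-- The part of the waveguide below `h` has an open projection contained in the closed interval,
which therefore misses the end points. Horizontal slices of test functions below `h` are thus
supported in `Ω₀`; above `h` the room may stick out of it. -/
theorem fst_mem_interval {lm lp : EReal} {ε d h b : ℝ} (hd : 0 < d) (hb : 0 < b)
    (hdI : Icc (-(d / 2)) (d / 2) ⊆ interval lm lp) {x : ℝ × ℝ}
    (hx : x ∈ waveguide lm lp ε d h b) (hxh : x.2 < h) : x.1 ∈ interval lm lp := by
  have hopen : IsOpen (Prod.fst '' (waveguide lm lp ε d h b ∩ {y | y.2 < h})) :=
    isOpenMap_fst _ ((isOpen_waveguide lm lp ε d h b).inter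
      (isOpen_lt continuous_snd continuous_const))
  have hcl : IsClosed {t : ℝ | lm ≤ (t : EReal) ∧ (t : EReal) ≤ lp} :=
    (isClosed_le continuous_const continuous_coe_real_ereal).inter
      (isClosed_le continuous_coe_real_ereal continuous_const)
  have hsub : Prod.fst '' (waveguide lm lp ε d h b ∩ {y | y.2 < h}) ⊆
      {t : ℝ | lm ≤ (t : EReal) ∧ (t : EReal) ≤ lp} := by
    rintro _ ⟨y, ⟨hy, hyh⟩, rfl⟩
    have hc := interior_subset hy
    rw [closure_union, closure_union, strip, passage_eq_prod, room_eq_prod, closure_prod_eq,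
      closure_prod_eq, closure_prod_eq, closure_Ioo (show -(d / 2) ≠ d / 2 by linarith),
      closure_Ioo (show h ≠ h + b by linarith)] at hc
    rcases hc with (hc | hc) | hc
    · exact closure_minimal (t := {t : ℝ | lm ≤ (t : EReal) ∧ (t : EReal) ≤ lp})
        (fun t (ht : t ∈ interval lm lp) => ⟨ht.1.le, ht.2.le⟩) hcl hc.1
    · exact ⟨(hdI hc.1).1.le, (hdI hc.1).2.le⟩
    · exact absurd hc.2.1 (not_le.2 hyh)
  have hmem := hopen.mem_nhds ⟨x, ⟨hx, hxh⟩, rfl⟩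
  obtain ⟨δ, hδ, hball⟩ := Metric.mem_nhds_iff.1 hmem
  rw [Real.ball_eq_Ioo] at hball
  have h1 := hsub (hball (⟨by linarith, by linarith⟩ : x.1 - δ / 2 ∈ Ioo (x.1 - δ) (x.1 + δ)))
  have h2 := hsub (hball (⟨by linarith, by linarith⟩ : x.1 + δ / 2 ∈ Ioo (x.1 - δ) (x.1 + δ)))
  exact ⟨h1.1.trans_lt (EReal.coe_lt_coe_iff.2 (by linarith)),
    lt_of_lt_of_le (EReal.coe_lt_coe_iff.2 (by linarith)) h2.2⟩

/-! ### The potential -/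

theorem memLp_potential {lm lp : EReal} {ε : ℝ} (d h b : ℝ) {V₀ : ℝ → ℝ}
    (hV : MemLp V₀ ⊤ (volume.restrict (interval lm lp))) :
    MemLp (potential lm lp ε V₀) ⊤ (volume.restrict (waveguide lm lp ε d h b)) := by
  have e : potential lm lp ε V₀ = (strip lm lp ε).indicator fun x => V₀ x.1 := by
    ext x
    by_cases hx : x ∈ strip lm lp ε <;> simp [potential, hx]
  rw [e, memLp_indicator_iff_restrict (isOpen_strip lm lp ε).measurableSet,
    Measure.restrict_restrict_of_subset (strip_subset lm lp ε d h b), restrict_strip]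
  exact hV.comp_fst _

theorem ae_strip_of_ae_interval {lm lp : EReal} {ε : ℝ} {p : ℝ → Prop}
    (hp : ∀ᵐ x ∂((volume : Measure ℝ).restrict (interval lm lp)), p x) :
    ∀ᵐ x ∂(volume : Measure (ℝ × ℝ)), x ∈ strip lm lp ε → p x.1 := by
  rw [← ae_restrict_iff' (isOpen_strip lm lp ε).measurableSet, restrict_strip]
  exact Measure.quasiMeasurePreserving_fst.ae hp

theorem ae_potential_nonneg {lm lp : EReal} {ε : ℝ} (d h b : ℝ) {V₀ : ℝ → ℝ}
    (hV0 : ∀ᵐ x ∂(volume.restrict (interval lm lp)), 0 ≤ V₀ x) :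
    ∀ᵐ x ∂(volume.restrict (waveguide lm lp ε d h b)), 0 ≤ potential lm lp ε V₀ x := by
  filter_upwards [ae_restrict_of_ae (ae_strip_of_ae_interval (ε := ε) hV0)] with x hx
  by_cases hxs : x ∈ strip lm lp ε
  · simpa [potential, hxs] using hx hxs
  · simp [potential, hxs]

/-! ### The identification operators are adjoint to each other -/

section Adjoint

variable (lm lp : EReal) (ε d h b : ℝ)

theorem setIntegral_strip_eq {F : ℝ × ℝ → ℂ} (hF : IntegrableOn F (strip lm lp ε)) :
    ∫ x in strip lm lp ε, F x = ∫ x in interval lm lp, ∫ y in Ioo (-ε) 0, F (x, y) := by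
  rw [IntegrableOn, restrict_strip] at hF
  rw [restrict_strip, integral_prod _ hF]

theorem liftStrip_ae (f : L2 (interval lm lp)) :
    liftStrip lm lp ε d h b f =ᵐ[volume.restrict (waveguide lm lp ε d h b)]
      (strip lm lp ε).indicator fun x => ((ε ^ (-(1 / 2) : ℝ) : ℝ) : ℂ) * f x.1 :=
  MemLp.coeFn_toLp (memLp_liftFun lm lp ε d h b (Lp.memLp f))

theorem averageStrip_ae (u : L2 (waveguide lm lp ε d h b)) :
    averageStrip lm lp ε d h b u =ᵐ[volume.restrict (interval lm lp)] fun x =>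
      ((ε ^ (-(1 / 2) : ℝ) : ℝ) : ℂ) * ∫ y in Ioo (-ε) 0, u (x, y) :=
  MemLp.coeFn_toLp (memLp_sectionFun lm lp ε d h b u)

theorem liftRoom_ae (c : ℂ) :
    liftRoom lm lp ε d h b c =ᵐ[volume.restrict (waveguide lm lp ε d h b)]
      (room h b).indicator fun _ => ((b⁻¹ : ℝ) : ℂ) * c := by
  have hm : MeasurableSet (room h b) := (isOpen_room h b).measurableSet
  have hf : (volume.restrict (waveguide lm lp ε d h b)) (room h b) ≠ ⊤ :=
    ((Measure.restrict_apply_le _ _).trans_lt (volume_room_lt_top h b)).ne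
  refine (Lp.coeFn_smul c (indicatorConstLp 2 hm hf ((b⁻¹ : ℝ) : ℂ))).trans ?_
  filter_upwards [indicatorConstLp_coeFn (p := 2) (hs := hm) (hμs := hf)
    (c := ((b⁻¹ : ℝ) : ℂ))] with x hx
  rw [Pi.smul_apply, hx]
  by_cases hxr : x ∈ room h b <;> simp [hxr, mul_comm]

theorem inner_eq_setIntegral {Ω S : Set (ℝ × ℝ)} (hS : MeasurableSet S) (hSΩ : S ⊆ Ω)
    {p : L2 Ω} {F : ℝ × ℝ → ℂ} (hp : p =ᵐ[volume.restrict Ω] S.indicator F) (u : L2 Ω) :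
    IntegrableOn (fun x => u x * conj (F x)) S ∧ inner ℂ p u = ∫ x in S, u x * conj (F x) := by
  obtain ⟨h1, h2⟩ := L2_inner_eq u p
  have hae : (fun x => u x * conj (p x)) =ᵐ[volume.restrict Ω]
      S.indicator fun x => u x * conj (F x) := by
    filter_upwards [hp] with x hx
    rw [hx]
    by_cases hxS : x ∈ S <;> simp [hxS]
  rw [integrable_congr hae, integrable_indicator_iff hS, IntegrableOn,
    Measure.restrict_restrict_of_subset hSΩ] at h1
  rw [integral_congr_ae hae, integral_indicator hS, Measure.restrict_restrict_of_subset hSΩ] at h2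
  exact ⟨h1, h2⟩

theorem inner_liftStrip (f : L2 (interval lm lp)) (u : L2 (waveguide lm lp ε d h b)) :
    inner ℂ (liftStrip lm lp ε d h b f) u = inner ℂ f (averageStrip lm lp ε d h b u) := by
  obtain ⟨h1, h2⟩ := inner_eq_setIntegral (isOpen_strip lm lp ε).measurableSet
    (strip_subset lm lp ε d h b) (liftStrip_ae lm lp ε d h b f) u
  rw [h2, setIntegral_strip_eq lm lp ε h1, (L2_inner_eq _ f).2]
  refine integral_congr_ae ?_
  filter_upwards [averageStrip_ae lm lp ε d h b u] with x hx
  rw [hx, integral_mul_const, map_mul, Complex.conj_ofReal]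
  ring

theorem inner_liftRoom (c : ℂ) (u : L2 (waveguide lm lp ε d h b)) :
    inner ℂ (liftRoom lm lp ε d h b c) u = inner ℂ c (averageRoom lm lp ε d h b u) := by
  rw [(inner_eq_setIntegral (isOpen_room h b).measurableSet (room_subset lm lp ε d h b)
    (liftRoom_ae lm lp ε d h b c) u).2, RCLike.inner_apply, integral_mul_const, map_mul,
    Complex.conj_ofReal]
  change _ = ((b⁻¹ : ℝ) : ℂ) * (∫ x in room h b, u x) * conj c
  ring

theorem adjoint_J : (J lm lp ε d h b).adjoint = JTilde lm lp ε d h b := by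
  symm
  rw [ContinuousLinearMap.eq_adjoint_iff]
  intro u f
  have h1 : inner ℂ (J lm lp ε d h b f) u = inner ℂ f (JTilde lm lp ε d h b u) := by
    change inner ℂ (liftStrip lm lp ε d h b f.fst + liftRoom lm lp ε d h b f.snd) u = _
    rw [inner_add_left, inner_liftStrip, inner_liftRoom, WithLp.prod_inner_apply]
    rfl
  rw [← inner_conj_symm, ← h1, inner_conj_symm]

theorem norm_resolvent_differences_eq {A : L2 (waveguide lm lp ε d h b) →L[ℂ]
      L2 (waveguide lm lp ε d h b)}
    {B : LimitSpace (interval lm lp) →L[ℂ] LimitSpace (interval lm lp)}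
    (hA : IsSelfAdjoint A) (hB : IsSelfAdjoint B) :
    ‖A ∘L J lm lp ε d h b - J lm lp ε d h b ∘L B‖ =
      ‖JTilde lm lp ε d h b ∘L A - B ∘L JTilde lm lp ε d h b‖ := by
  rw [← LinearIsometryEquiv.norm_map ContinuousLinearMap.adjoint (A ∘L J lm lp ε d h b - _),
    map_sub, ContinuousLinearMap.adjoint_comp, ContinuousLinearMap.adjoint_comp, adjoint_J,
    ContinuousLinearMap.isSelfAdjoint_iff'.1 hA, ContinuousLinearMap.isSelfAdjoint_iff'.1 hB]

/-- Averaging over the cross-section commutes with `∂₁`; this makes `J̃u` admissible in the limit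
form. -/
theorem hasWeakDeriv_averageStrip (hε : 0 < ε) {u g : L2 (waveguide lm lp ε d h b)}
    (hg : HasWeakDeriv (waveguide lm lp ε d h b) (1, 0) u g) :
    HasWeakDeriv (interval lm lp) 1 (averageStrip lm lp ε d h b u)
      (averageStrip lm lp ε d h b g) := by
  rw [hasWeakDeriv_line_iff]
  intro φ hφ hc hs
  have e := hg.section_fst (by linarith : -ε < 0) (strip_subset lm lp ε d h b) φ hφ hc hs
  have key : ∀ (χ : ℝ → ℝ) (w : L2 (waveguide lm lp ε d h b)),
      ∫ x in interval lm lp, χ x • averageStrip lm lp ε d h b w x =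
        ((ε ^ (-(1 / 2) : ℝ) : ℝ) : ℂ) *
          ∫ x in interval lm lp, χ x • ∫ y in Ioo (-ε) 0, w (x, y) := by
    intro χ w
    rw [← integral_const_mul]
    refine integral_congr_ae ?_
    filter_upwards [averageStrip_ae lm lp ε d h b w] with x hx
    rw [hx, mul_smul_comm]
  rw [key, key, e, mul_neg]

end Adjoint

/-! ### Gluing strip and room through the passage -/

/-- Slices of a smooth compactly supported function of two variables. -/
theorem test_slice {φ : ℝ × ℝ → ℝ} (hφ : ContDiff ℝ ∞ φ) (hc : HasCompactSupport φ) (t : ℝ) :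
    (ContDiff ℝ ∞ (fun y => φ (t, y)) ∧ HasCompactSupport (fun y => φ (t, y)) ∧
      ∀ y, deriv (fun y => φ (t, y)) y = fderiv ℝ φ (t, y) (0, 1)) ∧
    (ContDiff ℝ ∞ (fun x => φ (x, t)) ∧ HasCompactSupport (fun x => φ (x, t)) ∧
      tsupport (fun x => φ (x, t)) ⊆ {x | (x, t) ∈ tsupport φ} ∧
      ∀ x, deriv (fun x => φ (x, t)) x = fderiv ℝ φ (x, t) (1, 0)) := by
  have hd := hφ.differentiable (by simp)
  have s1 : tsupport (fun y => φ (t, y)) ⊆ {y | (t, y) ∈ tsupport φ} :=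
    closure_minimal (fun y hy => subset_tsupport φ hy)
      ((isClosed_tsupport φ).preimage (Continuous.prodMk_right t))
  have s2 : tsupport (fun x => φ (x, t)) ⊆ {x | (x, t) ∈ tsupport φ} :=
    closure_minimal (fun y hy => subset_tsupport φ hy)
      ((isClosed_tsupport φ).preimage (Continuous.prodMk_left t))
  refine ⟨⟨hφ.comp (contDiff_prodMk_right t), ?_, fun y => ?_⟩,
    ⟨hφ.comp (contDiff_prodMk_left t), ?_, s2, fun x => ?_⟩⟩
  · exact (hc.isCompact.image continuous_snd).of_isClosed_subset (isClosed_tsupport _)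
      fun y hy => ⟨(t, y), s1 hy, rfl⟩
  · exact ((hd (t, y)).hasFDerivAt.comp_hasDerivAt y
      ((hasDerivAt_const y t).prodMk (hasDerivAt_id y))).deriv
  · exact (hc.isCompact.image continuous_fst).of_isClosed_subset (isClosed_tsupport _)
      fun y hy => ⟨(y, t), s2 hy, rfl⟩
  · exact ((hd (x, t)).hasFDerivAt.comp_hasDerivAt x
      ((hasDerivAt_id x).prodMk (hasDerivAt_const x t))).deriv

/-- The continuous piecewise linear function which equals `1` on `(-∞, 0]` and `0` on `[h, ∞)`. -/
noncomputable def ramp (h y : ℝ) : ℝ := max 0 (min 1 (1 - y / h))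

theorem ramp_of_nonpos {h y : ℝ} (hh : 0 < h) (hy : y ≤ 0) : ramp h y = 1 := by
  have : y / h ≤ 0 := div_nonpos_of_nonpos_of_nonneg hy hh.le
  rw [ramp, min_eq_left (by linarith), max_eq_right zero_le_one]

theorem ramp_of_mem {h y : ℝ} (hh : 0 < h) (h0 : 0 ≤ y) (hy : y ≤ h) : ramp h y = 1 - y / h := by
  have h1 : 0 ≤ y / h := div_nonneg h0 hh.le
  have h2 : y / h ≤ 1 := (div_le_one hh).2 hy
  rw [ramp, min_eq_right (by linarith), max_eq_right (by linarith)]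

theorem ramp_of_ge {h y : ℝ} (hh : 0 < h) (hy : h ≤ y) : ramp h y = 0 := by
  have h1 : 1 ≤ y / h := (one_le_div hh).2 hy
  rw [ramp, min_eq_right (by linarith), max_eq_left (by linarith)]

/-- The half-line `(-∞, 0]` contributes `ψ 0`, which cancels the boundary term at `0` of the
integration by parts on `[0, h]`; at `h` the ramp vanishes. -/
theorem integral_deriv_mul_ramp {h : ℝ} (hh : 0 < h) {ψ : ℝ → ℝ} (hψ : ContDiff ℝ ∞ ψ)
    (hc : HasCompactSupport ψ) :
    Integrable (fun y => deriv ψ y * ramp h y) ∧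
      ∫ y, deriv ψ y * ramp h y = h⁻¹ * ∫ y in Ioo 0 h, ψ y := by
  have hd : Continuous (deriv ψ) := hψ.continuous_deriv (by simp)
  have hr : Continuous (ramp h) := by
    unfold ramp
    fun_prop
  have hint : Integrable fun y => deriv ψ y * ramp h y :=
    (hd.mul hr).integrable_of_hasCompactSupport hc.deriv.mul_right
  refine ⟨hint, ?_⟩
  have e0 : ∫ y in Iic 0, deriv ψ y * ramp h y = ψ 0 := by
    rw [← hc.integral_Iic_deriv_eq (hψ.of_le (by simp)) 0]
    refine setIntegral_congr_fun measurableSet_Iic fun y hy => ?_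
    rw [ramp_of_nonpos hh hy, mul_one]
  have e1 : ∫ y in Ioi 0, deriv ψ y * ramp h y = ∫ y in (0 : ℝ)..h, (1 - y / h) * deriv ψ y := by
    rw [intervalIntegral.integral_of_le hh.le,
      setIntegral_eq_of_subset_of_forall_sdiff_eq_zero (s := Ioc 0 h) measurableSet_Ioi
        Ioc_subset_Ioi_self]
    · refine setIntegral_congr_fun measurableSet_Ioc fun y hy => ?_
      rw [ramp_of_mem hh hy.1.le hy.2, mul_comm]
    · rintro y ⟨hy0, hy⟩
      rw [ramp_of_ge hh (not_lt.1 fun hlt => hy ⟨hy0, hlt.le⟩), mul_zero]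
  have e2 : ∫ y in (0 : ℝ)..h, (1 - y / h) * deriv ψ y =
      (1 - h / h) * ψ h - (1 - 0 / h) * ψ 0 - ∫ y in (0 : ℝ)..h, (-(1 / h)) * ψ y :=
    intervalIntegral.integral_mul_deriv_eq_deriv_mul
      (fun y _ => ((hasDerivAt_id y).div_const h).const_sub 1)
      (fun y _ => (hψ.differentiable (by simp) y).hasDerivAt)
      intervalIntegrable_const (hd.intervalIntegrable _ _)
  rw [← integral_add_compl measurableSet_Iic hint, compl_Iic, e0, e1, e2,
    intervalIntegral.integral_const_mul, intervalIntegral.integral_of_le hh.le,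
    integral_Ioc_eq_integral_Ioo, div_self hh.ne']
  ring

/-- Applied to the passage, this is the source of every factor `√(d h)` in the error. -/
theorem exists_bounded_lift {Ω S : Set (ℝ × ℝ)} (hS : MeasurableSet S) (hSΩ : S ⊆ Ω)
    (hfin : volume S < ⊤) {F : ℝ × ℝ → ℂ} (hF : AEStronglyMeasurable F (volume.restrict S))
    {M : ℝ} (hM0 : 0 ≤ M) (hM : ∀ᵐ x ∂(volume.restrict S), ‖F x‖ ≤ M) :
    ∃ q : L2 Ω, q =ᵐ[volume.restrict Ω] S.indicator F ∧ ‖q‖ ≤ M * √(volume.real S) := by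
  have : IsFiniteMeasure ((volume : Measure (ℝ × ℝ)).restrict S) :=
    ⟨by rwa [Measure.restrict_apply_univ]⟩
  have hm : MemLp (S.indicator F) 2 (volume.restrict Ω) := by
    rw [memLp_indicator_iff_restrict hS, Measure.restrict_restrict_of_subset hSΩ]
    exact MemLp.of_bound hF M hM
  refine ⟨hm.toLp, hm.coeFn_toLp, ?_⟩
  rw [Lp.norm_toLp, eLpNorm_indicator_eq_eLpNorm_restrict hS,
    Measure.restrict_restrict_of_subset hSΩ]
  have h1 := eLpNorm_le_of_ae_bound (p := 2) hM
  rw [Measure.restrict_apply_univ] at h1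
  have hne : volume S ^ ((2 : ℝ≥0∞).toReal)⁻¹ ≠ ⊤ :=
    ENNReal.rpow_ne_top_of_nonneg (by simp) hfin.ne
  refine (ENNReal.toReal_mono (ENNReal.mul_ne_top hne ENNReal.ofReal_ne_top) h1).trans
    (le_of_eq ?_)
  rw [ENNReal.toReal_mul, ENNReal.toReal_ofReal hM0, ← ENNReal.toReal_rpow, mul_comm,
    Real.sqrt_eq_rpow, Measure.real]
  norm_num

/-- Weak derivatives can be verified slice by slice, for representatives on the whole plane. -/
theorem setIntegral_test_eq_iterated {Ω : Set (ℝ × ℝ)} {χ : ℝ × ℝ → ℝ} (hχ : Continuous χ)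
    (hc : HasCompactSupport χ) (hs : tsupport χ ⊆ Ω) {U : ℝ × ℝ → ℂ} {q : L2 Ω}
    (hq : q =ᵐ[volume.restrict Ω] U) :
    (∫ x in Ω, χ x • q x = ∫ s, ∫ t, χ (s, t) • U (s, t)) ∧
      ∫ x in Ω, χ x • q x = ∫ t, ∫ s, χ (s, t) • U (s, t) := by
  have hi : Integrable (fun x => χ x • q x) (volume.restrict Ω) :=
    memLp_one_iff_integrable.1 ((Lp.memLp q).smul (memLp_test hχ hc Ω))
  have hae : (fun x => χ x • q x) =ᵐ[volume.restrict Ω] fun x => χ x • U x := by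
    filter_upwards [hq] with x hx
    rw [hx]
  have hsupp : Function.support (fun x => χ x • U x) ⊆ Ω := fun x hx => by_contra fun hn =>
    hx (by simp [image_eq_zero_of_notMem_tsupport fun h => hn (hs h)])
  have hi' : Integrable fun x => χ x • U x :=
    (integrableOn_iff_integrable_of_support_subset hsupp).1 (hi.congr hae)
  rw [integral_congr_ae hae, setIntegral_smul_of_tsupport_subset hs]
  rw [Measure.volume_eq_prod] at hi' ⊢
  exact ⟨integral_prod _ hi', integral_prod_symm _ hi'⟩

section Lift

variable {lm lp : EReal} {ε d h b : ℝ}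

/-- Replaces the three pieces by one formula on the whole plane, so that weak derivatives can be
checked on full lines without regard to how these meet the waveguide. -/
theorem liftSum_ae (g : L2 (interval lm lp)) (c : ℂ) {p : L2 (waveguide lm lp ε d h b)}
    {F U : ℝ × ℝ → ℂ} (hp : p =ᵐ[volume.restrict (waveguide lm lp ε d h b)] (passage d h).indicator F)
    (hstrip : ∀ x ∈ strip lm lp ε, U x = ((ε ^ (-(1 / 2) : ℝ) : ℝ) : ℂ) * g x.1)
    (hpass : ∀ x ∈ passage d h, U x = F x)
    (hroom : ∀ x ∈ room h b, U x = ((b⁻¹ : ℝ) : ℂ) * c) (hh : 0 < h) :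
    (liftStrip lm lp ε d h b g + p + liftRoom lm lp ε d h b c : L2 (waveguide lm lp ε d h b))
      =ᵐ[volume.restrict (waveguide lm lp ε d h b)] U := by
  filter_upwards [Lp.coeFn_add (liftStrip lm lp ε d h b g + p) (liftRoom lm lp ε d h b c),
    Lp.coeFn_add (liftStrip lm lp ε d h b g) p, hp, liftStrip_ae lm lp ε d h b g,
    liftRoom_ae lm lp ε d h b c, ae_mem_waveguide lm lp ε d h b] with x h1 h2 h3 h4 h5 h6
  rw [h1, Pi.add_apply, h2, Pi.add_apply, h3, h4, h5]
  rcases h6 with (hx | hx) | hx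
  · have n1 : x ∉ passage d h := fun hn => absurd hn.2.1 (not_lt.2 hx.2.2.le)
    have n2 : x ∉ room h b := fun hn => absurd (hh.trans hn.2.1) (not_lt.2 hx.2.2.le)
    simp [n1, n2, hx, hstrip x hx]
  · have n1 : x ∉ strip lm lp ε := fun hn => absurd hn.2.2 (not_lt.2 hx.2.1.le)
    have n2 : x ∉ room h b := fun hn => absurd hn.2.1 (not_lt.2 hx.2.2.le)
    simp [n1, n2, hx, hpass x hx]
  · have n1 : x ∉ strip lm lp ε := fun hn => absurd hn.2.2 (not_lt.2 (hh.trans hx.2.1).le)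
    have n2 : x ∉ passage d h := fun hn => absurd hn.2.2 (not_lt.2 hx.2.1.le)
    simp [n1, n2, hx, hroom x hx]

/-- The value of the glued function on the passage. -/
noncomputable def passageFun (ε h b : ℝ) (g : ℝ → ℂ) (c : ℂ) (x : ℝ × ℝ) : ℂ :=
  (((ε ^ (-(1 / 2) : ℝ) : ℝ) : ℂ) * g x.1 - ((b⁻¹ : ℝ) : ℂ) * c) * ((1 - x.2 / h : ℝ) : ℂ) +
    ((b⁻¹ : ℝ) : ℂ) * c

noncomputable def passageDerivFst (ε h : ℝ) (g' : ℝ → ℂ) (x : ℝ × ℝ) : ℂ :=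
  ((ε ^ (-(1 / 2) : ℝ) : ℝ) : ℂ) * g' x.1 * ((1 - x.2 / h : ℝ) : ℂ)

noncomputable def passageDerivSnd (ε h b : ℝ) (g : ℝ → ℂ) (c : ℂ) (x : ℝ × ℝ) : ℂ :=
  ((-h⁻¹ : ℝ) : ℂ) * (((ε ^ (-(1 / 2) : ℝ) : ℝ) : ℂ) * g x.1 - ((b⁻¹ : ℝ) : ℂ) * c)

/-- On each vertical line the representative is an affine function of the ramp, so
`integral_deriv_mul_ramp` gives the derivative. Continuity across the two mouths is built into the
ramp. -/
theorem hasWeakDeriv_glued_snd (hh : 0 < h)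
    (hdI : Icc (-(d / 2)) (d / 2) ⊆ interval lm lp) (g : L2 (interval lm lp)) (c : ℂ)
    {p₀ p₂ : L2 (waveguide lm lp ε d h b)}
    (hp₀ : p₀ =ᵐ[volume.restrict (waveguide lm lp ε d h b)]
      (passage d h).indicator (passageFun ε h b g c))
    (hp₂ : p₂ =ᵐ[volume.restrict (waveguide lm lp ε d h b)]
      (passage d h).indicator (passageDerivSnd ε h b g c)) :
    HasWeakDeriv (waveguide lm lp ε d h b) (0, 1)
      (liftStrip lm lp ε d h b g + p₀ + liftRoom lm lp ε d h b c) p₂ := by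
  intro φ hφ hc hs
  have hcont : Continuous fun x => fderiv ℝ φ x (0, 1) :=
    (hφ.continuous_fderiv (by simp)).clm_apply continuous_const
  have hfs : tsupport (fun x => fderiv ℝ φ x (0, 1)) ⊆ tsupport φ :=
    tsupport_fderiv_apply_subset ℝ (0, 1)
  have hU := liftSum_ae (U := fun x => (((ε ^ (-(1 / 2) : ℝ) : ℝ) : ℂ) *
    (interval lm lp).indicator g x.1 - ((b⁻¹ : ℝ) : ℂ) * c) * (ramp h x.2 : ℂ) +
      ((b⁻¹ : ℝ) : ℂ) * c) g c hp₀
    (fun x hx => by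
      rw [ramp_of_nonpos hh hx.2.2.le, indicator_of_mem hx.1]
      simp)
    (fun x hx => by
      have hxI : x.1 ∈ interval lm lp :=
        hdI ⟨(abs_lt.1 hx.1).1.le, (abs_lt.1 hx.1).2.le⟩
      rw [ramp_of_mem hh hx.2.1.le hx.2.2.le, indicator_of_mem hxI, passageFun])
    (fun x hx => by
      rw [ramp_of_ge hh hx.2.1.le]
      simp) hh
  have hW : p₂ =ᵐ[volume.restrict (waveguide lm lp ε d h b)] fun x =>
      (Ioo 0 h).indicator (fun _ => ((-h⁻¹ : ℝ) : ℂ)) x.2 *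
        (((ε ^ (-(1 / 2) : ℝ) : ℝ) : ℂ) * (interval lm lp).indicator g x.1 -
          ((b⁻¹ : ℝ) : ℂ) * c) := by
    filter_upwards [hp₂, ae_mem_waveguide lm lp ε d h b] with x h2 h6
    rw [h2]
    rcases h6 with (hx | hx) | hx
    · have n1 : x ∉ passage d h := fun hn => absurd hn.2.1 (not_lt.2 hx.2.2.le)
      have n2 : x.2 ∉ Ioo 0 h := fun hn => absurd hn.1 (not_lt.2 hx.2.2.le)
      simp [n1, n2]
    · have hxI : x.1 ∈ interval lm lp :=
        hdI ⟨(abs_lt.1 hx.1).1.le, (abs_lt.1 hx.1).2.le⟩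
      rw [indicator_of_mem hx, indicator_of_mem (show x.2 ∈ Ioo 0 h from hx.2),
        indicator_of_mem hxI, passageDerivSnd]
    · have n1 : x ∉ passage d h := fun hn => absurd hn.2.2 (not_lt.2 hx.2.1.le)
      have n2 : x.2 ∉ Ioo 0 h := fun hn => absurd hn.2 (not_lt.2 hx.2.1.le)
      simp [n1, n2]
  rw [(setIntegral_test_eq_iterated hcont (hc.fderiv_apply ℝ (0, 1)) (hfs.trans hs) hU).1,
    (setIntegral_test_eq_iterated hφ.continuous hc hs hW).1, ← integral_neg]
  refine integral_congr_ae (ae_of_all _ fun s => ?_)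
  obtain ⟨⟨hψ, hψc, hψd⟩, -⟩ := test_slice hφ hc s
  obtain ⟨i1, i2⟩ := integral_deriv_mul_ramp hh hψ hψc
  have i3 : Integrable fun y => fderiv ℝ φ (s, y) (0, 1) := by
    simp only [← hψd]
    exact (hψ.continuous_deriv (by simp)).integrable_of_hasCompactSupport hψc.deriv
  have i4 : ∫ y, fderiv ℝ φ (s, y) (0, 1) = 0 := by
    simp only [← hψd]
    exact integral_eq_zero_of_hasDerivAt_of_integrable
      (fun y => (hψ.differentiable (by simp) y).hasDerivAt)
      ((hψ.continuous_deriv (by simp)).integrable_of_hasCompactSupport hψc.deriv)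
      (hψ.continuous.integrable_of_hasCompactSupport hψc)
  simp only [hψd] at i1 i2
  dsimp only
  set A : ℂ := ((ε ^ (-(1 / 2) : ℝ) : ℝ) : ℂ) * (interval lm lp).indicator g s -
    ((b⁻¹ : ℝ) : ℂ) * c with hA
  have e1 : ∀ t, fderiv ℝ φ (s, t) (0, 1) • (A * (ramp h t : ℂ) + ((b⁻¹ : ℝ) : ℂ) * c) =
      (fderiv ℝ φ (s, t) (0, 1) * ramp h t) • A +
        fderiv ℝ φ (s, t) (0, 1) • (((b⁻¹ : ℝ) : ℂ) * c) := fun t => by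
    simp only [Complex.real_smul, Complex.ofReal_mul]
    ring
  have e2 : ∀ t, φ (s, t) • ((Ioo 0 h).indicator (fun _ => ((-h⁻¹ : ℝ) : ℂ)) t * A) =
      (Ioo 0 h).indicator (fun t => φ (s, t)) t • (-(h⁻¹ • A)) := fun t => by
    by_cases ht : t ∈ Ioo 0 h <;> simp [ht]
  simp only [e1, e2]
  rw [integral_add (i1.smul_const _) (i3.smul_const _), integral_smul_const, integral_smul_const,
    integral_smul_const, i2, i4, integral_indicator measurableSet_Ioo, zero_smul, add_zero,
    smul_neg, neg_neg, mul_comm, mul_smul]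

/-- At a height `t < h` the slice is a multiple of `g` plus a constant, and the slice of the test
function is supported in `Ω₀`. For `t ≥ h` the ramp vanishes and only a constant is left, so a room
wider than `Ω₀` does no harm. -/
theorem hasWeakDeriv_glued_fst (hd : 0 < d) (hh : 0 < h) (hb : 0 < b)
    (hdI : Icc (-(d / 2)) (d / 2) ⊆ interval lm lp) {g g' : L2 (interval lm lp)}
    (hg : HasWeakDeriv (interval lm lp) 1 g g') (c : ℂ)
    {p₀ p₁ : L2 (waveguide lm lp ε d h b)}
    (hp₀ : p₀ =ᵐ[volume.restrict (waveguide lm lp ε d h b)]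
      (passage d h).indicator (passageFun ε h b g c))
    (hp₁ : p₁ =ᵐ[volume.restrict (waveguide lm lp ε d h b)]
      (passage d h).indicator (passageDerivFst ε h g')) :
    HasWeakDeriv (waveguide lm lp ε d h b) (1, 0)
      (liftStrip lm lp ε d h b g + p₀ + liftRoom lm lp ε d h b c)
      (liftStrip lm lp ε d h b g' + p₁) := by
  intro φ hφ hc hs
  have hcont : Continuous fun x => fderiv ℝ φ x (1, 0) :=
    (hφ.continuous_fderiv (by simp)).clm_apply continuous_const
  have hfs : tsupport (fun x => fderiv ℝ φ x (1, 0)) ⊆ tsupport φ :=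
    tsupport_fderiv_apply_subset ℝ (1, 0)
  have hpI : ∀ x ∈ passage d h, x.1 ∈ interval lm lp := fun x hx =>
    hdI ⟨(abs_lt.1 hx.1).1.le, (abs_lt.1 hx.1).2.le⟩
  have hU := liftSum_ae (U := fun x => ((ε ^ (-(1 / 2) : ℝ) : ℝ) : ℂ) * (ramp h x.2 : ℂ) *
    (interval lm lp).indicator g x.1 + ((b⁻¹ : ℝ) : ℂ) * c * (1 - (ramp h x.2 : ℂ))) g c hp₀
    (fun x hx => by
      rw [ramp_of_nonpos hh hx.2.2.le, indicator_of_mem hx.1]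
      simp)
    (fun x hx => by
      rw [ramp_of_mem hh hx.2.1.le hx.2.2.le, indicator_of_mem (hpI x hx), passageFun]
      ring)
    (fun x hx => by
      rw [ramp_of_ge hh hx.2.1.le]
      simp) hh
  have hW := liftSum_ae (U := fun x => ((ε ^ (-(1 / 2) : ℝ) : ℝ) : ℂ) * (ramp h x.2 : ℂ) *
    (interval lm lp).indicator g' x.1) g' 0 hp₁
    (fun x hx => by
      rw [ramp_of_nonpos hh hx.2.2.le, indicator_of_mem hx.1]
      simp)
    (fun x hx => by
      rw [ramp_of_mem hh hx.2.1.le hx.2.2.le, indicator_of_mem (hpI x hx), passageDerivFst]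
      ring)
    (fun x hx => by
      rw [ramp_of_ge hh hx.2.1.le]
      simp) hh
  rw [map_zero, add_zero] at hW
  rw [(setIntegral_test_eq_iterated hcont (hc.fderiv_apply ℝ (1, 0)) (hfs.trans hs) hU).2,
    (setIntegral_test_eq_iterated hφ.continuous hc hs hW).2, ← integral_neg]
  refine integral_congr_ae (ae_of_all _ fun t => ?_)
  obtain ⟨-, hψ, hψc, hψs, hψd⟩ := test_slice hφ hc t
  have i3 : Integrable (deriv fun x => φ (x, t)) :=
    (hψ.continuous_deriv (by simp)).integrable_of_hasCompactSupport hψc.deriv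
  have i4 : ∫ x, deriv (fun x => φ (x, t)) x = 0 :=
    integral_eq_zero_of_hasDerivAt_of_integrable
      (fun y => (hψ.differentiable (by simp) y).hasDerivAt) i3
      (hψ.continuous.integrable_of_hasCompactSupport hψc)
  simp only [← hψd]
  rcases le_or_gt h t with ht | ht
  · simp only [ramp_of_ge hh ht, Complex.ofReal_zero, mul_zero, zero_mul, zero_add, sub_zero,
      mul_one, smul_zero, integral_zero, neg_zero]
    rw [integral_smul_const, i4, zero_smul]
  have hψI : tsupport (fun x => φ (x, t)) ⊆ interval lm lp := fun x hx =>
    fst_mem_interval hd hb hdI (hs (hψs hx)) ht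
  have hw := hasWeakDeriv_line_iff.1 hg _ hψ hψc hψI
  have hmI : MeasurableSet (interval lm lp) := (isOpen_interval lm lp).measurableSet
  have key : ∀ (χ : ℝ → ℝ) (f : L2 (interval lm lp)),
      (fun x => χ x • (interval lm lp).indicator f x) =
        (interval lm lp).indicator fun x => χ x • f x := fun χ f => by
    ext x
    by_cases hx : x ∈ interval lm lp <;> simp [hx]
  have e1 : ∀ x, deriv (fun x => φ (x, t)) x • (((ε ^ (-(1 / 2) : ℝ) : ℝ) : ℂ) * (ramp h t : ℂ) *
      (interval lm lp).indicator g x + ((b⁻¹ : ℝ) : ℂ) * c * (1 - (ramp h t : ℂ))) =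
      (((ε ^ (-(1 / 2) : ℝ) : ℝ) : ℂ) * (ramp h t : ℂ)) •
        (deriv (fun x => φ (x, t)) x • (interval lm lp).indicator g x) +
      deriv (fun x => φ (x, t)) x • (((b⁻¹ : ℝ) : ℂ) * c * (1 - (ramp h t : ℂ))) := fun x => by
    simp only [Complex.real_smul, smul_eq_mul]
    ring
  have e2 : ∀ x, φ (x, t) • (((ε ^ (-(1 / 2) : ℝ) : ℝ) : ℂ) * (ramp h t : ℂ) *
      (interval lm lp).indicator g' x) = (((ε ^ (-(1 / 2) : ℝ) : ℝ) : ℂ) * (ramp h t : ℂ)) •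
        (φ (x, t) • (interval lm lp).indicator g' x) := fun x => by
    simp only [Complex.real_smul, smul_eq_mul]
    ring
  have i5 : Integrable fun x => deriv (fun x => φ (x, t)) x • (interval lm lp).indicator g x := by
    rw [key, integrable_indicator_iff hmI]
    exact memLp_one_iff_integrable.1 ((Lp.memLp g).smul
      (memLp_test (hψ.continuous_deriv (by simp)) hψc.deriv _))
  simp only [e1, e2]
  rw [integral_add (i5.fun_smul _) (i3.smul_const _), integral_smul, integral_smul_const, i4, zero_smul,
    add_zero, key, integral_indicator hmI, hw, integral_smul, key (fun x => φ (x, t)),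
    integral_indicator hmI, smul_neg]

end Lift

/-! ### Regularity of the solutions of the limit problem -/

theorem integral_test_smul_eq_inner {Ω : Set ℝ} {φ : ℝ → ℝ} (hφ : Continuous φ)
    (hc : HasCompactSupport φ) :
    ∃ q : L2 Ω, q =ᵐ[volume.restrict Ω] (fun x => (φ x : ℂ)) ∧
      (∀ u : L2 Ω, inner ℂ q u = ∫ x in Ω, φ x • u x) := by
  have hm : MemLp (fun x => (φ x : ℂ)) 2 (volume.restrict Ω) := (memLp_test hφ hc Ω).ofReal
  refine ⟨hm.toLp, hm.coeFn_toLp, fun u => ?_⟩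
  rw [(L2_inner_eq u _).2]
  refine integral_congr_ae ?_
  filter_upwards [hm.coeFn_toLp] with x hx
  rw [hx, Complex.conj_ofReal, mul_comm, Complex.real_smul]

/-- Away from the origin the solution of the limit problem has a second weak derivative. -/
theorem isWeakDeriv_of_limit_equation {Ω A : Set ℝ} (hΩ : IsOpen Ω) (hord : Ω.OrdConnected)
    (h0 : (0 : ℝ) ∈ Ω) (hAΩ : A ⊆ Ω) (h0A : (0 : ℝ) ∉ A) {V : ℝ → ℝ} {γ : ℝ}
    {f g : LimitSpace Ω} {g' w : L2 Ω}
    (hw : w =ᵐ[volume.restrict Ω] fun x => (V x : ℂ) * g.fst x)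
    (heq : ∀ (v : LimitSpace Ω) (k : L2 Ω), HasWeakDeriv Ω 1 v.fst k →
      inner ℂ v (f - g) = inner ℂ k g' + (∫ x in Ω, (V x : ℂ) * g.fst x * conj (v.fst x)) +
        γ * pointValue Ω g.fst 0 * conj (pointValue Ω v.fst 0)) :
    IsWeakDeriv A g' (g.fst + w - f.fst : L2 Ω) := by
  intro φ hφ hc hs
  -- A test function vanishing at the origin does not feel the δ-term; pairing it with `0` in the
  -- summand `ℂ` leaves the pure differential equation.
  have hφ0 : φ 0 = 0 := image_eq_zero_of_notMem_tsupport fun h => h0A (hs h)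
  have hd : Continuous (deriv φ) := hφ.continuous_deriv (by simp)
  obtain ⟨q, hq1, hq2⟩ := integral_test_smul_eq_inner (Ω := Ω) hφ.continuous hc
  obtain ⟨q', hq'1, hq'2⟩ := integral_test_smul_eq_inner (Ω := Ω) hd hc.deriv
  have hcd : Continuous fun x => ((deriv φ x : ℝ) : ℂ) := Complex.continuous_ofReal.comp hd
  have hint : ∀ x, ∫ t in (0 : ℝ)..x, ((deriv φ t : ℝ) : ℂ) = φ x := fun x => by
    rw [intervalIntegral.integral_ofReal, intervalIntegral.integral_deriv_eq_sub
      (fun y _ => hφ.differentiable (by simp) y) (hd.intervalIntegrable _ _), hφ0, sub_zero]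
  have hqw : HasWeakDeriv Ω 1 q q' := by
    rw [hasWeakDeriv_line_iff]
    have h1 := isWeakDeriv_integral (G := fun x => ((deriv φ x : ℝ) : ℂ)) hΩ hord
      (hcd.continuousOn.locallyIntegrableOn hΩ.measurableSet) h0
    simp only [hint] at h1
    intro χ hχ hχc hχs
    have e1 : ∫ x in Ω, deriv χ x • q x = ∫ x in Ω, deriv χ x • (φ x : ℂ) :=
      integral_congr_ae (by filter_upwards [hq1] with x hx; rw [hx])
    have e2 : ∫ x in Ω, χ x • q' x = ∫ x in Ω, χ x • ((deriv φ x : ℝ) : ℂ) :=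
      integral_congr_ae (by filter_upwards [hq'1] with x hx; rw [hx])
    rw [e1, e2, h1 χ hχ hχc hχs]
  have hpv : pointValue Ω q 0 = 0 := by
    rw [pointValue_eq hΩ (Complex.continuous_ofReal.comp hφ.continuous).continuousOn hq1 h0]
    simp [hφ0]
  have e := heq (WithLp.toLp 2 (q, 0)) q' hqw
  rw [WithLp.prod_inner_apply] at e
  change inner ℂ q (f - g).fst + inner ℂ (0 : ℂ) (f - g).snd = inner ℂ q' g' +
    (∫ x in Ω, (V x : ℂ) * g.fst x * conj (q x)) +
      γ * pointValue Ω g.fst 0 * conj (pointValue Ω q 0) at e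
  have e3 : ∫ x in Ω, (V x : ℂ) * g.fst x * conj (q x) = inner ℂ q w := by
    rw [(L2_inner_eq w q).2]
    refine integral_congr_ae ?_
    filter_upwards [hw] with x hx
    rw [hx]
  have e4 : inner ℂ q (f - g).fst = inner ℂ q f.fst - inner ℂ q g.fst := inner_sub_right _ _ _
  rw [hpv, inner_zero_left, e3, map_zero, mul_zero, add_zero, add_zero, e4] at e
  rw [setIntegral_smul_of_tsupport_subset ((tsupport_deriv_subset' φ).trans hs),
    ← setIntegral_smul_of_tsupport_subset
      ((tsupport_deriv_subset' φ).trans (hs.trans hAΩ)), ← hq'2,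
    setIntegral_smul_of_tsupport_subset hs,
    ← setIntegral_smul_of_tsupport_subset (hs.trans hAΩ), ← hq2, inner_sub_right, inner_add_right]
  linear_combination -e

theorem norm_ae_le_of_isWeakDeriv {Ω : Set ℝ} {a b : ℝ} (hab : a < b) (hI : Ioo a b ⊆ Ω)
    {u k : L2 Ω} (h : IsWeakDeriv (Ioo a b) u k) :
    ∀ᵐ x ∂(volume.restrict (Ioo a b)), ‖u x‖ ≤ (√(b - a))⁻¹ * ‖u‖ + √(b - a) * ‖k‖ := by
  have hm : ∀ f : L2 Ω, MemLp f 2 (volume.restrict (Ioo a b)) := fun f =>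
    (Lp.memLp f).mono_measure (Measure.restrict_mono hI le_rfl)
  obtain ⟨Fc, -, hae, hFc⟩ := h.exists_continuousOn isOpen_Ioo ordConnected_Ioo
    (hm u).locallyIntegrableOn_restrict (hm k).locallyIntegrableOn_restrict
  filter_upwards [hae, ae_restrict_mem measurableSet_Ioo] with x hx hxI
  rw [hx]
  refine (norm_le_of_primitive hab (hm u) (hm k) hae hFc hxI).trans (add_le_add ?_ ?_)
  · exact mul_le_mul_of_nonneg_left (eLpNorm_restrict_toReal_le hI u) (by positivity)
  · exact mul_le_mul_of_nonneg_left (eLpNorm_restrict_toReal_le hI k) (by positivity)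

/-- Uniform bounds near the origin for the solution of the limit problem and its derivative. -/
theorem limit_solution_bounds {Ω : Set ℝ} (hΩ : IsOpen Ω) (hord : Ω.OrdConnected) {V : ℝ → ℝ}
    {K ρ γ : ℝ} (hK : 1 ≤ K) (hρK : K⁻¹ ≤ ρ) (hρ1 : ρ ≤ 1) (hI : Ioo (-ρ) ρ ⊆ Ω)
    (hV : MemLp V ⊤ (volume.restrict Ω))
    (hVK : eLpNorm V ⊤ (volume.restrict Ω) ≤ ENNReal.ofReal K)
    {f g : LimitSpace Ω} {g' : L2 Ω} {N : ℝ} (hgw : HasWeakDeriv Ω 1 g.fst g')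
    (hf : ‖f.fst‖ ≤ N) (hg : ‖g.fst‖ ≤ N) (hg' : ‖g'‖ ≤ N)
    (heq : ∀ (v : LimitSpace Ω) (k : L2 Ω), HasWeakDeriv Ω 1 v.fst k →
      inner ℂ v (f - g) = inner ℂ k g' + (∫ x in Ω, (V x : ℂ) * g.fst x * conj (v.fst x)) +
        γ * pointValue Ω g.fst 0 * conj (pointValue Ω v.fst 0)) :
    ‖pointValue Ω g.fst 0‖ ≤ (2 * K + 2) * N ∧
      (∀ᵐ x ∂(volume.restrict (Ioo (-ρ) ρ)), ‖g.fst x‖ ≤ (2 * K + 2) * N) ∧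
      (∀ᵐ x ∂(volume.restrict (Ioo (-ρ) ρ)), ‖g' x‖ ≤ (2 * K + 2) * N) ∧
      ∀ᵐ x ∂(volume.restrict (Ioo (-ρ) ρ)),
        ‖g.fst x - pointValue Ω g.fst 0‖ ≤ (2 * K + 2) * N * |x| := by
  have hK0 : 0 < K := by linarith
  have hρ : 0 < ρ := (inv_pos.2 hK0).trans_le hρK
  have hN : 0 ≤ N := (norm_nonneg _).trans hf
  have h0 : (0 : ℝ) ∈ Ioo (-ρ) ρ := ⟨by linarith, hρ⟩
  have hVae : ∀ᵐ x ∂(volume.restrict Ω), |V x| ≤ K := by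
    rw [eLpNorm_exponent_top] at hVK
    filter_upwards [ae_le_eLpNormEssSup (f := V) (μ := volume.restrict Ω)] with x hx
    rw [← Real.norm_eq_abs, ← toReal_enorm]
    exact ENNReal.toReal_le_of_le_ofReal hK0.le (hx.trans hVK)
  obtain ⟨M, hM⟩ := exists_mulOperator hV
  have hw := hM g.fst
  have hwn : ‖M g.fst‖ ≤ K * N := by
    refine (Lp.norm_le_mul_norm_of_ae_le_mul (c := K) (g := g.fst) ?_).trans
      (mul_le_mul_of_nonneg_left hg hK0.le)
    filter_upwards [hw, hVae] with x hx hVx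
    rw [hx, norm_mul, Complex.norm_real, Real.norm_eq_abs]
    exact mul_le_mul_of_nonneg_right hVx (norm_nonneg _)
  have hkn : ‖g.fst + M g.fst - f.fst‖ ≤ (2 + K) * N := by
    refine (norm_sub_le _ _).trans ((add_le_add_left (norm_add_le _ _) _).trans ?_)
    linarith
  -- Used for the interval lengths `ρ` and `2ρ`. The first bound holds because `K⁻² ≤ K⁻¹ ≤ r`.
  have hsq : ∀ r, K⁻¹ ≤ r → r ≤ 2 → (√r)⁻¹ ≤ K ∧ √r ≤ 2 := by
    intro r h1 h2
    have hr : 0 < r := (inv_pos.2 hK0).trans_le h1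
    constructor
    · rw [inv_le_comm₀ (Real.sqrt_pos.2 hr) hK0]
      refine Real.le_sqrt_of_sq_le (le_trans ?_ h1)
      have : K⁻¹ ≤ 1 := inv_le_one_of_one_le₀ hK
      have := inv_pos.2 hK0
      nlinarith
    · rw [Real.sqrt_le_left (by norm_num)]
      linarith
  -- The derivative may jump at the origin, so it is bounded on each half-interval of length `ρ`
  -- separately. The constant is `K` from `g'` itself plus `2 + K` from its weak derivative `g + V g
  -- - f`.
  have hdb : ∀ a b : ℝ, a < b → b - a = ρ → Ioo a b ⊆ Ioo (-ρ) ρ → (0 : ℝ) ∉ Ioo a b →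
      ∀ᵐ x ∂(volume.restrict (Ioo a b)), ‖g' x‖ ≤ (2 * K + 2) * N := by
    intro a b hab hr hsub hn
    have hwd := isWeakDeriv_of_limit_equation hΩ hord (hI h0) (hsub.trans hI) hn hw heq
    have hs1 : √ρ ≤ 1 := Real.sqrt_le_one.2 hρ1
    filter_upwards [norm_ae_le_of_isWeakDeriv hab (hsub.trans hI) hwd] with x hx
    refine hx.trans ?_
    rw [hr]
    have e1 := mul_le_mul (hsq ρ hρK (by linarith)).1 hg' (norm_nonneg _) hK0.le
    have e2 := mul_le_mul hs1 hkn (norm_nonneg _) zero_le_one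
    linarith
  have hder : ∀ᵐ x ∂(volume.restrict (Ioo (-ρ) ρ)), ‖g' x‖ ≤ (2 * K + 2) * N := by
    have e1 := hdb (-ρ) 0 (by linarith) (by ring) (Ioo_subset_Ioo_right hρ.le) (by simp)
    have e2 := hdb 0 ρ hρ (by ring) (Ioo_subset_Ioo_left (by linarith)) (by simp)
    rw [ae_restrict_iff' measurableSet_Ioo] at e1 e2 ⊢
    have hne : ∀ᵐ x : ℝ, x ≠ 0 := by simp [ae_iff]
    filter_upwards [e1, e2, hne] with x h1 h2 h3 hx
    rcases lt_or_gt_of_ne h3 with h | h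
    · exact h1 ⟨hx.1, h⟩
    · exact h2 ⟨h, hx.2⟩
  obtain ⟨Gc, hGc1, hGc2, hGc3, hGc4⟩ := hgw.exists_continuousOn hΩ hord
  have hGae : g.fst =ᵐ[volume.restrict (Ioo (-ρ) ρ)] Gc :=
    ae_restrict_of_ae_restrict_of_subset hI hGc2
  have hm : ∀ f : L2 Ω, MemLp f 2 (volume.restrict (Ioo (-ρ) ρ)) := fun f =>
    (Lp.memLp f).mono_measure (Measure.restrict_mono hI le_rfl)
  have hsup : ∀ x ∈ Ioo (-ρ) ρ, ‖Gc x‖ ≤ (2 * K + 2) * N := by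
    intro x hx
    have e := norm_le_of_primitive (by linarith) (hm g.fst) (hm g') hGae
      (fun x hx y hy => hGc3 x (hI hx) y (hI hy)) hx
    obtain ⟨q1, q2⟩ := hsq (ρ - -ρ) (by linarith) (by linarith)
    have e1 := mul_le_mul q1 ((eLpNorm_restrict_toReal_le hI g.fst).trans hg)
      ENNReal.toReal_nonneg hK0.le
    have e2 := mul_le_mul q2 ((eLpNorm_restrict_toReal_le hI g').trans hg')
      ENNReal.toReal_nonneg (by norm_num)
    nlinarith
  rw [hGc4 0 (hI h0)]
  refine ⟨hsup 0 h0, ?_, hder, ?_⟩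
  · filter_upwards [hGae, ae_restrict_mem measurableSet_Ioo] with x hx hxI
    rw [hx]
    exact hsup x hxI
  · filter_upwards [hGae, ae_restrict_mem measurableSet_Ioo] with x hx hxI
    rw [hx, hGc3 0 (hI h0) x (hI hxI)]
    rw [ae_restrict_iff' measurableSet_Ioo] at hder
    refine (intervalIntegral.norm_integral_le_of_norm_le_const_ae ?_).trans
      (le_of_eq (by rw [sub_zero]))
    filter_upwards [hder] with t ht htx
    exact ht (ordConnected_Ioo.uIcc_subset h0 hxI (uIoc_subset_uIcc htx))

/-! ### The difference of the resolvents -/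

theorem ae_passage {d h : ℝ} {I : Set ℝ} (hI : Ioo (-(d / 2)) (d / 2) ⊆ I) {p : ℝ → Prop}
    (hp : ∀ᵐ x ∂((volume : Measure ℝ).restrict I), p x) :
    ∀ᵐ x ∂((volume : Measure (ℝ × ℝ)).restrict (passage d h)), x ∈ passage d h ∧ p x.1 := by
  have h1 := ae_restrict_mem (μ := (volume : Measure (ℝ × ℝ))) (isOpen_passage d h).measurableSet
  have h2 : ∀ᵐ x ∂((volume : Measure (ℝ × ℝ)).restrict (passage d h)), p x.1 := by
    rw [passage_eq_prod, Measure.volume_eq_prod, ← Measure.prod_restrict]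
    exact Measure.quasiMeasurePreserving_fst.ae (ae_restrict_of_ae_restrict_of_subset hI hp)
  exact h1.and h2

theorem aestronglyMeasurable_passage {d h : ℝ} {I : Set ℝ} (hI : Ioo (-(d / 2)) (d / 2) ⊆ I)
    (g : L2 I) : AEStronglyMeasurable (fun x : ℝ × ℝ => g x.1) (volume.restrict (passage d h)) := by
  rw [passage_eq_prod, Measure.volume_eq_prod, ← Measure.prod_restrict]
  exact ((Lp.aestronglyMeasurable g).mono_measure (Measure.restrict_mono hI le_rfl)).comp_fst

theorem volume_passage {d h : ℝ} (hd : 0 ≤ d) (hh : 0 ≤ h) :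
    volume (passage d h) < ⊤ ∧ volume.real (passage d h) = d * h := by
  have e : volume (passage d h) = ENNReal.ofReal (d * h) := by
    rw [passage_eq_prod, Measure.volume_eq_prod, Measure.prod_prod, Real.volume_Ioo,
      Real.volume_Ioo, ← ENNReal.ofReal_mul (by linarith)]
    congr 1
    ring
  exact ⟨by rw [e]; exact ENNReal.ofReal_lt_top,
    by rw [Measure.real, e, ENNReal.toReal_ofReal (mul_nonneg hd hh)]⟩

section Difference

variable {lm lp : EReal} {ε d h b : ℝ}

/-- The remainder in the derivative of the glued function along the passage. -/
noncomputable def passageRemainder (ε h b : ℝ) (g : ℝ → ℂ) (a c : ℂ) (x : ℝ × ℝ) : ℂ :=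
  ((-h⁻¹ : ℝ) : ℂ) * (((ε ^ (-(1 / 2) : ℝ) : ℝ) : ℂ) * (g x.1 - a) - ((b⁻¹ : ℝ) : ℂ) * c)

/-- The components of the glued function supported on the passage, with their norms. -/
theorem exists_passage_components (hε : 0 < ε) (hd : 0 < d) (hh : 0 < h) (hb : 0 < b)
    (hdI : Ioo (-(d / 2)) (d / 2) ⊆ interval lm lp) (g g' : L2 (interval lm lp)) (a c : ℂ) {M : ℝ}
    (hM : 0 ≤ M) (hc : ‖c‖ ≤ M)
    (hg : ∀ᵐ x ∂(volume.restrict (Ioo (-(d / 2)) (d / 2))), ‖g x‖ ≤ M)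
    (hg' : ∀ᵐ x ∂(volume.restrict (Ioo (-(d / 2)) (d / 2))), ‖g' x‖ ≤ M)
    (hga : ∀ᵐ x ∂(volume.restrict (Ioo (-(d / 2)) (d / 2))), ‖g x - a‖ ≤ M * |x|) :
    ∃ p₀ p₁ r q : L2 (waveguide lm lp ε d h b),
      (p₀ =ᵐ[volume.restrict (waveguide lm lp ε d h b)]
        (passage d h).indicator (passageFun ε h b g c) ∧
        ‖p₀‖ ≤ (ε ^ (-(1 / 2) : ℝ) + 2 * b⁻¹) * M * √(d * h)) ∧
      (p₁ =ᵐ[volume.restrict (waveguide lm lp ε d h b)]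
        (passage d h).indicator (passageDerivFst ε h g') ∧
        ‖p₁‖ ≤ ε ^ (-(1 / 2) : ℝ) * M * √(d * h)) ∧
      (r =ᵐ[volume.restrict (waveguide lm lp ε d h b)]
        (passage d h).indicator (passageRemainder ε h b g a c) ∧
        ‖r‖ ≤ h⁻¹ * (ε ^ (-(1 / 2) : ℝ) * d + b⁻¹) * M * √(d * h)) ∧
      q =ᵐ[volume.restrict (waveguide lm lp ε d h b)] (passage d h).indicator fun _ => 1 := by
  obtain ⟨hfin, hvol⟩ := volume_passage hd.le hh.le
  have hS := (isOpen_passage d h).measurableSet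
  have hSΩ := passage_subset lm lp ε d h b
  have hmg := aestronglyMeasurable_passage (h := h) hdI g
  have hmg' := aestronglyMeasurable_passage (h := h) hdI g'
  have hmr : AEStronglyMeasurable (fun x : ℝ × ℝ => ((1 - x.2 / h : ℝ) : ℂ))
      (volume.restrict (passage d h)) := by
    refine Continuous.aestronglyMeasurable ?_
    fun_prop
  have he : 0 ≤ ε ^ (-(1 / 2) : ℝ) := (Real.rpow_pos_of_pos hε _).le
  have hen : ‖((ε ^ (-(1 / 2) : ℝ) : ℝ) : ℂ)‖ = ε ^ (-(1 / 2) : ℝ) := by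
    rw [Complex.norm_real, Real.norm_of_nonneg he]
  have hbn : ‖((b⁻¹ : ℝ) : ℂ) * c‖ ≤ b⁻¹ * M := by
    rw [norm_mul, Complex.norm_real, Real.norm_of_nonneg (inv_pos.2 hb).le]
    exact mul_le_mul_of_nonneg_left hc (inv_pos.2 hb).le
  have hb0 : 0 < b⁻¹ := inv_pos.2 hb
  have hr1 : ∀ x ∈ passage d h, ‖((1 - x.2 / h : ℝ) : ℂ)‖ ≤ 1 := by
    intro x hx
    have h1 : 0 ≤ x.2 / h := div_nonneg hx.2.1.le hh.le
    have h2 : x.2 / h ≤ 1 := (div_le_one hh).2 hx.2.2.le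
    rw [Complex.norm_real, Real.norm_eq_abs, abs_le]
    constructor <;> linarith
  have hegn : ∀ z : ℂ, ‖z‖ ≤ M → ‖((ε ^ (-(1 / 2) : ℝ) : ℝ) : ℂ) * z‖ ≤ ε ^ (-(1 / 2) : ℝ) * M :=
    fun z hz => by
      rw [norm_mul, hen]
      exact mul_le_mul_of_nonneg_left hz he
  obtain ⟨p₀, hp₀⟩ := exists_bounded_lift hS hSΩ hfin (F := passageFun ε h b g c)
    (M := (ε ^ (-(1 / 2) : ℝ) + 2 * b⁻¹) * M)
    ((((hmg.const_mul _).sub aestronglyMeasurable_const).mul hmr).add aestronglyMeasurable_const)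
    (by positivity) (by
      filter_upwards [ae_passage subset_rfl hg] with x hx
      have e1 := norm_sub_le (((ε ^ (-(1 / 2) : ℝ) : ℝ) : ℂ) * g x.1) (((b⁻¹ : ℝ) : ℂ) * c)
      have e2 := hegn _ hx.2
      have e3 := mul_le_mul e1 (hr1 x hx.1) (norm_nonneg _)
        (add_nonneg (norm_nonneg _) (norm_nonneg _))
      refine (norm_add_le _ _).trans ?_
      rw [norm_mul]
      linarith)
  obtain ⟨p₁, hp₁⟩ := exists_bounded_lift hS hSΩ hfin (F := passageDerivFst ε h g')
    (M := ε ^ (-(1 / 2) : ℝ) * M) ((hmg'.const_mul _).mul hmr) (by positivity) (by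
      filter_upwards [ae_passage subset_rfl hg'] with x hx
      rw [passageDerivFst, norm_mul]
      exact (mul_le_of_le_one_right (norm_nonneg _) (hr1 x hx.1)).trans (hegn _ hx.2))
  obtain ⟨r, hr⟩ := exists_bounded_lift hS hSΩ hfin (F := passageRemainder ε h b g a c)
    (M := h⁻¹ * (ε ^ (-(1 / 2) : ℝ) * d + b⁻¹) * M)
    (((hmg.sub aestronglyMeasurable_const).const_mul _).sub aestronglyMeasurable_const |>.const_mul _)
    (by positivity) (by
      filter_upwards [ae_passage subset_rfl hga] with x hx
      have hxd : |x.1| ≤ d := by linarith [hx.1.1]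
      have e1 : ‖((ε ^ (-(1 / 2) : ℝ) : ℝ) : ℂ) * (g x.1 - a)‖ ≤ ε ^ (-(1 / 2) : ℝ) * (M * d) := by
        rw [norm_mul, hen]
        exact mul_le_mul_of_nonneg_left (hx.2.trans (mul_le_mul_of_nonneg_left hxd hM)) he
      rw [passageRemainder, norm_mul, Complex.norm_real, norm_neg,
        Real.norm_of_nonneg (inv_pos.2 hh).le, mul_assoc]
      refine mul_le_mul_of_nonneg_left ((norm_sub_le _ _).trans ?_) (inv_pos.2 hh).le
      linarith)
  obtain ⟨q, hq⟩ := exists_bounded_lift hS hSΩ hfin (F := fun _ => (1 : ℂ)) (M := 1)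
    aestronglyMeasurable_const zero_le_one (by simp)
  rw [hvol] at hp₀ hp₁ hr
  exact ⟨p₀, p₁, r, q, hp₀, hp₁, hr, hq.1⟩

/-- The four summands bound, in this order, the flux mismatch at the origin, the horizontal gradient
on the passage, the non-constant part of the vertical gradient there, and the mass of the
interpolation. The factor `2 * K + 2` comes from the sup bounds for the limit solution, and `n`
counts the doublings of squares. -/
theorem norm_resolvent_difference_le {γ K ρ : ℝ} {V₀ : ℝ → ℝ} {n : ℕ} (hε : 0 < ε) (hd : 0 < d)
    (hh : 0 < h) (hdh : d ≤ h) (hdε : d ≤ ε) (hdb : d ≤ b) (hdγ : d = γ * ε * h) (hγ : 0 < γ)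
    (hbn : b ≤ 2 ^ n * d) (hεn : ε ≤ 2 ^ n * d) (hK : 1 ≤ K) (hρK : K⁻¹ ≤ ρ) (hρ1 : ρ ≤ 1)
    (hρε : ε ≤ ρ) (hI : Ioo (-ρ) ρ ⊆ interval lm lp)
    (hV : MemLp V₀ ⊤ (volume.restrict (interval lm lp)))
    (hV0 : ∀ᵐ x ∂(volume.restrict (interval lm lp)), 0 ≤ V₀ x)
    (hVK : eLpNorm V₀ ⊤ (volume.restrict (interval lm lp)) ≤ ENNReal.ofReal K) :
    ‖formResolvent (neumannGraph (waveguide lm lp ε d h b) (potential lm lp ε V₀)) ∘L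
        J lm lp ε d h b - J lm lp ε d h b ∘L formResolvent (limitGraph (interval lm lp) V₀ γ)‖ ≤
      (2 * K + 2) * (ε ^ (-(1 / 2) : ℝ) * γ * ε * (5 + 10 * n + b⁻¹) +
        ε ^ (-(1 / 2) : ℝ) * √(d * h) + h⁻¹ * (ε ^ (-(1 / 2) : ℝ) * d + b⁻¹) * √(d * h) +
        2 * (ε ^ (-(1 / 2) : ℝ) + 2 * b⁻¹) * √(d * h)) := by
  have hb : 0 < b := hd.trans_le hdb
  have hρ : 0 < ρ := hε.trans_le hρε
  have hΩ := isOpen_waveguide lm lp ε d h b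
  have hΩ₀ := isOpen_interval lm lp
  have hord := ordConnected_interval lm lp
  have h0 : (0 : ℝ) ∈ interval lm lp := hI ⟨by linarith, hρ⟩
  have hDρ : Ioo (-(d / 2)) (d / 2) ⊆ Ioo (-ρ) ρ := Ioo_subset_Ioo (by linarith) (by linarith)
  have hdI : Icc (-(d / 2)) (d / 2) ⊆ interval lm lp := fun x hx =>
    hI ⟨by linarith [hx.1], by linarith [hx.2]⟩
  obtain ⟨-, hAsa, hA⟩ := neumannResolvent_spec hΩ (memLp_potential (ε := ε) d h b hV)
    (ae_potential_nonneg d h b hV0)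
  obtain ⟨-, -, hB⟩ := limitResolvent_spec hΩ₀ hord h0 hV hV0 hγ.le
  set A := formResolvent (neumannGraph (waveguide lm lp ε d h b) (potential lm lp ε V₀))
  set B := formResolvent (limitGraph (interval lm lp) V₀ γ)
  set e : ℝ := ε ^ (-(1 / 2) : ℝ) with hedef
  have he : 0 < e := Real.rpow_pos_of_pos hε _
  set C := (2 * K + 2) * (e * γ * ε * (5 + 10 * n + b⁻¹) + e * √(d * h) +
    h⁻¹ * (e * d + b⁻¹) * √(d * h) + 2 * (e + 2 * b⁻¹) * √(d * h)) with hC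
  have hC0 : 0 ≤ C := by positivity
  -- Taking for `w` the image of `f` turns the bound for the pairing into one for the operator norm.
  suffices hpair : ∀ f w, ‖inner ℂ w ((A ∘L J lm lp ε d h b - J lm lp ε d h b ∘L B) f)‖ ≤
      C * ‖f‖ * ‖w‖ by
    refine ContinuousLinearMap.opNorm_le_bound _ hC0 fun f => ?_
    have h1 := hpair f ((A ∘L J lm lp ε d h b - J lm lp ε d h b ∘L B) f)
    rw [inner_self_eq_norm_sq_to_K, norm_pow, RCLike.norm_ofReal, abs_norm, sq] at h1
    rcases (norm_nonneg ((A ∘L J lm lp ε d h b - J lm lp ε d h b ∘L B) f)).eq_or_lt with h2 | h2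
    · rw [← h2]
      positivity
    · exact le_of_mul_le_mul_right h1 h2
  intro f w
  obtain ⟨k₁, k₂, hk₁, hk₂, hun, hk₁n, hk₂n, hueq⟩ := hA w
  obtain ⟨g', hg', hgn, hg'n, hgeq⟩ := hB f
  set u := A w with hu
  set g := B f with hg
  obtain ⟨hb1, hb2, hb3, hb4⟩ := limit_solution_bounds hΩ₀ hord hK hρK hρ1 hI hV hVK hg'
    (WithLp.norm_fst_le _ f) ((WithLp.norm_fst_le _ g).trans hgn) hg'n hgeq
  set a := pointValue (interval lm lp) g.fst 0 with ha
  set M := (2 * K + 2) * ‖f‖ with hM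
  have hM0 : 0 ≤ M := by positivity
  have hg2 : ‖g.snd‖ ≤ M := by
    refine ((WithLp.norm_snd_le _ g).trans hgn).trans (le_mul_of_one_le_left (norm_nonneg _) ?_)
    linarith
  obtain ⟨p₀, p₁, r, q, ⟨hp₀, hp₀n⟩, ⟨hp₁, hp₁n⟩, ⟨hr, hrn⟩, hq⟩ :=
    exists_passage_components (lm := lm) (lp := lp) hε hd hh hb (Ioo_subset_Icc_self.trans hdI)
      g.fst g' a g.snd hM0 hg2 (ae_restrict_of_ae_restrict_of_subset hDρ hb2)
      (ae_restrict_of_ae_restrict_of_subset hDρ hb3) (ae_restrict_of_ae_restrict_of_subset hDρ hb4)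
  -- The vertical derivative of the test function is split into the constant obtained by replacing
  -- `g₁` by `g₁(0)`, which pairs with the flux of `u`, and the remainder `r`, which collects the
  -- oscillation of `g₁` and the room value.
  set p₂ := ((-h⁻¹ * e : ℝ) : ℂ) • a • q + r with hp₂def
  have hp₂ : p₂ =ᵐ[volume.restrict (waveguide lm lp ε d h b)]
      (passage d h).indicator (passageDerivSnd ε h b g.fst g.snd) := by
    filter_upwards [Lp.coeFn_add (((-h⁻¹ * e : ℝ) : ℂ) • a • q) r,
      Lp.coeFn_smul ((-h⁻¹ * e : ℝ) : ℂ) (a • q), Lp.coeFn_smul a q, hr, hq] with x e1 e2 e3 e4 e5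
    rw [e1, Pi.add_apply, e2, Pi.smul_apply, e3, Pi.smul_apply, e4, e5]
    by_cases hx : x ∈ passage d h
    · simp only [indicator_of_mem hx, passageRemainder, passageDerivSnd, smul_eq_mul, ← hedef]
      push_cast
      ring
    · simp [hx]
  set j := liftStrip lm lp ε d h b g.fst + p₀ + liftRoom lm lp ε d h b g.snd with hj
  have hj1 := hasWeakDeriv_glued_fst hd hh hb hdI hg' g.snd hp₀ hp₁
  have hj2 := hasWeakDeriv_glued_snd hh hdI g.fst g.snd hp₀ hp₂
  have hjJ : j = J lm lp ε d h b g + p₀ := by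
    change _ = liftStrip lm lp ε d h b g.fst + liftRoom lm lp ε d h b g.snd + p₀
    rw [hj]
    abel
  -- The two test choices: `j` in the equation for `u`, and `J̃u` in the equation for `g`.
  have E1 := hueq j _ _ hj1 hj2
  have E0 := hgeq (JTilde lm lp ε d h b u) (averageStrip lm lp ε d h b k₁)
    (hasWeakDeriv_averageStrip lm lp ε d h b hε hk₁)
  obtain ⟨W, hW⟩ := exists_mulOperator hV
  -- Both potential terms pair `V₀ g₁` with the cross-sectional average of `u`, so up to conjugation
  -- they coincide and will cancel.
  have hV1 : ∫ x in interval lm lp, (V₀ x : ℂ) * g.fst x *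
      conj ((JTilde lm lp ε d h b u).fst x) =
        inner ℂ (averageStrip lm lp ε d h b u) (W g.fst) := by
    rw [(L2_inner_eq _ _).2]
    refine integral_congr_ae ?_
    filter_upwards [hW g.fst] with x hx
    rw [hx]
    rfl
  have hV2 : ∫ x in waveguide lm lp ε d h b, (potential lm lp ε V₀ x : ℂ) * u x * conj (j x) =
      inner ℂ (W g.fst) (averageStrip lm lp ε d h b u) := by
    rw [← inner_liftStrip, (L2_inner_eq _ _).2]
    have hjs : ∀ᵐ x ∂(volume.restrict (waveguide lm lp ε d h b)), x ∈ strip lm lp ε →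
        j x = (e : ℂ) * g.fst x.1 := by
      filter_upwards [Lp.coeFn_add (liftStrip lm lp ε d h b g.fst + p₀)
        (liftRoom lm lp ε d h b g.snd), Lp.coeFn_add (liftStrip lm lp ε d h b g.fst) p₀, hp₀,
        liftStrip_ae lm lp ε d h b g.fst, liftRoom_ae lm lp ε d h b g.snd]
        with x h1 h2 h3 h4 h5 hx
      have n1 : x ∉ passage d h := fun hn => absurd hn.2.1 (not_lt.2 hx.2.2.le)
      have n2 : x ∉ room h b := fun hn => absurd (hh.trans hn.2.1) (not_lt.2 hx.2.2.le)
      rw [h1, Pi.add_apply, h2, Pi.add_apply, h3, h4, h5]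
      simp [n1, n2, hx, hedef]
    refine integral_congr_ae ?_
    filter_upwards [hjs, liftStrip_ae lm lp ε d h b (W g.fst),
      ae_restrict_of_ae (ae_strip_of_ae_interval (ε := ε) (hW g.fst))] with x h1 h2 h3
    rw [h2]
    by_cases hx : x ∈ strip lm lp ε
    · rw [h1 hx, indicator_of_mem hx, h3 hx]
      simp only [potential, hx, if_true, map_mul, Complex.conj_ofReal]
      ring
    · simp [potential, hx]
  rw [hV1] at E0
  rw [hV2] at E1
  have hq' : inner ℂ q k₂ = ∫ x in passage d h, k₂ x := by
    rw [(inner_eq_setIntegral (isOpen_passage d h).measurableSet (passage_subset lm lp ε d h b)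
      hq k₂).2]
    simp
  have hwA : inner ℂ w (A (J lm lp ε d h b f)) = inner ℂ (JTilde lm lp ε d h b u) f := by
    rw [← adjoint_J, ContinuousLinearMap.adjoint_inner_left, hu,
      ← ContinuousLinearMap.adjoint_inner_left, ContinuousLinearMap.isSelfAdjoint_iff'.1 hAsa]
  have huJ : inner ℂ u (J lm lp ε d h b g) = inner ℂ (JTilde lm lp ε d h b u) g := by
    rw [← adjoint_J, ContinuousLinearMap.adjoint_inner_left]
  have E1' : inner ℂ (w - u) j = inner ℂ k₁ (liftStrip lm lp ε d h b g' + p₁) + inner ℂ k₂ p₂ +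
      inner ℂ (averageStrip lm lp ε d h b u) (W g.fst) := by
    rw [← inner_conj_symm, E1, map_add, map_add, inner_conj_symm, inner_conj_symm, inner_conj_symm]
  have hk₁l : inner ℂ k₁ (liftStrip lm lp ε d h b g') =
      inner ℂ (averageStrip lm lp ε d h b k₁) g' := by
    rw [← inner_conj_symm, inner_liftStrip, inner_conj_symm]
  have hk₂p : inner ℂ k₂ p₂ = ((-h⁻¹ * e : ℝ) : ℂ) * a * conj (∫ x in passage d h, k₂ x) +
      inner ℂ k₂ r := by
    rw [hp₂def, inner_add_right, inner_smul_right, inner_smul_right, ← hq', inner_conj_symm,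
      mul_assoc]
  set m := pointValue (interval lm lp) (JTilde lm lp ε d h b u).fst 0 with hm
  -- An exact identity: all contributions of strip and room have cancelled, except for the point
  -- value `m`, which is paired with the flux through the passage.
  have key : inner ℂ w ((A ∘L J lm lp ε d h b - J lm lp ε d h b ∘L B) f) =
      a * conj ((γ : ℂ) * m + ((h⁻¹ * e : ℝ) : ℂ) * ∫ x in passage d h, k₂ x) -
        inner ℂ k₁ p₁ - inner ℂ k₂ r + inner ℂ (w - u) p₀ := by
    change inner ℂ w (A (J lm lp ε d h b f) - J lm lp ε d h b g) = _
    rw [inner_sub_right, hwA]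
    have e1 : inner ℂ (JTilde lm lp ε d h b u) f =
        inner ℂ (JTilde lm lp ε d h b u) (f - g) + inner ℂ (JTilde lm lp ε d h b u) g := by
      rw [inner_sub_right, sub_add_cancel]
    have e2 : inner ℂ w (J lm lp ε d h b g) = inner ℂ (w - u) j + inner ℂ u (J lm lp ε d h b g) -
        inner ℂ (w - u) p₀ := by
      rw [hjJ, inner_add_right, inner_sub_left, inner_sub_left]
      ring
    rw [e1, e2, E0, E1', huJ, inner_add_right, hk₁l, hk₂p, map_add, map_mul, map_mul,
      Complex.conj_ofReal, Complex.conj_ofReal]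
    push_cast
    ring
  obtain ⟨hsu, -⟩ := section_fst_memLp u (by linarith : -ε ≤ 0) (strip_subset lm lp ε d h b)
  obtain ⟨hsk, -⟩ := section_fst_memLp k₁ (by linarith : -ε ≤ 0) (strip_subset lm lp ε d h b)
  obtain ⟨Fc, hFc1, hFc2, hFc3⟩ := (hk₁.section_fst (by linarith : -ε < 0)
    (strip_subset lm lp ε d h b)).exists_continuousOn hΩ₀ hord hsu.locallyIntegrableOn_restrict
    hsk.locallyIntegrableOn_restrict
  have hmF : m = (e : ℂ) * Fc 0 := by
    refine pointValue_eq (Fc := fun x => (e : ℂ) * Fc x) hΩ₀ (continuousOn_const.mul hFc1) ?_ h0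
    filter_upwards [JTilde_fst_ae lm lp ε d h b u, hFc2] with x h1 h2
    rw [h1, h2]
  have hflux := norm_flux_add_le hk₁ hk₂ hun hk₁n hk₂n hd hdh hdε hdb hbn hεn
    (tall_subset_waveguide hd hh hdb (Ioo_subset_Icc_self.trans hdI))
    (strip_subset lm lp ε d h b)
    ((Ioo_subset_Ioo (by linarith) (by linarith) : _ ⊆ Ioo (-ρ) ρ).trans hI)
    (by rw [← room_eq_prod]; exact room_subset lm lp ε d h b) hFc2 hFc3
  rw [← passage_eq_prod] at hflux
  -- The relation `h⁻¹ = γ ε d⁻¹` gives point value and flux a common prefactor; this fixes the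
  -- strength of the δ-interaction as `γ`.
  have hT : (γ : ℂ) * m + ((h⁻¹ * e : ℝ) : ℂ) * ∫ x in passage d h, k₂ x =
      (e * γ * ε : ℝ) • (d⁻¹ • (∫ x in passage d h, k₂ x) + ε⁻¹ • Fc 0) := by
    have e1 : h⁻¹ = γ * ε * d⁻¹ := by
      rw [hdγ]
      field_simp
    rw [hmF, e1]
    have hε' : (ε : ℂ) ≠ 0 := by exact_mod_cast hε.ne'
    simp only [Complex.real_smul]
    push_cast
    field_simp
    ring
  rw [key, hT]
  have t1 : ‖a * conj ((e * γ * ε : ℝ) • (d⁻¹ • (∫ x in passage d h, k₂ x) + ε⁻¹ • Fc 0))‖ ≤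
      M * (e * γ * ε * ((5 + 10 * n + b⁻¹) * ‖w‖)) := by
    rw [norm_mul, RCLike.norm_conj, norm_smul, Real.norm_of_nonneg (by positivity)]
    exact mul_le_mul hb1 (mul_le_mul_of_nonneg_left hflux (by positivity)) (by positivity) hM0
  have t2 : ‖inner ℂ k₁ p₁‖ ≤ ‖w‖ * (e * M * √(d * h)) :=
    (norm_inner_le_norm _ _).trans (mul_le_mul hk₁n hp₁n (norm_nonneg _) (norm_nonneg _))
  have t3 : ‖inner ℂ k₂ r‖ ≤ ‖w‖ * (h⁻¹ * (e * d + b⁻¹) * M * √(d * h)) :=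
    (norm_inner_le_norm _ _).trans (mul_le_mul hk₂n hrn (norm_nonneg _) (norm_nonneg _))
  have t4 : ‖inner ℂ (w - u) p₀‖ ≤ (2 * ‖w‖) * ((e + 2 * b⁻¹) * M * √(d * h)) := by
    refine (norm_inner_le_norm _ _).trans (mul_le_mul ?_ hp₀n (norm_nonneg _) (by positivity))
    exact (norm_sub_le _ _).trans (by linarith)
  refine (norm_add_le _ _).trans ((add_le_add (norm_sub_le _ _) le_rfl).trans ?_)
  refine (add_le_add (add_le_add (norm_sub_le _ _) le_rfl) le_rfl).trans
    ((add_le_add (add_le_add (add_le_add t1 t2) t3) t4).trans (le_of_eq ?_))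
  rw [hC, hM]
  ring

end Difference

/-! ### Orders of magnitude -/

/-- The number of doublings is of order `log d⁻¹`, and `d ≥ ε^(α+2)` because `ε < γ`. By `log ε⁻¹ ≤
β⁻¹ ε^(-β)` the logarithm is absorbed into the factor `b⁻¹ = ε^(-β)`, which the mean over the room
costs anyway. -/
theorem exists_nat_two_pow_mul_ge {K α β γ ε d : ℝ} (hα0 : 0 < α) (hαK : α ≤ K) (hβ : 0 < β)
    (hβK : β⁻¹ ≤ K) (hε : 0 < ε) (hε1 : ε < 1) (hεγ : ε < γ) (hd : d = γ * ε ^ (α + 1)) :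
    ∃ n : ℕ, 1 ≤ 2 ^ n * d ∧ (n : ℝ) ≤ (2 * (K + 2) * K + 1) * ε ^ (-β) := by
  have hK : 0 < K := hα0.trans_le hαK
  have hγ : 0 < γ := hε.trans hεγ
  have hd0 : 0 < d := by
    rw [hd]
    positivity
  have hεβ : 1 ≤ ε ^ (-β) := Real.one_le_rpow_of_pos_of_le_one_of_nonpos hε hε1.le (by linarith)
  have hle : ε⁻¹ = ε ^ (-1 : ℝ) := (Real.rpow_neg_one ε).symm
  have hlog : Real.log d⁻¹ ≤ (K + 2) * (K * ε ^ (-β)) := by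
    have h1 : ε ^ (α + 2) ≤ d := by
      rw [hd, show α + 2 = 1 + (α + 1) by ring, Real.rpow_add hε, Real.rpow_one]
      exact mul_le_mul_of_nonneg_right hεγ.le (Real.rpow_pos_of_pos hε _).le
    have h2 : Real.log d⁻¹ ≤ (α + 2) * Real.log ε⁻¹ := by
      rw [Real.log_inv, Real.log_inv]
      have := Real.log_le_log (Real.rpow_pos_of_pos hε _) h1
      rw [Real.log_rpow hε] at this
      linarith
    have h3 : Real.log ε⁻¹ ≤ K * ε ^ (-β) := by
      refine (Real.log_le_rpow_div (inv_pos.2 hε).le hβ).trans ?_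
      rw [Real.inv_rpow hε.le, ← Real.rpow_neg hε.le, div_eq_inv_mul]
      exact mul_le_mul_of_nonneg_right hβK (by linarith)
    have h4 : 0 ≤ Real.log ε⁻¹ := Real.log_nonneg ((one_le_inv₀ hε).2 hε1.le)
    exact h2.trans (mul_le_mul (by linarith) h3 h4 (by linarith))
  have hlog2 : 1 / 2 ≤ Real.log 2 := by linarith [Real.log_two_gt_d9]
  -- The factor `2` compensates `log 2 ≥ 1 / 2`. Rounding up adds at most `1`, which is at most
  -- `ε^(-β)`.
  refine ⟨⌈2 * ((K + 2) * (K * ε ^ (-β)))⌉₊, ?_, ?_⟩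
  · have h1 := Nat.le_ceil (2 * ((K + 2) * (K * ε ^ (-β))))
    have h2 : Real.log d⁻¹ ≤ ⌈2 * ((K + 2) * (K * ε ^ (-β)))⌉₊ * Real.log 2 := by
      have h3 := mul_le_mul h1 hlog2 (by norm_num) (Nat.cast_nonneg _)
      linarith
    rw [← Real.log_pow, Real.log_le_log_iff (inv_pos.2 hd0) (by positivity)] at h2
    rwa [inv_eq_one_div, div_le_iff₀ hd0] at h2
  · have h1 := (Nat.ceil_lt_add_one (show 0 ≤ 2 * ((K + 2) * (K * ε ^ (-β))) by positivity)).le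
    linarith

/-- Since `√(d h) = √γ ε^(α+1/2)`, every term becomes a power of `ε`. The flux term and `h⁻¹ b⁻¹ √(d
h)` have order `ε^(1/2-β)`; the others are at most of order `ε^α`, using `β < 1/2` for `b⁻¹ √(d h)`.
The coefficient `8K` collects `1 + 1 + 2 + 4` such terms, and `K * K` comes from `h⁻¹ d = γ ε`. -/
theorem error_terms_le {K α β γ ε d h b : ℝ} {n : ℕ} (hK : 2 ≤ K) (hβ : 0 < β)
    (hβ2 : β < 1 / 2) (hγ : 0 < γ) (hγK : γ ≤ K) (hε : 0 < ε) (hε1 : ε < 1)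
    (hd : d = γ * ε ^ (α + 1)) (hh : h = ε ^ α) (hb : b = ε ^ β)
    (hn : (n : ℝ) ≤ (2 * (K + 2) * K + 1) * ε ^ (-β)) :
    ε ^ (-(1 / 2) : ℝ) * γ * ε * (5 + 10 * n + b⁻¹) +
        ε ^ (-(1 / 2) : ℝ) * √(d * h) + h⁻¹ * (ε ^ (-(1 / 2) : ℝ) * d + b⁻¹) * √(d * h) +
        2 * (ε ^ (-(1 / 2) : ℝ) + 2 * b⁻¹) * √(d * h) ≤
      (K * (16 + 20 * (K + 2) * K) + 8 * K + K * K) * ε ^ min α (1 / 2 - β) := by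
  have hanti : ∀ x y : ℝ, y ≤ x → ε ^ x ≤ ε ^ y := fun x y hxy =>
    Real.rpow_le_rpow_of_exponent_ge hε hε1.le hxy
  have hadd : ∀ x y : ℝ, ε ^ x * ε ^ y = ε ^ (x + y) := fun x y => (Real.rpow_add hε x y).symm
  have hpos : ∀ x : ℝ, 0 < ε ^ x := fun x => Real.rpow_pos_of_pos hε x
  set τ := ε ^ min α (1 / 2 - β) with hτ
  have hτα : ε ^ α ≤ τ := hanti _ _ (min_le_left _ _)
  have hτβ : ε ^ (1 / 2 - β) ≤ τ := hanti _ _ (min_le_right _ _)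
  have hτ0 : 0 < τ := hpos _
  have hε1' : ε = ε ^ (1 : ℝ) := (Real.rpow_one ε).symm
  have hbi : b⁻¹ = ε ^ (-β) := by rw [hb, Real.rpow_neg hε.le]
  have hhi : h⁻¹ = ε ^ (-α) := by rw [hh, Real.rpow_neg hε.le]
  have hβ1 : 1 ≤ ε ^ (-β) := Real.one_le_rpow_of_pos_of_le_one_of_nonpos hε hε1.le (by linarith)
  have hsγ : √γ ≤ K := by
    rw [Real.sqrt_le_left (by linarith)]
    nlinarith
  have hsq : √(d * h) = √γ * ε ^ (α + 1 / 2) := by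
    have : d * h = γ * (ε ^ (α + 1 / 2) * ε ^ (α + 1 / 2)) := by
      rw [hd, hh, mul_assoc, hadd, hadd]
      ring_nf
    rw [this, Real.sqrt_mul hγ.le, Real.sqrt_mul_self (hpos _).le]
  have a1 : ε ^ (-(1 / 2) : ℝ) * √(d * h) ≤ K * τ := by
    rw [hsq, mul_left_comm, hadd]
    exact mul_le_mul hsγ ((hanti _ _ (by linarith)).trans hτα) (hpos _).le (by linarith)
  have a2 : b⁻¹ * √(d * h) ≤ K * τ := by
    rw [hsq, hbi, mul_left_comm, hadd]
    exact mul_le_mul hsγ ((hanti _ _ (by linarith)).trans hτα) (hpos _).le (by linarith)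
  have a3 : h⁻¹ * b⁻¹ * √(d * h) ≤ K * τ := by
    rw [hsq, hbi, hhi, hadd, mul_left_comm, hadd]
    exact mul_le_mul hsγ ((hanti _ _ (by linarith)).trans hτβ) (hpos _).le (by linarith)
  have a4 : h⁻¹ * d * (ε ^ (-(1 / 2) : ℝ) * √(d * h)) ≤ K * (K * τ) := by
    have : h⁻¹ * d ≤ K := by
      rw [hhi, hd, mul_left_comm, hadd]
      have : ε ^ (-α + (α + 1)) ≤ 1 := Real.rpow_le_one hε.le hε1.le (by linarith)
      nlinarith [hpos (-α + (α + 1))]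
    exact mul_le_mul this a1 (mul_nonneg (hpos _).le (Real.sqrt_nonneg _)) (by linarith)
  have a5 : ε ^ (-(1 / 2) : ℝ) * γ * ε * (5 + 10 * n + b⁻¹) ≤ K * (16 + 20 * (K + 2) * K) * τ := by
    have e1 : ε ^ (-(1 / 2) : ℝ) * γ * ε = γ * ε ^ (1 / 2 : ℝ) := by
      rw [mul_assoc, mul_left_comm]
      nth_rewrite 2 [hε1']
      rw [hadd]
      norm_num
    have e2 : 5 + 10 * n + b⁻¹ ≤ (16 + 20 * (K + 2) * K) * ε ^ (-β) := by
      rw [hbi]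
      linarith
    have e3 : ε ^ (1 / 2 : ℝ) * ε ^ (-β) ≤ τ := by
      rw [hadd]
      exact hτβ
    rw [e1]
    calc γ * ε ^ (1 / 2 : ℝ) * (5 + 10 * n + b⁻¹)
        ≤ γ * ε ^ (1 / 2 : ℝ) * ((16 + 20 * (K + 2) * K) * ε ^ (-β)) :=
          mul_le_mul_of_nonneg_left e2 (mul_pos hγ (hpos _)).le
      _ = γ * (16 + 20 * (K + 2) * K) * (ε ^ (1 / 2 : ℝ) * ε ^ (-β)) := by ring
      _ ≤ K * (16 + 20 * (K + 2) * K) * τ := by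
          have h16 : 0 ≤ 16 + 20 * (K + 2) * K := by positivity
          exact mul_le_mul (mul_le_mul_of_nonneg_right hγK h16) e3
            (mul_pos (hpos _) (hpos _)).le (by positivity)
  nlinarith

theorem theorem2p1 (K : ℝ) :
    ∃ C : ℝ, 0 < C ∧
      ∀ (lm lp : EReal) (α β γ : ℝ) (V₀ : ℝ → ℝ) (ε₀ ε d h b : ℝ),
        lm < 0 → 0 < lp →
        0 < α → 0 < β → β < 1 / 2 → 0 < γ →
        MemLp V₀ ⊤ (volume.restrict (interval lm lp)) →
        (∀ᵐ x ∂(volume.restrict (interval lm lp)), 0 ≤ V₀ x) →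
        -- the parameters on whose upper bounds the constant may depend
        α ≤ K → β⁻¹ ≤ K → γ ≤ K →
        lm ≤ ((-K⁻¹ : ℝ) : EReal) → ((K⁻¹ : ℝ) : EReal) ≤ lp →
        eLpNorm V₀ ⊤ (volume.restrict (interval lm lp)) ≤ ENNReal.ofReal K →
        -- smallness of `ε₀`
        ε₀ < (2 * γ) ^ (-1 / α) → lm < ((-ε₀ : ℝ) : EReal) → (ε₀ : EReal) < lp →
        ε₀ < γ ^ (-1 / (α + 1 - β)) → ε₀ < min γ γ⁻¹ →
        0 < ε → ε ≤ ε₀ →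
        d = γ * ε ^ (α + 1) → h = ε ^ α → b = ε ^ β →
        IsResolvent (neumannGraph (waveguide lm lp ε d h b) (potential lm lp ε V₀))
          (formResolvent (neumannGraph (waveguide lm lp ε d h b) (potential lm lp ε V₀))) ∧
        IsResolvent (limitGraph (interval lm lp) V₀ γ)
          (formResolvent (limitGraph (interval lm lp) V₀ γ)) ∧
        ‖formResolvent (neumannGraph (waveguide lm lp ε d h b) (potential lm lp ε V₀)) ∘L
              J lm lp ε d h b -
            J lm lp ε d h b ∘L formResolvent (limitGraph (interval lm lp) V₀ γ)‖ =
          ‖JTilde lm lp ε d h b ∘L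
              formResolvent (neumannGraph (waveguide lm lp ε d h b) (potential lm lp ε V₀)) -
            formResolvent (limitGraph (interval lm lp) V₀ γ) ∘L JTilde lm lp ε d h b‖ ∧
        ‖formResolvent (neumannGraph (waveguide lm lp ε d h b) (potential lm lp ε V₀)) ∘L
              J lm lp ε d h b -
            J lm lp ε d h b ∘L formResolvent (limitGraph (interval lm lp) V₀ γ)‖ ≤
          C * ε ^ min α (1 / 2 - β) := by
  -- For `K ≤ 2` there are no admissible data, as `β < 1/2` forces `β⁻¹ > 2`.
  rcases le_or_gt K 2 with hK2 | hK2
  · refine ⟨1, one_pos, fun lm lp α β γ V₀ ε₀ ε d h b _ _ _ hβ hβ2 _ _ _ _ hβK => ?_⟩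
    have : 2 < β⁻¹ := by
      rw [lt_inv_comm₀ (by norm_num) hβ]
      linarith
    linarith
  refine ⟨(2 * K + 2) * (K * (16 + 20 * (K + 2) * K) + 8 * K + K * K), by positivity, ?_⟩
  intro lm lp α β γ V₀ ε₀ ε d h b hlm hlp hα hβ hβ2 hγ hV hV0 hαK hβK hγK hlmK hlpK hVK hε₀α hlmε
    hlpε _ hε₀γ hε hεε₀ hd hh hb
  have h0 : (0 : ℝ) ∈ interval lm lp := ⟨hlm, hlp⟩
  have hA := neumannResolvent_spec (isOpen_waveguide lm lp ε d h b)
    (memLp_potential (ε := ε) d h b hV) (ae_potential_nonneg d h b hV0)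
  have hB := limitResolvent_spec (isOpen_interval lm lp) (ordConnected_interval lm lp) h0 hV hV0
    hγ.le
  refine ⟨hA.1, hB.1, norm_resolvent_differences_eq lm lp ε d h b hA.2.1 hB.2.1, ?_⟩
  have hεγ : ε < γ := hεε₀.trans_lt (hε₀γ.trans_le (min_le_left _ _))
  have hεγ' : ε < γ⁻¹ := hεε₀.trans_lt (hε₀γ.trans_le (min_le_right _ _))
  have hγε : γ * ε < 1 := by
    rwa [lt_inv_comm₀ hε hγ, lt_inv_comm₀ hγ hε, inv_eq_one_div, lt_div_iff₀ hγ, mul_comm] at hεγ'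
  have hε1 : ε < 1 := by nlinarith
  have hd0 : 0 < d := by
    rw [hd]
    positivity
  have hh0 : 0 < h := by
    rw [hh]
    positivity
  have hdγ : d = γ * ε * h := by
    rw [hd, hh, Real.rpow_add hε, Real.rpow_one]
    ring
  have hdh : d ≤ h := by
    rw [hdγ]
    exact mul_le_of_le_one_left hh0.le hγε.le
  -- The bound by `(2γ)^(-1/α)` gives even `1 / 2` here; it makes the passage narrower than the
  -- strip is high.
  have hγα : γ * ε ^ α ≤ 1 := by
    have h1 : ε ^ α ≤ ((2 * γ) ^ (-1 / α)) ^ α :=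
      Real.rpow_le_rpow hε.le (hεε₀.trans hε₀α.le) hα.le
    rw [← Real.rpow_mul (by positivity), div_mul_cancel₀ _ hα.ne', Real.rpow_neg_one] at h1
    have h2 := mul_le_mul_of_nonneg_left h1 hγ.le
    have h3 : γ * (2 * γ)⁻¹ = 1 / 2 := by field_simp
    linarith
  have hdε : d ≤ ε := by
    rw [hdγ, hh, mul_right_comm]
    exact mul_le_of_le_one_left hε.le hγα
  have hb1 : b ≤ 1 := by
    rw [hb]
    exact Real.rpow_le_one hε.le hε1.le hβ.le
  have hεb : ε ≤ b := by
    rw [hb]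
    exact Real.self_le_rpow_of_le_one hε.le hε1.le (by linarith)
  obtain ⟨n, hn1, hn2⟩ := exists_nat_two_pow_mul_ge hα hαK hβ hβK hε hε1 hεγ hd
  have hK0 : 0 < K := by linarith
  -- The radius must be at least `ε`, for the square below the passage to fit into the strip, and at
  -- least `K⁻¹`, for the sup bounds to be uniform in `ε`. The hypotheses on the end points provide
  -- both.
  have hI : Ioo (-max ε K⁻¹) (max ε K⁻¹) ⊆ interval lm lp := by
    intro x hx
    rcases max_cases ε K⁻¹ with ⟨hm, -⟩ | ⟨hm, -⟩
    · rw [hm] at hx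
      exact ⟨hlmε.trans_le (EReal.coe_le_coe_iff.2 (by linarith [hx.1])),
        (EReal.coe_le_coe_iff.2 (by linarith [hx.2])).trans_lt hlpε⟩
    · rw [hm] at hx
      exact ⟨hlmK.trans_lt (EReal.coe_lt_coe_iff.2 hx.1),
        (EReal.coe_lt_coe_iff.2 hx.2).trans_le hlpK⟩
  refine (norm_resolvent_difference_le hε hd0 hh0 hdh hdε (hdε.trans hεb) hdγ hγ (hb1.trans hn1)
    (hε1.le.trans hn1) (by linarith) (le_max_right _ _)
    (max_le hε1.le (inv_le_one_of_one_le₀ (by linarith))) (le_max_left _ _) hI hV hV0 hVK).trans ?_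
  exact (mul_le_mul_of_nonneg_left
    (error_terms_le hK2.le hβ hβ2 hγ hγK hε hε1 hd hh hb hn2)
    (show 0 ≤ 2 * K + 2 by positivity)).trans (le_of_eq (mul_assoc _ _ _).symm)
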